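/- Let $(\mathcal X,d)$ be a metric space, $\ell\ge 1$ a real number, $k\ge 1$ and $m\ge 0$ integers, $C\subseteq\mathcal X$ a finite set of clients with $|C|\ge m$ and $L\subseteq\mathcal X$ a finite set of facility locations with $|L|\ge k$; put $n=|C|+|L|$. A feasible solution of the outlier $k$-service problem is a set $Z\subseteq C$ with $|Z|=m$ together with a partition $\mathcal C=\{C_1,\dots,C_k\}$ of $C\setminus Z$ into $k$ (possibly empty) clusters. A $k$-center-set is a set $F=\{f_1,\dots,f_k\}$ of $k$ distinct elements of $L$, and $$\Psi(F,\mathcal C)=\min_{\pi}\sum_{i=1}^{k}\sum_{x\in C_i}d(x,f_{\pi(i)})^{\ell},\qquad \Psi^*(\mathcal C)=\min_{F}\Psi(F,\mathcal C),$$ where $\pi$ ranges over the permutations of $\{1,\dots,k\}$ and $F$ over the $k$-center-sets. Let $\mathrm{OPT}$ be the minimum of $\Psi^*(\mathcal C)$ over all feasible solutions $(Z,\mathcal C)$. **Theorem.** There are a single randomized algorithm and an absolute constant $c>0$ such that for every such instance and every $0<\varepsilon\le 1$ the algorithm, given $|C|,|L|,k,m,\ell,\varepsilon$ and access to the pairwise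 distances of the points of $C$ and $L$ (each listed in an arbitrary order), always halts within $$c\cdot n\cdot \max\Big\{2,\ \frac{k+m}{\varepsilon}\Big\}^{c\,k\,\ell^{2}}$$ steps and, with probability at least $1/2$, outputs a feasible solution $(Z,\mathcal C)$ and a $k$-center-set $F$ with $$\Psi^*(\mathcal C)\le\Psi(F,\mathcal C)\le(3^{\ell}+\varepsilon)\cdot\mathrm{OPT}.$$ If $C\subseteq L$, then with probability at least $1/2$ its output even satisfies $\Psi(F,\mathcal C)\le(2^{\ell}+\varepsilon)\cdot\mathrm{OPT}$. Running time is counted on a randomized real RAM: a fixed program with natural and real arrays and natural-number constants, in which each memory access, addition or truncated subtraction of naturals, field operation on reals, conversion of a natural to a real, evaluation of $x\mapsto|x|^{\ell}$, distance query, exact comparison, draw of a uniform random real in $[0,1]$, and control-flow command costs one step. -/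

import Mathlib

/-! ## The outlier `k`-service problem -/

/-- An instance: clients `C`, facility locations `L`, number `k ≥ 1` of centers, number `m` of
outliers. There must be `k` locations and `m` clients to choose from. -/
structure OutlierInstance (X : Type*) where
  C : Finset X
  L : Finset X
  k : ℕ
  m : ℕ
  k_pos : 0 < k
  k_le : k ≤ L.card
  m_le : m ≤ C.card

namespace OutlierInstance

variable {X : Type*} (I : OutlierInstance X)

/-- `f` enumerates a `k`-center-set: `k` distinct elements of `L`. -/
def IsCenterSet (f : Fin I.k → X) : Prop :=
  Function.Injective f ∧ ∀ j, f j ∈ I.L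

/-- A feasible solution: a set `Z ⊆ C` of exactly `m` outliers, and a partition
`𝒞 0, …, 𝒞 (k-1)` of `C \ Z` into `k` (possibly empty) clusters. -/
def IsOutlierClustering (Z : Finset X) (𝒞 : Fin I.k → Finset X) : Prop :=
  Z ⊆ I.C ∧ Z.card = I.m ∧ Pairwise (fun i j => Disjoint (𝒞 i) (𝒞 j)) ∧
    ∀ x, (∃ j, x ∈ 𝒞 j) ↔ (x ∈ I.C ∧ x ∉ Z)

variable [MetricSpace X] (ℓ : ℝ)

/-- `Ψ(F, 𝒞)`: the cheapest way to match the `k` clusters with the `k` centers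
(a minimum over the finitely many permutations). -/
noncomputable def Psi (f : Fin I.k → X) (𝒞 : Fin I.k → Finset X) : ℝ :=
  ⨅ π : Equiv.Perm (Fin I.k), ∑ j, ∑ x ∈ 𝒞 j, dist x (f (π j)) ^ ℓ

/-- `Ψ*(𝒞)`: the minimum of `Ψ(F, 𝒞)` over all `k`-center-sets `F`. -/
noncomputable def PsiStar (𝒞 : Fin I.k → Finset X) : ℝ :=
  sInf {r | ∃ f, I.IsCenterSet f ∧ r = I.Psi ℓ f 𝒞}

/-- The optimum: the minimum of `Ψ*(𝒞)` over all feasible solutions. -/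
noncomputable def opt : ℝ :=
  sInf {r | ∃ Z 𝒞, I.IsOutlierClustering Z 𝒞 ∧ r = I.PsiStar ℓ 𝒞}

end OutlierInstance

/-! ## A randomized real RAM

Programs are fixed finite objects. The memory has natural and real arrays; an array is named by a
constant of the program, its cells are addressed by computed indices. The basic operations are:
addition and truncated subtraction of naturals; the four field operations on reals; the map
`x ↦ |x| ^ ℓ`; the distance oracle; the embedding of naturals into the reals; exact comparisons;
drawing a uniform real of `[0, 1]`. There is no rounding of reals and the only constants are
natural numbers. Every operation, memory access, comparison and command costs one step. -/

namespace RealRAM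

/-- What a program may access besides its memory: pairwise distances of the input points, given by
their indices, and the exponent `ℓ`. -/
structure Env where
  dist : ℕ → ℕ → ℝ
  ell : ℝ

/-- Memory contents (cell `i` of array `a` is `nat a i`, resp. `real a i`) and the random numbers
that have not been used yet. -/
structure State where
  nat : ℕ → ℕ → ℕ
  real : ℕ → ℕ → ℝ
  tape : ℕ → unitInterval

inductive NExp where
  | const (c : ℕ)
  | get (a : ℕ) (i : NExp)
  | add (e₁ e₂ : NExp)
  | sub (e₁ e₂ : NExp)

inductive RExp where
  | ofNat (e : NExp)
  | get (a : ℕ) (i : NExp)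
  | dist (i j : NExp)
  | add (e₁ e₂ : RExp)
  | sub (e₁ e₂ : RExp)
  | mul (e₁ e₂ : RExp)
  | div (e₁ e₂ : RExp)
  | powEll (e : RExp)

inductive BExp where
  | natLt (e₁ e₂ : NExp)
  | realLt (e₁ e₂ : RExp)
  | not (b : BExp)

inductive Cmd where
  | skip
  | setNat (a : ℕ) (i : NExp) (e : NExp)
  | setReal (a : ℕ) (i : NExp) (e : RExp)
  | sample (a : ℕ) (i : NExp)
  | seq (c₁ c₂ : Cmd)
  | branch (b : BExp) (c₁ c₂ : Cmd)
  | loop (b : BExp) (c : Cmd)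

def NExp.eval (σ : State) : NExp → ℕ
  | .const c => c
  | .get a i => σ.nat a (i.eval σ)
  | .add e₁ e₂ => e₁.eval σ + e₂.eval σ
  | .sub e₁ e₂ => e₁.eval σ - e₂.eval σ

def NExp.cost : NExp → ℕ
  | .const _ => 1
  | .get _ i => i.cost + 1
  | .add e₁ e₂ => e₁.cost + e₂.cost + 1
  | .sub e₁ e₂ => e₁.cost + e₂.cost + 1

noncomputable def RExp.eval (E : Env) (σ : State) : RExp → ℝ
  | .ofNat e => (e.eval σ : ℝ)
  | .get a i => σ.real a (i.eval σ)
  | .dist i j => E.dist (i.eval σ) (j.eval σ)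
  | .add e₁ e₂ => e₁.eval E σ + e₂.eval E σ
  | .sub e₁ e₂ => e₁.eval E σ - e₂.eval E σ
  | .mul e₁ e₂ => e₁.eval E σ * e₂.eval E σ
  | .div e₁ e₂ => e₁.eval E σ / e₂.eval E σ
  | .powEll e => |e.eval E σ| ^ E.ell

def RExp.cost : RExp → ℕ
  | .ofNat e => e.cost + 1
  | .get _ i => i.cost + 1
  | .dist i j => i.cost + j.cost + 1
  | .add e₁ e₂ => e₁.cost + e₂.cost + 1
  | .sub e₁ e₂ => e₁.cost + e₂.cost + 1
  | .mul e₁ e₂ => e₁.cost + e₂.cost + 1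
  | .div e₁ e₂ => e₁.cost + e₂.cost + 1
  | .powEll e => e.cost + 1

def BExp.holds (E : Env) (σ : State) : BExp → Prop
  | .natLt e₁ e₂ => e₁.eval σ < e₂.eval σ
  | .realLt e₁ e₂ => e₁.eval E σ < e₂.eval E σ
  | .not b => ¬ b.holds E σ

def BExp.cost : BExp → ℕ
  | .natLt e₁ e₂ => e₁.cost + e₂.cost + 1
  | .realLt e₁ e₂ => e₁.cost + e₂.cost + 1
  | .not b => b.cost + 1

def State.setNat (σ : State) (a i v : ℕ) : State :=
  { σ with nat := Function.update σ.nat a (Function.update (σ.nat a) i v) }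

def State.setReal (σ : State) (a i : ℕ) (v : ℝ) : State :=
  { σ with real := Function.update σ.real a (Function.update (σ.real a) i v) }

/-- Store the next random number and remove it from the tape. -/
def State.draw (σ : State) (a i : ℕ) : State :=
  { σ.setReal a i (σ.tape 0 : ℝ) with tape := fun t => σ.tape (t + 1) }

/-- `Exec E c σ t τ`: started in `σ`, the command `c` halts after exactly `t` steps in `τ`. -/
inductive Exec (E : Env) : Cmd → State → ℕ → State → Prop
  | skip (σ : State) : Exec E .skip σ 1 σ
  | setNat (a : ℕ) (i e : NExp) (σ : State) :
      Exec E (.setNat a i e) σ (i.cost + e.cost + 1) (σ.setNat a (i.eval σ) (e.eval σ))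
  | setReal (a : ℕ) (i : NExp) (e : RExp) (σ : State) :
      Exec E (.setReal a i e) σ (i.cost + e.cost + 1) (σ.setReal a (i.eval σ) (e.eval E σ))
  | sample (a : ℕ) (i : NExp) (σ : State) :
      Exec E (.sample a i) σ (i.cost + 1) (σ.draw a (i.eval σ))
  | seq {c₁ c₂ : Cmd} {σ τ ρ : State} {s t : ℕ} :
      Exec E c₁ σ s τ → Exec E c₂ τ t ρ → Exec E (.seq c₁ c₂) σ (s + t + 1) ρ
  | branch_true {b : BExp} {c₁ c₂ : Cmd} {σ τ : State} {t : ℕ} :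
      b.holds E σ → Exec E c₁ σ t τ → Exec E (.branch b c₁ c₂) σ (b.cost + t + 1) τ
  | branch_false {b : BExp} {c₁ c₂ : Cmd} {σ τ : State} {t : ℕ} :
      ¬ b.holds E σ → Exec E c₂ σ t τ → Exec E (.branch b c₁ c₂) σ (b.cost + t + 1) τ
  | loop_false {b : BExp} {c : Cmd} {σ : State} :
      ¬ b.holds E σ → Exec E (.loop b c) σ (b.cost + 1) σ
  | loop_true {b : BExp} {c : Cmd} {σ τ ρ : State} {s t : ℕ} :
      b.holds E σ → Exec E c σ s τ → Exec E (.loop b c) τ t ρ →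
        Exec E (.loop b c) σ (b.cost + s + t + 1) ρ

/-- For a given tape, the number of steps and the final state are determined. -/
theorem Exec.unique {E : Env} {c : Cmd} {σ τ : State} {t : ℕ} (h : Exec E c σ t τ) :
    ∀ {t' : ℕ} {τ' : State}, Exec E c σ t' τ' → t = t' ∧ τ = τ' := by
  induction h with
  | skip => intro _ _ h'; cases h'; exact ⟨rfl, rfl⟩
  | setNat => intro _ _ h'; cases h'; exact ⟨rfl, rfl⟩
  | setReal => intro _ _ h'; cases h'; exact ⟨rfl, rfl⟩
  | sample => intro _ _ h'; cases h'; exact ⟨rfl, rfl⟩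
  | seq _ _ ih₁ ih₂ =>
    intro _ _ h'
    cases h' with
    | seq h₁ h₂ =>
      obtain ⟨rfl, rfl⟩ := ih₁ h₁
      obtain ⟨rfl, rfl⟩ := ih₂ h₂
      exact ⟨rfl, rfl⟩
  | branch_true hb _ ih =>
    intro _ _ h'
    cases h' with
    | branch_true _ h₁ => obtain ⟨rfl, rfl⟩ := ih h₁; exact ⟨rfl, rfl⟩
    | branch_false hn _ => exact absurd hb hn
  | branch_false hb _ ih =>
    intro _ _ h'
    cases h' with
    | branch_true hn _ => exact absurd hn hb
    | branch_false _ h₁ => obtain ⟨rfl, rfl⟩ := ih h₁; exact ⟨rfl, rfl⟩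
  | loop_false hb =>
    intro _ _ h'
    cases h' with
    | loop_false _ => exact ⟨rfl, rfl⟩
    | loop_true hn _ _ => exact absurd hn hb
  | loop_true hb _ _ ih₁ ih₂ =>
    intro _ _ h'
    cases h' with
    | loop_false hn => exact absurd hb hn
    | loop_true _ h₁ h₂ =>
      obtain ⟨rfl, rfl⟩ := ih₁ h₁
      obtain ⟨rfl, rfl⟩ := ih₂ h₂
      exact ⟨rfl, rfl⟩

/-- The law of the tape: independent uniform random numbers in `[0, 1]`. -/
noncomputable def tapeLaw : MeasureTheory.Measure (ℕ → unitInterval) :=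
  MeasureTheory.Measure.infinitePi fun _ => (MeasureTheory.volume : MeasureTheory.Measure unitInterval)

end RealRAM

/-! ## Input and output conventions -/

/-- An instance as it is presented to a program: the clients and the locations are listed in some
order. -/
structure ListedInstance (X : Type*) extends OutlierInstance X where
  client : Fin C.card ≃ {x // x ∈ C}
  location : Fin L.card ≃ {x // x ∈ L}

namespace ListedInstance

open RealRAM

variable {X : Type*} (I : ListedInstance X)

/-- The input size `n = |C| + |L|`. -/
def n : ℕ := I.C.card + I.L.card

/-- The indices `0, …, |C| - 1` denote the clients, the next `|L|` indices the locations. -/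
def point (i : Fin I.n) : X :=
  Fin.addCases (fun a => (I.client a : X)) (fun b => (I.location b : X)) i

/-- The distance oracle and the exponent (distances to nonexistent points are answered by `0`). -/
noncomputable def env [MetricSpace X] (ℓ : ℝ) : Env where
  dist i j := if h : i < I.n ∧ j < I.n then dist (I.point ⟨i, h.1⟩) (I.point ⟨j, h.2⟩) else 0
  ell := ℓ

/-- The initial memory: the natural array `0` starts with `|C|, |L|, k, m`, the real array `0`
starts with `ε, ℓ`, everything else is `0`. -/
def init (ℓ ε : ℝ) (ω : ℕ → unitInterval) : State where
  nat a i := if a = 0 then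
    (if i = 0 then I.C.card else if i = 1 then I.L.card else
      if i = 2 then I.k else if i = 3 then I.m else 0) else 0
  real a i := if a = 0 then (if i = 0 then ε else if i = 1 then ℓ else 0) else 0
  tape := ω

/-- The clients whose label (the entry of the natural array `2`) satisfies `p`. -/
def labelled (σ : State) (p : ℕ → Prop) [DecidablePred p] : Finset X :=
  (Finset.univ.filter fun i : Fin I.C.card => p (σ.nat 2 i)).map
    (I.client.toEmbedding.trans (Function.Embedding.subtype _))

/-- Output: the natural array `1` starts with the indices in `{0, …, |L| - 1}` of `k` distinct
locations `f`; label `j < k` puts a client into cluster `j`, any other label makes it an outlier.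
The output is good for `ρ` if it is a feasible solution with `Ψ(F, 𝒞) ≤ ρ · opt`. -/
def IsApproxOutput [MetricSpace X] (ℓ ρ : ℝ) (σ : State) : Prop :=
  ∃ f : Fin I.k → X,
    (∀ j : Fin I.k, ∃ h : σ.nat 1 j < I.L.card, f j = I.location ⟨σ.nat 1 j, h⟩) ∧
    I.IsCenterSet f ∧
    I.IsOutlierClustering (I.labelled σ (I.k ≤ ·)) (fun j => I.labelled σ (· = (j : ℕ))) ∧
    I.Psi ℓ f (fun j => I.labelled σ (· = (j : ℕ))) ≤ ρ * I.opt ℓ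

end ListedInstance

/-! The algorithm repeats a trial many times and keeps the cheapest result. A trial opens `k`
locations one by one. With `F` already open, the power of a client is the `ℓ`-th power of its
distance to `F`. It is truncated at the `(m+1)`-st largest power, a client is sampled with
probability proportional to the truncated power, and the nearest unused location is opened. In the
end each client joins its nearest open location and the `m` most expensive clients become outliers.

Fix an optimal clustering and let `r` be the `ℓ`-th power mean radius of a cluster. The cluster is
covered if `F` has a location within `s * r` of its center. By Minkowski's inequality `F` then
serves it at `(1 + s) ^ ℓ` times its optimal cost (`sum_dist_rpow_le_of_dist_le`). In an uncovered
cluster, Markov's inequality gives many clients within `(1 + δ) * r` of the center, and these carry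
at least the share `nearShare` of the weight of the cluster (`nearShare_mul_sum_le`). Sampling such
a client covers its cluster for `s = β * (1 + 2 * δ)`: `β = 2` always works by the triangle
inequality, and `β = 1` works if the clients are themselves locations (`covered_next`). Hence the
ratios `3 ^ ℓ` and `2 ^ ℓ`.

Truncation controls the outliers. Some inlier has power at least the threshold, so the `m` outliers
together weigh at most `m` times the inliers (`IsThreshold.sum_min_le`). Hence either the uncovered
clusters are so cheap that `F` is good already, or a round covers a new cluster with probability at
least `roundProb` (`servesWithin_or_weight_useful`). Consequently a trial succeeds with probability
at least `roundProb ^ k` (`tapeLaw_real_rounds_le`), and `numTrials` is at least the reciprocal of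
that, so all trials fail with probability at most `1 / e`.

The remaining work is of two kinds. The program is verified with explicit step counts against the
pure recursion `IndexedInstance.rounds` (`Cmd.service_halts`). The probability estimates are
inequalities that hold for arbitrary events, so measurability of the output is never needed. -/

namespace RealRAM

/-! ### Which arrays a command may write -/

/-- `c.writesNat a`: the command `c` contains an assignment to the natural array `a`. -/
def Cmd.writesNat : Cmd → ℕ → Bool
  | .skip, _ => false
  | .setNat b _ _, a => a == b
  | .setReal _ _ _, _ => false
  | .sample _ _, _ => false
  | .seq c₁ c₂, a => c₁.writesNat a || c₂.writesNat a
  | .branch _ c₁ c₂, a => c₁.writesNat a || c₂.writesNat a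
  | .loop _ c, a => c.writesNat a

/-- `c.writesReal a`: the command `c` contains an assignment to the real array `a`. -/
def Cmd.writesReal : Cmd → ℕ → Bool
  | .skip, _ => false
  | .setNat _ _ _, _ => false
  | .setReal b _ _, a => a == b
  | .sample b _, a => a == b
  | .seq c₁ c₂, a => c₁.writesReal a || c₂.writesReal a
  | .branch _ c₁ c₂, a => c₁.writesReal a || c₂.writesReal a
  | .loop _ c, a => c.writesReal a

/-- `c.draws`: the command `c` contains a random draw. -/
def Cmd.draws : Cmd → Bool
  | .skip => false
  | .setNat _ _ _ => false
  | .setReal _ _ _ => false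
  | .sample _ _ => true
  | .seq c₁ c₂ => c₁.draws || c₂.draws
  | .branch _ c₁ c₂ => c₁.draws || c₂.draws
  | .loop _ c => c.draws

/-- `τ` agrees with `σ` on everything that `c` cannot change. -/
structure Frame (c : Cmd) (σ τ : State) : Prop where
  nat : ∀ a, c.writesNat a = false → τ.nat a = σ.nat a
  real : ∀ a, c.writesReal a = false → τ.real a = σ.real a
  tape : c.draws = false → τ.tape = σ.tape

theorem Frame.refl (c : Cmd) (σ : State) : Frame c σ σ :=
  ⟨fun _ _ => rfl, fun _ _ => rfl, fun _ => rfl⟩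

theorem Frame.trans {c : Cmd} {σ τ ρ : State} (h₁ : Frame c σ τ) (h₂ : Frame c τ ρ) :
    Frame c σ ρ :=
  ⟨fun a h => (h₂.nat a h).trans (h₁.nat a h), fun a h => (h₂.real a h).trans (h₁.real a h),
    fun h => (h₂.tape h).trans (h₁.tape h)⟩

theorem Frame.weaken {c c' : Cmd} {σ τ : State} (h : Frame c σ τ)
    (hn : ∀ a, c'.writesNat a = false → c.writesNat a = false)
    (hr : ∀ a, c'.writesReal a = false → c.writesReal a = false)
    (ht : c'.draws = false → c.draws = false) : Frame c' σ τ :=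
  ⟨fun a ha => h.nat a (hn a ha), fun a ha => h.real a (hr a ha), fun ha => h.tape (ht ha)⟩

/-- A primitive command changes only the array it names. Since the written arrays are computable
from the syntax, later proofs can transport untouched data across whole subprograms by `decide`. -/
theorem Exec.frame {E : Env} {c : Cmd} {σ τ : State} {t : ℕ} (h : Exec E c σ t τ) :
    Frame c σ τ := by
  induction h with
  | skip => exact Frame.refl _ _
  | setNat a i e σ =>
    refine ⟨fun b hb => ?_, fun _ _ => rfl, fun _ => rfl⟩
    have : b ≠ a := by simpa [Cmd.writesNat] using hb
    simp [State.setNat, this]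
  | setReal a i e σ =>
    refine ⟨fun _ _ => rfl, fun b hb => ?_, fun _ => rfl⟩
    have : b ≠ a := by simpa [Cmd.writesReal] using hb
    simp [State.setReal, this]
  | sample a i σ =>
    refine ⟨fun _ _ => rfl, fun b hb => ?_, fun h => by simp [Cmd.draws] at h⟩
    have : b ≠ a := by simpa [Cmd.writesReal] using hb
    simp [State.draw, State.setReal, this]
  | seq _ _ ih₁ ih₂ =>
    refine Frame.trans (ih₁.weaken ?_ ?_ ?_) (ih₂.weaken ?_ ?_ ?_) <;>
      simp +contextual [Cmd.writesNat, Cmd.writesReal, Cmd.draws]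
  | branch_true _ _ ih =>
    refine ih.weaken ?_ ?_ ?_ <;>
      simp +contextual [Cmd.writesNat, Cmd.writesReal, Cmd.draws]
  | branch_false _ _ ih =>
    refine ih.weaken ?_ ?_ ?_ <;>
      simp +contextual [Cmd.writesNat, Cmd.writesReal, Cmd.draws]
  | loop_false => exact Frame.refl _ _
  | loop_true _ _ _ ih₁ ih₂ =>
    refine Frame.trans (ih₁.weaken ?_ ?_ ?_) ih₂ <;>
      simp +contextual [Cmd.writesNat, Cmd.writesReal, Cmd.draws]

/-! ### Total correctness with time bounds -/

/-- Started in `σ`, the command `c` halts within `T` steps in a state satisfying `Q`. -/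
def Halts (E : Env) (c : Cmd) (σ : State) (T : ℕ) (Q : State → Prop) : Prop :=
  ∃ t τ, Exec E c σ t τ ∧ t ≤ T ∧ Q τ

variable {E : Env}

theorem Halts.mono {c : Cmd} {σ : State} {T T' : ℕ} {Q Q' : State → Prop}
    (h : Halts E c σ T Q) (hT : T ≤ T') (hQ : ∀ τ, Frame c σ τ → Q τ → Q' τ) :
    Halts E c σ T' Q' := by
  obtain ⟨t, τ, he, ht, hq⟩ := h
  exact ⟨t, τ, he, ht.trans hT, hQ τ he.frame hq⟩

theorem Halts.seq {c₁ c₂ : Cmd} {σ : State} {T₁ T₂ T : ℕ} {Q R : State → Prop}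
    (h₁ : Halts E c₁ σ T₁ R)
    (h₂ : ∀ τ, Frame c₁ σ τ → R τ → Halts E c₂ τ T₂ Q) (hT : T₁ + T₂ + 1 ≤ T) :
    Halts E (.seq c₁ c₂) σ T Q := by
  obtain ⟨t, τ, he, ht, hr⟩ := h₁
  obtain ⟨s, ρ, he', hs, hq⟩ := h₂ τ he.frame hr
  exact ⟨_, ρ, .seq he he', by omega, hq⟩

/-! ### Commands without loops -/

/-- `c` contains no loop. -/
def Cmd.straight : Cmd → Bool
  | .skip => true
  | .setNat _ _ _ => true
  | .setReal _ _ _ => true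
  | .sample _ _ => true
  | .seq c₁ c₂ => c₁.straight && c₂.straight
  | .branch _ c₁ c₂ => c₁.straight && c₂.straight
  | .loop _ _ => false

/-- An upper bound for the number of steps of a command without loops. -/
def Cmd.bound : Cmd → ℕ
  | .skip => 1
  | .setNat _ i e => i.cost + e.cost + 1
  | .setReal _ i e => i.cost + e.cost + 1
  | .sample _ i => i.cost + 1
  | .seq c₁ c₂ => c₁.bound + c₂.bound + 1
  | .branch b c₁ c₂ => b.cost + (c₁.bound + c₂.bound) + 1
  | .loop _ _ => 0

open Classical in
/-- The final state of a command without loops. -/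
noncomputable def Cmd.run (E : Env) : Cmd → State → State
  | .skip, σ => σ
  | .setNat a i e, σ => σ.setNat a (i.eval σ) (e.eval σ)
  | .setReal a i e, σ => σ.setReal a (i.eval σ) (e.eval E σ)
  | .sample a i, σ => σ.draw a (i.eval σ)
  | .seq c₁ c₂, σ => c₂.run E (c₁.run E σ)
  | .branch b c₁ c₂, σ => if b.holds E σ then c₁.run E σ else c₂.run E σ
  | .loop _ _, σ => σ

/-- Symbolic execution: without loops the final state is a function of the initial one, so a
correctness claim reduces to simplifying `Cmd.run`. -/
theorem Halts.of_straight {c : Cmd} (hc : c.straight = true) (σ : State) {T : ℕ}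
    (hT : c.bound ≤ T) {Q : State → Prop} (hQ : Q (c.run E σ)) : Halts E c σ T Q := by
  suffices h : ∀ σ, ∃ t ≤ c.bound, Exec E c σ t (c.run E σ) by
    obtain ⟨t, ht, he⟩ := h σ
    exact ⟨t, _, he, ht.trans hT, hQ⟩
  clear hQ hT
  induction c with
  | skip => exact fun σ => ⟨_, le_rfl, .skip σ⟩
  | setNat a i e => exact fun σ => ⟨_, le_rfl, .setNat a i e σ⟩
  | setReal a i e => exact fun σ => ⟨_, le_rfl, .setReal a i e σ⟩
  | sample a i => exact fun σ => ⟨_, le_rfl, .sample a i σ⟩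
  | seq c₁ c₂ ih₁ ih₂ =>
    intro σ
    simp only [Cmd.straight, Bool.and_eq_true] at hc
    obtain ⟨t₁, ht₁, he₁⟩ := ih₁ hc.1 σ
    obtain ⟨t₂, ht₂, he₂⟩ := ih₂ hc.2 (c₁.run E σ)
    exact ⟨_, by simp only [Cmd.bound]; omega, .seq he₁ he₂⟩
  | branch b c₁ c₂ ih₁ ih₂ =>
    intro σ
    simp only [Cmd.straight, Bool.and_eq_true] at hc
    by_cases hb : b.holds E σ
    · obtain ⟨t, ht, he⟩ := ih₁ hc.1 σ
      exact ⟨b.cost + t + 1, by simp only [Cmd.bound]; omega,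
        by simpa only [Cmd.run, if_pos hb] using Exec.branch_true hb he⟩
    · obtain ⟨t, ht, he⟩ := ih₂ hc.2 σ
      exact ⟨b.cost + t + 1, by simp only [Cmd.bound]; omega,
        by simpa only [Cmd.run, if_neg hb] using Exec.branch_false hb he⟩
  | loop b c => simp [Cmd.straight] at hc

/-! ### Counting loops -/

/-- The cell `0` of the natural array `a`, used as a variable. -/
abbrev NExp.var (a : ℕ) : NExp := .get a (.const 0)

/-- The cell `0` of the real array `a`, used as a variable. -/
abbrev RExp.var (a : ℕ) : RExp := .get a (.const 0)

/-- `for v := 0; b; v := v + 1 do c`. -/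
def Cmd.count (v : ℕ) (b : BExp) (c : Cmd) : Cmd :=
  .seq (.setNat v (.const 0) (.const 0))
    (.loop b (.seq c (.setNat v (.const 0) (.add (.var v) (.const 1)))))

/-- A counting loop with exactly `n` rounds, each of which takes at most `T` steps. -/
theorem Halts.count {v : ℕ} {b : BExp} {c : Cmd} {σ : State} {n T : ℕ}
    (Inv : ℕ → State → Prop) (hv : c.writesNat v = false)
    (hb : ∀ τ, Frame (.count v b c) σ τ → τ.nat v 0 ≤ n → (b.holds E τ ↔ τ.nat v 0 < n))
    (h0 : Inv 0 (σ.setNat v 0 0))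
    (hs : ∀ i < n, ∀ τ, Frame (.count v b c) σ τ → τ.nat v 0 = i → Inv i τ →
      Halts E c τ T (fun ρ => Inv (i + 1) (ρ.setNat v 0 (i + 1)))) :
    Halts E (.count v b c) σ (n * (T + b.cost + 8) + b.cost + 5) (Inv n) := by
  have hinc : ∀ ρ : State, Exec E (.setNat v (.const 0) (.add (.var v) (.const 1))) ρ 6
      (ρ.setNat v 0 (ρ.nat v 0 + 1)) := fun ρ => .setNat v _ _ ρ
  have hset : ∀ (ρ : State) (x : ℕ), (ρ.setNat v 0 x).nat v 0 = x := fun ρ x => by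
    simp [State.setNat]
  -- The induction is on the number `j` of rounds still to come, because a loop derivation unfolds
  -- from its first round. Each round pays 6 steps for the increment and one each for the sequencing
  -- and the loop, besides body and test.
  have main : ∀ j i, i + j = n → ∀ τ, Frame (.count v b c) σ τ → τ.nat v 0 = i → Inv i τ →
      Halts E (.loop b (.seq c (.setNat v (.const 0) (.add (.var v) (.const 1))))) τ
        (j * (T + b.cost + 8) + b.cost + 1) (Inv n) := by
    intro j
    induction j with
    | zero =>
      intro i hi τ hf hvi hinv
      obtain rfl : i = n := by omega
      refine ⟨_, τ, .loop_false ?_, by omega, hinv⟩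
      rw [hb τ hf (by omega)]; omega
    | succ j ih =>
      intro i hi τ hf hvi hinv
      obtain ⟨t, ρ, he, ht, hq⟩ := hs i (by omega) τ hf hvi hinv
      have hρ : ρ.nat v 0 = i := by rw [he.frame.nat v hv, hvi]
      have hbody := Exec.seq he (hinc ρ)
      rw [hρ] at hbody
      obtain ⟨s, τ', he', hs', hq'⟩ := ih (i + 1) (by omega) (ρ.setNat v 0 (i + 1))
        (hf.trans (hbody.frame.weaken (by simp +contextual [Cmd.count, Cmd.writesNat])
          (by simp +contextual [Cmd.count, Cmd.writesReal])
          (by simp +contextual [Cmd.count, Cmd.draws]))) (hset _ _) hq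
      refine ⟨_, τ', .loop_true ?_ hbody he', ?_, hq'⟩
      · rw [hb τ hf (by omega)]; omega
      · have : (j + 1) * (T + b.cost + 8) = j * (T + b.cost + 8) + (T + b.cost + 8) := by ring
        omega
  have hinit : Exec E (.setNat v (.const 0) (.const 0)) σ 3 (σ.setNat v 0 0) := .setNat v _ _ σ
  obtain ⟨t, τ, he, ht, hq⟩ := main n 0 (by omega) (σ.setNat v 0 0)
    (hinit.frame.weaken (by simp +contextual [Cmd.count, Cmd.writesNat])
      (by simp +contextual [Cmd.count, Cmd.writesReal])
      (by simp +contextual [Cmd.count, Cmd.draws])) (hset _ _) h0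
  exact ⟨_, τ, .seq hinit he, by omega, hq⟩

/-- `for v < e do c`. -/
abbrev Cmd.forLt (v : ℕ) (e : NExp) (c : Cmd) : Cmd := .count v (.natLt (.var v) e) c

theorem Halts.forLt {v : ℕ} {e : NExp} {c : Cmd} {σ : State} {n T T' : ℕ}
    (Inv : ℕ → State → Prop) (hv : c.writesNat v = false)
    (he : ∀ τ, Frame (.forLt v e c) σ τ → e.eval τ = n)
    (h0 : Inv 0 (σ.setNat v 0 0))
    (hs : ∀ i < n, ∀ τ, Frame (.forLt v e c) σ τ → τ.nat v 0 = i → Inv i τ →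
      Halts E c τ T (fun ρ => Inv (i + 1) (ρ.setNat v 0 (i + 1))))
    (hT : n * (T + e.cost + 11) + e.cost + 8 ≤ T') :
    Halts E (.forLt v e c) σ T' (Inv n) := by
  refine (Halts.count (n := n) (T := T) Inv hv ?_ h0 hs).mono ?_ fun _ _ h => h
  · intro τ hf _
    simp [BExp.holds, NExp.eval, he τ hf]
  · have : (BExp.natLt (.var v) e).cost = e.cost + 3 := by
      simp only [BExp.cost, NExp.cost]; omega
    rw [this]
    have : n * (T + (e.cost + 3) + 8) = n * (T + e.cost + 11) := by ring
    omega

end RealRAM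

/-! ### Selection of largest entries and inverse transform sampling -/

/-- Running maximum of `v` over the indices below `n` outside `U`: the first index where it is
attained, and its value (`-1` if there is no such index). -/
noncomputable def argmaxOutside (U : Finset ℕ) (v : ℕ → ℝ) : ℕ → ℕ × ℝ
  | 0 => (0, -1)
  | n + 1 => if n ∉ U ∧ (argmaxOutside U v n).2 < v n then (n, v n) else argmaxOutside U v n

theorem argmaxOutside_upper {U : Finset ℕ} {v : ℕ → ℝ} {n : ℕ} :
    ∀ x < n, x ∉ U → v x ≤ (argmaxOutside U v n).2 := by
  induction n with
  | zero => simp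
  | succ n ih =>
    intro x hx hU
    simp only [argmaxOutside]
    split_ifs with h
    · rcases Nat.lt_succ_iff_lt_or_eq.1 hx with hx | rfl
      · exact (ih x hx hU).trans h.2.le
      · exact le_rfl
    · rcases Nat.lt_succ_iff_lt_or_eq.1 hx with hx | rfl
      · exact ih x hx hU
      · simpa [hU] using h

theorem argmaxOutside_attained (U : Finset ℕ) (v : ℕ → ℝ) (n : ℕ) :
    (argmaxOutside U v n).2 = -1 ∨
      (argmaxOutside U v n).1 < n ∧ (argmaxOutside U v n).1 ∉ U ∧
        v (argmaxOutside U v n).1 = (argmaxOutside U v n).2 := by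
  induction n with
  | zero => simp [argmaxOutside]
  | succ n ih =>
    simp only [argmaxOutside]
    split_ifs with h
    · exact Or.inr ⟨by simp, h.1, rfl⟩
    · rcases ih with ih | ⟨h₁, h₂⟩
      · exact Or.inl ih
      · exact Or.inr ⟨by omega, h₂⟩

/-- For nonnegative values the initial value `-1` cannot survive once an index outside `U` has been
scanned. -/
theorem argmaxOutside_mem {U : Finset ℕ} {v : ℕ → ℝ} {n : ℕ} (hv : ∀ x < n, 0 ≤ v x)
    (hU : ∃ x < n, x ∉ U) :
    (argmaxOutside U v n).1 < n ∧ (argmaxOutside U v n).1 ∉ U ∧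
      v (argmaxOutside U v n).1 = (argmaxOutside U v n).2 := by
  refine (argmaxOutside_attained U v n).resolve_left fun h => ?_
  obtain ⟨x, hx, hxU⟩ := hU
  have := argmaxOutside_upper (v := v) x hx hxU
  linarith [hv x hx]

/-- The last index below `n` for which the sum of the preceding weights is at most `t`. -/
noncomputable def pickIndex (w : ℕ → ℝ) (t : ℝ) : ℕ → ℕ
  | 0 => 0
  | n + 1 => if t < ∑ x ∈ Finset.range n, w x then pickIndex w t n else n

theorem pickIndex_lt {w : ℕ → ℝ} {t : ℝ} {n : ℕ} (hn : 0 < n) : pickIndex w t n < n := by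
  induction n with
  | zero => omega
  | succ n ih =>
    simp only [pickIndex]
    split_ifs with h
    · rcases Nat.eq_zero_or_pos n with rfl | hn
      · simp [pickIndex]
      · exact (ih hn).trans (by omega)
    · omega

/-- Partial sums of nonnegative weights are monotone, so the recursion passes over every later index
and stops exactly at `x`. Thus `x` is picked on an interval of length `w x`, which is what makes the
sampling correct. -/
theorem pickIndex_eq {w : ℕ → ℝ} {t : ℝ} {n x : ℕ} (hw : ∀ y < n, 0 ≤ w y) (hx : x < n)
    (h₁ : ∑ y ∈ Finset.range x, w y ≤ t) (h₂ : t < ∑ y ∈ Finset.range (x + 1), w y) :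
    pickIndex w t n = x := by
  induction n with
  | zero => omega
  | succ n ih =>
    simp only [pickIndex]
    rcases Nat.lt_succ_iff_lt_or_eq.1 hx with hx | rfl
    · rw [if_pos, ih (fun y hy => hw y (by omega)) hx]
      refine h₂.trans_le (Finset.sum_le_sum_of_subset_of_nonneg
        (Finset.range_subset_range.2 hx) fun y hy _ => hw y ?_)
      exact (Finset.mem_range.1 hy).trans (by omega)
    · rw [if_neg (not_lt.2 h₁)]

/-- `T` is the `(m + 1)`-st largest of the first `n` values of `D`, or `-1` if `n ≤ m`. -/
def IsThreshold (D : ℕ → ℝ) (n m : ℕ) (T : ℝ) : Prop :=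
  {x ∈ Finset.range n | T < D x}.card ≤ m ∧
    (T = -1 ∧ n ≤ m ∨ m < {x ∈ Finset.range n | T ≤ D x}.card)

/-- If `S < S'` were both thresholds, the more than `m` values that are at least `S'` would all
exceed `S`. Uniqueness identifies the number computed by the machine with the one chosen in
`IndexedInstance.threshold`. -/
theorem IsThreshold.unique {D : ℕ → ℝ} {n m : ℕ} {T T' : ℝ}
    (h : IsThreshold D n m T) (h' : IsThreshold D n m T') : T = T' := by
  have key : ∀ {S S' : ℝ}, IsThreshold D n m S → IsThreshold D n m S' → S' ≤ S := by
    intro S S' h h'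
    by_contra! hlt
    have hle : {x ∈ Finset.range n | S' ≤ D x}.card ≤ {x ∈ Finset.range n | S < D x}.card :=
      Finset.card_le_card (Finset.monotone_filter_right _ fun x _ hx => hlt.trans_le hx)
    rcases h'.2 with ⟨rfl, hn⟩ | h'm
    · rcases h.2 with ⟨rfl, _⟩ | hm
      · exact lt_irrefl _ hlt
      · have := (Finset.card_filter_le (Finset.range n) fun x => S ≤ D x)
        rw [Finset.card_range] at this
        omega
    · have := h.1
      omega
  exact le_antisymm (key h' h) (key h h')

/-- `M` consists of `m` of the first `n` indices at which `D` is largest. -/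
structure IsTopSet (D : ℕ → ℝ) (n m : ℕ) (M : Finset ℕ) : Prop where
  subset : M ⊆ Finset.range n
  card : M.card = m
  le : ∀ x ∈ M, ∀ y < n, y ∉ M → D y ≤ D x

/-- Every value above the maximum outside `M` sits in `M`, and `M` together with the maximizer
supplies `m + 1` values at least as large. If nothing is outside, the sentinel `-1` is the agreed
threshold. -/
theorem IsTopSet.isThreshold {D : ℕ → ℝ} {n m : ℕ} {M : Finset ℕ} (h : IsTopSet D n m M)
    (hD : ∀ x < n, 0 ≤ D x) : IsThreshold D n m (argmaxOutside M D n).2 := by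
  have hup := argmaxOutside_upper (U := M) (v := D) (n := n)
  refine ⟨?_, ?_⟩
  · rw [← h.card]
    refine Finset.card_le_card fun x hx => ?_
    simp only [Finset.mem_filter, Finset.mem_range] at hx
    by_contra hxM
    exact absurd (hup x hx.1 hxM) (not_le.2 hx.2)
  · by_cases hU : ∃ x < n, x ∉ M
    · right
      obtain ⟨h₁, h₂, h₃⟩ := argmaxOutside_mem hD hU
      rw [← h.card, ← h₃]
      refine Finset.card_lt_card (Finset.ssubset_iff.2 ⟨_, h₂, fun x hx => ?_⟩)
      simp only [Finset.mem_filter, Finset.mem_range]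
      rcases Finset.mem_insert.1 hx with rfl | hx
      · exact ⟨h₁, le_rfl⟩
      · exact ⟨Finset.mem_range.1 (h.subset hx), h.le x hx _ h₁ h₂⟩
    · left
      push Not at hU
      refine ⟨?_, ?_⟩
      · rcases argmaxOutside_attained M D n with h | h
        · exact h
        · exact absurd (hU _ h.1) h.2.1
      · rw [← h.card, ← Finset.card_range n]
        exact Finset.card_le_card fun x hx => hU x (Finset.mem_range.1 hx)

theorem IsTopSet.insert_argmax {D : ℕ → ℝ} {n m : ℕ} {M : Finset ℕ} (h : IsTopSet D n m M)
    (hD : ∀ x < n, 0 ≤ D x) (hm : m < n) :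
    IsTopSet D n (m + 1) (insert (argmaxOutside M D n).1 M) := by
  have hU : ∃ x < n, x ∉ M := by
    by_contra! hU
    have : (Finset.range n).card ≤ M.card :=
      Finset.card_le_card fun x hx => hU x (Finset.mem_range.1 hx)
    rw [h.card, Finset.card_range] at this
    omega
  obtain ⟨h₁, h₂, h₃⟩ := argmaxOutside_mem hD hU
  refine ⟨Finset.insert_subset (Finset.mem_range.2 h₁) h.subset, ?_, ?_⟩
  · rw [Finset.card_insert_of_notMem h₂, h.card]
  · intro x hx y hy hyM
    simp only [Finset.mem_insert, not_or] at hyM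
    rcases Finset.mem_insert.1 hx with rfl | hx
    · rw [h₃]
      exact argmaxOutside_upper y hy hyM.2
    · exact h.le x hx y hy hyM.2

theorem exists_isTopSet {D : ℕ → ℝ} {n m : ℕ} (hD : ∀ x < n, 0 ≤ D x) (hm : m ≤ n) :
    ∃ M, IsTopSet D n m M := by
  induction m with
  | zero => exact ⟨∅, by simp, rfl, by simp⟩
  | succ m ih =>
    obtain ⟨M, hM⟩ := ih (by omega)
    exact ⟨_, hM.insert_argmax hD hm⟩

/-! ### The algorithm as a recursion on sets of location indices -/

/-- A `k`-service instance with indexed clients and locations. -/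
structure IndexedInstance (X : Type*) where
  client : ℕ → X
  loc : ℕ → X
  ell : ℝ
  numC : ℕ
  numL : ℕ
  m : ℕ

namespace IndexedInstance

variable {X : Type*} [MetricSpace X] (P : IndexedInstance X)

/-- The distance of `y` to the nearest of the locations in `F`, raised to the power `ℓ`;
it is replaced by `1` if there are none. -/
noncomputable def power (F : Finset ℕ) (y : X) : ℝ :=
  if h : F.Nonempty then F.inf' h fun f => dist y (P.loc f) ^ P.ell else 1

open Classical in
/-- The `(m + 1)`-st largest power of a client. -/
noncomputable def threshold (F : Finset ℕ) : ℝ :=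
  if h : ∃ T, IsThreshold (fun x => P.power F (P.client x)) P.numC P.m T then h.choose else 0

/-- The sampling weight of a client: its truncated power. -/
noncomputable def weight (F : Finset ℕ) (x : ℕ) : ℝ :=
  min (P.power F (P.client x)) (P.threshold F)

/-- The client that is sampled by `u ∈ [0, 1]`. -/
noncomputable def drawn (F : Finset ℕ) (u : ℝ) : ℕ :=
  pickIndex (P.weight F) (u * ∑ x ∈ Finset.range P.numC, P.weight F x) P.numC

/-- The first of the unused locations that are nearest to the client `x`. -/
noncomputable def nearest (F : Finset ℕ) (x : ℕ) : ℕ :=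
  (argmaxOutside F (fun f => 1 / (1 + dist (P.client x) (P.loc f))) P.numL).1

/-- One round of the algorithm. -/
noncomputable def next (F : Finset ℕ) (u : ℝ) : Finset ℕ :=
  insert (P.nearest F (P.drawn F u)) F

/-- The centers after `j` further rounds. -/
noncomputable def rounds : ℕ → Finset ℕ → (ℕ → unitInterval) → Finset ℕ
  | 0, F, _ => F
  | j + 1, F, ω => rounds j (P.next F (ω 0)) fun t => ω (t + 1)

/-- The recursion peels off the first draw, which suits conditioning on it; the loop of the machine
appends a last round and needs this form. -/
theorem rounds_succ (j : ℕ) (F : Finset ℕ) (ω : ℕ → unitInterval) :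
    P.rounds (j + 1) F ω = P.next (P.rounds j F ω) (ω j) := by
  induction j generalizing F ω with
  | zero => rfl
  | succ j ih =>
    rw [rounds, ih]
    rfl

theorem power_empty (y : X) : P.power ∅ y = 1 := by simp [power]

theorem power_nonneg (F : Finset ℕ) (y : X) : 0 ≤ P.power F y := by
  unfold power
  split_ifs with h
  · exact Finset.le_inf' _ _ fun f _ => Real.rpow_nonneg dist_nonneg _
  · exact zero_le_one

theorem power_le {F : Finset ℕ} {f : ℕ} (hf : f ∈ F) (y : X) :
    P.power F y ≤ dist y (P.loc f) ^ P.ell := by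
  rw [power, dif_pos ⟨f, hf⟩]
  exact Finset.inf'_le _ hf

theorem exists_power_eq {F : Finset ℕ} (hF : F.Nonempty) (y : X) :
    ∃ f ∈ F, P.power F y = dist y (P.loc f) ^ P.ell := by
  rw [power, dif_pos hF]
  exact Finset.exists_mem_eq_inf' hF _

theorem power_singleton (f : ℕ) (y : X) : P.power {f} y = dist y (P.loc f) ^ P.ell := by
  simp [power]

theorem power_insert {F : Finset ℕ} (hF : F.Nonempty) (f : ℕ) (y : X) :
    P.power (insert f F) y = min (dist y (P.loc f) ^ P.ell) (P.power F y) := by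
  rw [power, dif_pos (Finset.insert_nonempty f F), power, dif_pos hF, Finset.inf'_insert]

/-- Nonemptiness matters: the power of the empty set is the placeholder `1`, and opening a first
location may raise it. -/
theorem power_anti {F G : Finset ℕ} (hF : F.Nonempty) (h : F ⊆ G) (y : X) :
    P.power G y ≤ P.power F y := by
  obtain ⟨f, hf, he⟩ := P.exists_power_eq hF y
  rw [he]
  exact P.power_le (h hf) y

theorem threshold_eq {F : Finset ℕ} {T : ℝ}
    (h : IsThreshold (fun x => P.power F (P.client x)) P.numC P.m T) : P.threshold F = T := by
  have hex : ∃ T, IsThreshold (fun x => P.power F (P.client x)) P.numC P.m T := ⟨T, h⟩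
  rw [threshold, dif_pos hex]
  exact hex.choose_spec.unique h

/-- The function `1 / (1 + d)` is positive and decreasing, so a maximum search with sentinel `-1`
also finds a nearest location. -/
theorem nearest_spec {F : Finset ℕ} {x : ℕ} (hF : ∃ f < P.numL, f ∉ F) :
    P.nearest F x < P.numL ∧ P.nearest F x ∉ F ∧
      ∀ f < P.numL, f ∉ F →
        dist (P.client x) (P.loc (P.nearest F x)) ≤ dist (P.client x) (P.loc f) := by
  obtain ⟨h₁, h₂, h₃⟩ := argmaxOutside_mem (U := F)
    (v := fun f => 1 / (1 + dist (P.client x) (P.loc f))) (fun f _ => by positivity) hF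
  refine ⟨h₁, h₂, fun f hf hfF => ?_⟩
  have := argmaxOutside_upper (v := fun f => 1 / (1 + dist (P.client x) (P.loc f))) f hf hfF
  rw [← h₃] at this
  have := (one_div_le_one_div (by positivity) (by positivity)).1 this
  simpa [nearest] using this

end IndexedInstance

/-! ### Exchange arguments for the choice of outliers -/

/-- The largest value outside `M` separates; if nothing is outside, the smallest value inside does.
-/
theorem IsTopSet.exists_separator {D : ℕ → ℝ} {n m : ℕ} {M : Finset ℕ} (h : IsTopSet D n m M) :
    ∃ t, (∀ x ∈ M, t ≤ D x) ∧ ∀ y ∈ Finset.range n \ M, D y ≤ t := by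
  by_cases hne : (Finset.range n \ M).Nonempty
  · obtain ⟨y, hy, hmax⟩ := Finset.exists_max_image _ D hne
    simp only [Finset.mem_sdiff, Finset.mem_range] at hy
    exact ⟨D y, fun x hx => h.le x hx y hy.1 hy.2, hmax⟩
  · rw [Finset.not_nonempty_iff_eq_empty] at hne
    by_cases hM : M.Nonempty
    · obtain ⟨x, _, hmin⟩ := Finset.exists_min_image _ D hM
      exact ⟨D x, hmin, by simp [hne]⟩
    · rw [Finset.not_nonempty_iff_eq_empty] at hM
      exact ⟨0, by simp [hM], by simp [hne]⟩

/-- Removing a separated set of `m` elements costs no more than removing any other one, even with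
truncated values. -/
theorem sum_sdiff_le_sum_min {S M N : Finset ℕ} {D : ℕ → ℝ} {t : ℝ} (hM : M ⊆ S) (hN : N ⊆ S)
    (hc : M.card = N.card) (h₁ : ∀ x ∈ M, t ≤ D x) (h₂ : ∀ y ∈ S \ M, D y ≤ t) :
    ∑ x ∈ S \ M, D x ≤ ∑ x ∈ S \ N, min (D x) t := by
  have e₁ : ∑ x ∈ S \ M, D x = ∑ x ∈ S \ M, min (D x) t :=
    Finset.sum_congr rfl fun x hx => (min_eq_left (h₂ x hx)).symm
  -- After truncation every element of `M` counts exactly `t` and every element of `N` at most `t`.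
  -- As the cardinalities agree, the complement of `M` keeps the smaller rest.
  have e₂ : ∑ x ∈ M, min (D x) t = M.card * t := by
    rw [Finset.sum_congr rfl fun x hx => min_eq_right (h₁ x hx), Finset.sum_const, nsmul_eq_mul]
  have e₃ : ∑ x ∈ N, min (D x) t ≤ N.card * t := by
    rw [← nsmul_eq_mul, ← Finset.sum_const]
    exact Finset.sum_le_sum fun x _ => min_le_right _ _
  have s₁ := Finset.sum_sdiff (f := fun x => min (D x) t) hM
  have s₂ := Finset.sum_sdiff (f := fun x => min (D x) t) hN
  rw [← hc] at e₃
  linarith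

theorem IsTopSet.sum_le {D : ℕ → ℝ} {n m : ℕ} {M N : Finset ℕ} (h : IsTopSet D n m M)
    (hN : N ⊆ Finset.range n) (hc : N.card = m) :
    ∑ x ∈ Finset.range n \ M, D x ≤ ∑ x ∈ Finset.range n \ N, D x := by
  obtain ⟨t, h₁, h₂⟩ := h.exists_separator
  exact (sum_sdiff_le_sum_min h.subset hN (h.card.trans hc.symm) h₁ h₂).trans
    (Finset.sum_le_sum fun x _ => min_le_left _ _)

/-! ### Machine code: marking outliers and weighted sampling -/

namespace RealRAM

variable {E : Env}

theorem Halts.branch {b : BExp} {c₁ c₂ : Cmd} {σ : State} {T T' : ℕ} {Q : State → Prop}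
    (h₁ : b.holds E σ → Halts E c₁ σ T Q) (h₂ : ¬ b.holds E σ → Halts E c₂ σ T Q)
    (hT : b.cost + T + 1 ≤ T') : Halts E (.branch b c₁ c₂) σ T' Q := by
  by_cases hb : b.holds E σ
  · obtain ⟨t, τ, he, ht, hq⟩ := h₁ hb
    exact ⟨_, τ, .branch_true hb he, by omega, hq⟩
  · obtain ⟨t, τ, he, ht, hq⟩ := h₂ hb
    exact ⟨_, τ, .branch_false hb he, by omega, hq⟩

/-- The indices with entry `0` in the natural array `mk` are searched for the largest entry of
the real array `va`; the index goes to the natural variable `7`, the value to the real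
variable `4`. The range is given by the input cell `c`. -/
def Cmd.argmax (c mk va : ℕ) : Cmd :=
  .seq (.setNat 7 (.const 0) (.const 0)) <|
  .seq (.setReal 4 (.const 0) (.sub (.ofNat (.const 0)) (.ofNat (.const 1)))) <|
  .forLt 9 (.get 0 (.const c)) <|
    .branch (.natLt (.get mk (.var 9)) (.const 1))
      (.branch (.realLt (.var 4) (.get va (.var 9)))
        (.seq (.setNat 7 (.const 0) (.var 9)) (.setReal 4 (.const 0) (.get va (.var 9))))
        .skip)
      .skip

theorem Cmd.argmax_halts {c mk va n : ℕ} {σ : State} {U : Finset ℕ} {v : ℕ → ℝ}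
    (h7 : mk ≠ 7) (h9 : mk ≠ 9) (h4 : va ≠ 4) (hn : σ.nat 0 c = n)
    (hU : ∀ x < n, (σ.nat mk x < 1 ↔ x ∉ U)) (hv : ∀ x < n, σ.real va x = v x) :
    Halts E (.argmax c mk va) σ (n * 38 + 22) fun τ =>
      τ.nat 7 0 = (argmaxOutside U v n).1 ∧ τ.real 4 0 = (argmaxOutside U v n).2 := by
  refine Halts.seq (T₁ := 3) (T₂ := n * 38 + 18) (Halts.of_straight rfl σ (by decide) rfl) ?_
    (by omega)
  rintro _ - rfl
  refine Halts.seq (T₁ := 7) (T₂ := n * 38 + 10) (Halts.of_straight rfl _ (by decide) rfl) ?_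
    (by omega)
  rintro _ - rfl
  refine Halts.forLt (n := n) (T := 25) (fun i τ => τ.nat 7 0 = (argmaxOutside U v i).1 ∧
    τ.real 4 0 = (argmaxOutside U v i).2) (by simp [Cmd.writesNat]) ?_ ?_ ?_
    (by simp [NExp.cost])
  · intro τ hf
    have := hf.nat 0 (by simp [Cmd.count, Cmd.writesNat])
    simp [NExp.eval, this, Cmd.run, State.setNat, State.setReal, hn]
  · simp [Cmd.run, State.setNat, State.setReal, NExp.eval, RExp.eval, argmaxOutside]
  · rintro i hi τ hf hvi ⟨h₁, h₂⟩
    have e₁ := hf.nat mk (by simp [Cmd.count, Cmd.writesNat, h7, h9])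
    have e₂ := hf.real va (by simp [Cmd.count, Cmd.writesReal, h4])
    have f₁ : τ.nat mk i < 1 ↔ i ∉ U := by
      rw [← hU i hi, e₁]
      simp [Cmd.run, State.setNat, State.setReal, Function.update_of_ne h7]
    have f₂ : τ.real va i = v i := by
      rw [← hv i hi, e₂]
      simp [Cmd.run, State.setNat, State.setReal, Function.update_of_ne h4]
    refine Halts.of_straight rfl τ (by simp [Cmd.bound, BExp.cost, NExp.cost, RExp.cost]) ?_
    simp only [Cmd.run, BExp.holds, NExp.eval, RExp.eval, hvi, f₁, f₂, h₂, argmaxOutside]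
    by_cases hiU : i ∉ U
    · by_cases hlt : (argmaxOutside U v i).2 < v i
      · simp [hiU, hlt, State.setNat, State.setReal, hvi, f₂]
      · simp [hiU, hlt, State.setNat, h₁, h₂]
    · simp [hiU, State.setNat, h₁, h₂]

/-- The memory holds the parameters of the instance in the natural array `0`. -/
structure Input {X : Type*} (P : IndexedInstance X) (k : ℕ) (σ : State) : Prop where
  numC : σ.nat 0 0 = P.numC
  numL : σ.nat 0 1 = P.numL
  k : σ.nat 0 2 = k
  m : σ.nat 0 3 = P.m

variable {X : Type*} {P : IndexedInstance X} {k : ℕ}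

theorem Input.frame {c : Cmd} {σ τ : State} (h : Input P k σ) (hf : Frame c σ τ)
    (hc : c.writesNat 0 = false) : Input P k τ := by
  have := hf.nat 0 hc
  exact ⟨by rw [this, h.numC], by rw [this, h.numL], by rw [this, h.k], by rw [this, h.m]⟩

/-- Mark `m` clients with largest entries of the real array `1` in the natural array `6`. -/
def Cmd.markTop : Cmd :=
  .seq (.forLt 9 (.get 0 (.const 0)) (.setNat 6 (.var 9) (.const 0)))
    (.forLt 10 (.get 0 (.const 3)) (.seq (.argmax 0 6 1) (.setNat 6 (.var 7) (.const 1))))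

/-- Selection sort stopped after `m` passes: each pass adds the largest unmarked entry and so
extends a top set by one. -/
theorem Cmd.markTop_halts {σ : State} {D : ℕ → ℝ} (hI : Input P k σ) (hm : P.m ≤ P.numC)
    (hD : ∀ x < P.numC, σ.real 1 x = D x) (hD0 : ∀ x < P.numC, 0 ≤ D x) :
    Halts E .markTop σ ((P.m + 1) * (P.numC * 38 + 42)) fun τ =>
      ∃ M, IsTopSet D P.numC P.m M ∧ ∀ x < P.numC, (τ.nat 6 x < 1 ↔ x ∉ M) := by
  refine Halts.seq (T₁ := P.numC * 17 + 10) (T₂ := P.m * (P.numC * 38 + 40) + 10)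
    (R := fun τ => ∀ x < P.numC, τ.nat 6 x = 0) ?_ ?_ ?_
  · refine Halts.forLt (n := P.numC) (T := 4) (fun i τ => ∀ x < i, τ.nat 6 x = 0)
      (by decide) ?_ ?_ ?_ (by simp [NExp.cost])
    · intro τ hf
      simpa [NExp.eval] using (hI.frame hf (by decide)).numC
    · simp
    · intro i hi τ hf hvi h
      refine Halts.of_straight rfl τ (by decide) ?_
      intro x hx
      simp only [Cmd.run, State.setNat, NExp.eval, hvi]
      by_cases hxi : x = i
      · simp [hxi]
      · simp [hxi, h x (by omega)]
  · intro τ hf h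
    have hIτ := hI.frame hf (by decide)
    have hDτ : ∀ x < P.numC, τ.real 1 x = D x := by
      rw [hf.real 1 (by decide)]; exact hD
    refine (Halts.forLt (n := P.m) (T := P.numC * 38 + 27) (fun i τ => ∃ M,
      IsTopSet D P.numC i M ∧ ∀ x < P.numC, (τ.nat 6 x < 1 ↔ x ∉ M))
      (by decide) ?_ ?_ ?_ ?_)
    · intro τ hf
      simpa [NExp.eval] using (hIτ.frame hf (by decide)).m
    · refine ⟨∅, ⟨by simp, rfl, by simp⟩, fun x hx => ?_⟩
      simp [State.setNat, h x hx]
    · rintro i hi ρ hfρ hvi ⟨M, hM, hMρ⟩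
      have hIρ := hIτ.frame hfρ (by decide)
      have hDρ : ∀ x < P.numC, ρ.real 1 x = D x := by
        rw [hfρ.real 1 (by decide)]; exact hDτ
      refine Halts.seq (T₁ := P.numC * 38 + 22) (T₂ := 4)
        (Cmd.argmax_halts (by decide) (by decide) (by decide) hIρ.numC hMρ hDρ) ?_ (by omega)
      rintro π hfπ ⟨h₁, h₂⟩
      refine Halts.of_straight rfl π (by decide) ?_
      refine ⟨_, hM.insert_argmax hD0 (by omega), fun x hx => ?_⟩
      simp only [Cmd.run, State.setNat, NExp.eval, h₁, Finset.mem_insert, not_or]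
      by_cases hxb : x = (argmaxOutside M D P.numC).1
      · simp [hxb]
      · simp [hxb, hfπ.nat 6 (by decide), ← hMρ x hx]
    · simp only [NExp.cost]
      have : P.m * (P.numC * 38 + 27 + (1 + 1) + 11) = P.m * (P.numC * 38 + 40) := by ring
      omega
  · have : (P.m + 1) * (P.numC * 38 + 42)
        = P.m * (P.numC * 38 + 40) + P.m * 2 + P.numC * 38 + 42 := by ring
    omega

/-- Sample a client with probability proportional to its truncated power. -/
def Cmd.drawClient : Cmd :=
  .seq (.forLt 9 (.get 0 (.const 0))
    (.branch (.realLt (.var 4) (.get 1 (.var 9))) (.setReal 2 (.var 9) (.var 4))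
      (.setReal 2 (.var 9) (.get 1 (.var 9))))) <|
  .seq (.setReal 5 (.const 0) (.ofNat (.const 0))) <|
  .seq (.forLt 9 (.get 0 (.const 0))
    (.setReal 5 (.const 0) (.add (.var 5) (.get 2 (.var 9))))) <|
  .seq (.seq (.sample 6 (.const 0)) (.seq (.setReal 6 (.const 0) (.mul (.var 6) (.var 5)))
    (.seq (.setReal 7 (.const 0) (.ofNat (.const 0))) (.setNat 8 (.const 0) (.const 0))))) <|
  .forLt 9 (.get 0 (.const 0))
    (.seq (.branch (.realLt (.var 6) (.var 7)) .skip (.setNat 8 (.const 0) (.var 9)))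
      (.setReal 7 (.const 0) (.add (.var 7) (.get 2 (.var 9)))))

/-- The code forms the truncated powers and their total, scales one uniform number by the total, and
scans the partial sums. The scan is the recursion of `pickIndex` run forwards, and exactly one
number of the tape is used. -/
theorem Cmd.drawClient_halts [MetricSpace X] {σ : State} {F : Finset ℕ} (hI : Input P k σ)
    (hD : ∀ x < P.numC, σ.real 1 x = P.power F (P.client x)) (hT : σ.real 4 0 = P.threshold F) :
    Halts E .drawClient σ (P.numC * 100 + 100) fun τ =>
      τ.nat 8 0 = P.drawn F (σ.tape 0) ∧ τ.tape = fun t => σ.tape (t + 1) := by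
  refine Halts.seq (T₁ := P.numC * 40 + 10) (T₂ := P.numC * 60 + 80)
    (R := fun τ => ∀ x < P.numC, τ.real 2 x = P.weight F x) ?_ ?_ (by omega)
  · refine Halts.forLt (n := P.numC) (T := 18) (fun i τ => ∀ x < i, τ.real 2 x = P.weight F x)
      (by decide) ?_ ?_ ?_ (by simp only [NExp.cost]; omega)
    · intro τ hf
      simpa [NExp.eval] using (hI.frame hf (by decide)).numC
    · simp
    · intro i hi τ hf hvi h
      refine Halts.of_straight rfl τ (by decide) ?_
      have e₁ : τ.real 1 i = P.power F (P.client i) := by rw [hf.real 1 (by decide), hD i hi]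
      have e₂ : τ.real 4 0 = P.threshold F := by rw [hf.real 4 (by decide), hT]
      intro x hx
      simp only [Cmd.run, BExp.holds, State.setReal, State.setNat, NExp.eval, RExp.eval, hvi, e₁,
        e₂]
      by_cases hxi : x = i
      · subst hxi
        split_ifs with hlt
        · simp [IndexedInstance.weight, hlt.le]
        · simp [IndexedInstance.weight, not_lt.1 hlt]
      · split_ifs <;> simp [hxi, h x (by omega)]
  intro τ hf hw
  replace hI := hI.frame hf (by decide)
  rw [← hf.tape (by decide)]
  clear hD hT hf
  refine Halts.seq (T₁ := 4) (T₂ := P.numC * 60 + 75) (Halts.of_straight rfl τ (by decide) rfl) ?_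
    (by omega)
  rintro _ - rfl
  refine Halts.seq (T₁ := P.numC * 25 + 10) (T₂ := P.numC * 35 + 50)
    (R := fun ρ => ρ.real 5 0 = ∑ x ∈ Finset.range P.numC, P.weight F x) ?_ ?_ (by omega)
  · refine Halts.forLt (n := P.numC) (T := 12) (fun i ρ => ρ.real 5 0 =
      ∑ x ∈ Finset.range i, P.weight F x) (by decide) ?_ ?_ ?_ (by simp only [NExp.cost]; omega)
    · intro ρ hf
      have := hf.nat 0 (by decide)
      simp [NExp.eval, this, Cmd.run, State.setReal, hI.numC]
    · simp [Cmd.run, State.setReal, State.setNat, NExp.eval, RExp.eval]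
    · intro i hi ρ hf hvi h
      refine Halts.of_straight rfl ρ (by decide) ?_
      have e : ρ.real 2 i = P.weight F i := by
        rw [hf.real 2 (by decide), ← hw i hi]
        simp [Cmd.run, State.setReal]
      simp [Cmd.run, State.setReal, State.setNat, NExp.eval, RExp.eval, hvi, h, e,
        Finset.sum_range_succ]
  intro ρ hf hW
  have e : τ.tape = ρ.tape := by rw [hf.tape (by decide)]; rfl
  have hwρ : ∀ x < P.numC, ρ.real 2 x = P.weight F x := by
    intro x hx
    rw [hf.real 2 (by decide), ← hw x hx]
    simp [Cmd.run, State.setReal]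
  have hIρ : Input P k ρ := by
    have : ρ.nat 0 = τ.nat 0 := by rw [hf.nat 0 (by decide)]; rfl
    exact ⟨by rw [this, hI.numC], by rw [this, hI.numL], by rw [this, hI.k], by rw [this, hI.m]⟩
  rw [e]
  clear hf hI hw e
  refine Halts.seq (T₁ := 20) (T₂ := P.numC * 35 + 20) (Halts.of_straight rfl ρ (by decide) rfl) ?_
    (by omega)
  rintro _ hfr rfl
  have hI' := hIρ.frame hfr (by decide)
  -- The partial sum is updated after the test, so in round `i` it contains only the weights of the
  -- indices below `i`, as in `pickIndex`.
  refine (Halts.forLt (n := P.numC) (T := 22) (fun i π => π.nat 8 0 = pickIndex (P.weight F)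
      ((ρ.tape 0 : ℝ) * ∑ x ∈ Finset.range P.numC, P.weight F x) i ∧ π.real 7 0 =
      ∑ x ∈ Finset.range i, P.weight F x ∧ π.tape = fun t => ρ.tape (t + 1)) (by decide) ?_ ?_ ?_
      (by simp only [NExp.cost]; omega)).mono le_rfl fun π _ h => ⟨h.1, h.2.2⟩
  · intro π hf
    simpa [NExp.eval] using (hI'.frame hf (by decide)).numC
  · simp [Cmd.run, State.setReal, State.setNat, State.draw, NExp.eval, RExp.eval, pickIndex]
  · rintro i hi π hf hvi ⟨h₁, h₂, h₃⟩
    refine Halts.of_straight rfl π (by decide) ?_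
    have e : π.real 2 i = P.weight F i := by
      rw [hf.real 2 (by decide), hfr.real 2 (by decide), ← hwρ i hi]
    have e' : π.real 6 0 = (ρ.tape 0 : ℝ) * ∑ x ∈ Finset.range P.numC, P.weight F x := by
      rw [hf.real 6 (by decide)]
      simp [Cmd.run, State.setReal, State.setNat, State.draw, NExp.eval, RExp.eval, hW]
    simp only [Cmd.run, BExp.holds, NExp.eval, RExp.eval, hvi, e', h₂, pickIndex]
    split_ifs with hlt
    · simp [State.setReal, State.setNat, h₁, h₂, h₃, hvi, e, Finset.sum_range_succ]
    · simp [State.setReal, State.setNat, h₂, h₃, hvi, e, Finset.sum_range_succ]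

end RealRAM

/-! ### Machine code: opening the nearest unused location -/

namespace RealRAM

variable {X : Type*} [MetricSpace X] {P : IndexedInstance X} {k : ℕ} {E : Env}

/-- The oracle answers with the distances of the instance. -/
structure Represents (E : Env) (P : IndexedInstance X) : Prop where
  dist : ∀ x f, x < max P.numC 1 → f < P.numL →
    E.dist x (P.numC + f) = dist (P.client x) (P.loc f)
  ell : E.ell = P.ell

/-- Find the unused location nearest to the client in the natural variable `8`. -/
def Cmd.findNearest : Cmd :=
  .seq (.forLt 9 (.get 0 (.const 1))
    (.setReal 3 (.var 9) (.div (.ofNat (.const 1))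
      (.add (.ofNat (.const 1)) (.dist (.var 8) (.add (.get 0 (.const 0)) (.var 9)))))))
    (.argmax 1 5 3)

theorem Cmd.findNearest_halts {σ : State} {F : Finset ℕ} {x : ℕ} (hE : Represents E P)
    (hI : Input P k σ) (hx : σ.nat 8 0 = x) (hx' : x < max P.numC 1)
    (hF : ∀ f < P.numL, (σ.nat 5 f < 1 ↔ f ∉ F)) :
    Halts E .findNearest σ (P.numL * 70 + 40) fun τ => τ.nat 7 0 = P.nearest F x := by
  refine Halts.seq (T₁ := P.numL * 32 + 10) (T₂ := P.numL * 38 + 22)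
    (R := fun τ => ∀ f < P.numL, τ.real 3 f = 1 / (1 + dist (P.client x) (P.loc f)))
    ?_ ?_ (by omega)
  · refine Halts.forLt (n := P.numL) (T := 19) (fun i τ => ∀ f < i, τ.real 3 f =
      1 / (1 + dist (P.client x) (P.loc f))) (by decide) ?_ ?_ ?_ (by simp only [NExp.cost]; omega)
    · intro τ hf
      simpa [NExp.eval] using (hI.frame hf (by decide)).numL
    · simp
    · intro i hi τ hf hvi h
      refine Halts.of_straight rfl τ (by decide) ?_
      have e : τ.nat 8 0 = x := by rw [hf.nat 8 (by decide), hx]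
      intro f hfi
      simp only [Cmd.run, State.setReal, State.setNat, NExp.eval, RExp.eval, hvi, e,
        (hI.frame hf (by decide)).numC, hE.dist x i hx' hi]
      by_cases hfe : f = i
      · simp [hfe]
      · simp [hfe, h f (by omega)]
  · intro τ hf h
    refine (Cmd.argmax_halts (by decide) (by decide) (by decide) (hI.frame hf (by decide)).numL
      (U := F) ?_ h).mono le_rfl fun π _ h => h.1
    rw [hf.nat 5 (by decide)]
    exact hF

/-- The memory holds the set `F` of the `i` locations chosen so far, the powers of the clients, and
for each client the position of its nearest chosen location. -/
structure Chosen (P : IndexedInstance X) (i : ℕ) (F : Finset ℕ) (σ : State) : Prop where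
  subset : ∀ f ∈ F, f < P.numL
  enum : (Finset.range i).image (σ.nat 3) = F
  card : F.card = i
  used : ∀ f < P.numL, (σ.nat 5 f < 1 ↔ f ∉ F)
  power : ∀ x < P.numC, σ.real 1 x = P.power F (P.client x)
  label : 0 < i → ∀ x < P.numC, σ.nat 4 x < i ∧
    P.power F (P.client x) = dist (P.client x) (P.loc (σ.nat 3 (σ.nat 4 x))) ^ P.ell

/-- Append the location in the natural variable `7` to the chosen ones. -/
def Cmd.addLocation : Cmd :=
  .seq (.seq (.setNat 3 (.var 11) (.var 7)) (.setNat 5 (.var 7) (.const 1))) <|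
  .forLt 9 (.get 0 (.const 0))
    (.seq (.setReal 11 (.const 0) (.powEll (.dist (.var 9) (.add (.get 0 (.const 0)) (.var 7)))))
      (.branch (.natLt (.var 11) (.const 1))
        (.seq (.setReal 1 (.var 9) (.var 11)) (.setNat 4 (.var 9) (.var 11)))
        (.branch (.realLt (.var 11) (.get 1 (.var 9)))
          (.seq (.setReal 1 (.var 9) (.var 11)) (.setNat 4 (.var 9) (.var 11)))
          .skip)))

/-- A minimum over `insert b F` is the minimum of the old value and one new distance power, so one
pass over the clients suffices. The first location is an exception: it must overwrite the
placeholder `1` even where its distance power is larger, whence the separate treatment of `i = 0`.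
-/
theorem Cmd.addLocation_halts {σ : State} {F : Finset ℕ} {i b : ℕ} (hE : Represents E P)
    (hI : Input P k σ) (hσ : Chosen P i F σ) (hi : σ.nat 11 0 = i) (hb : σ.nat 7 0 = b)
    (hbL : b < P.numL) (hbF : b ∉ F) :
    Halts E .addLocation σ (P.numC * 80 + 40) (Chosen P (i + 1) (insert b F)) := by
  refine Halts.seq (T₁ := 20) (T₂ := P.numC * 80 + 10) (Halts.of_straight rfl σ (by decide) rfl) ?_
    (by omega)
  rintro _ hf₀ rfl
  have hI₀ := hI.frame hf₀ (by decide)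
  set ρ := Cmd.run E (.seq (.setNat 3 (.var 11) (.var 7)) (.setNat 5 (.var 7) (.const 1))) σ
    with hρ
  have ρ3 : ρ.nat 3 = Function.update (σ.nat 3) i b := by
    simp [hρ, Cmd.run, State.setNat, NExp.eval, hi, hb]
  have ρ5 : ρ.nat 5 = Function.update (σ.nat 5) b 1 := by
    simp [hρ, Cmd.run, State.setNat, NExp.eval, hb]
  have ρ1 : ρ.real 1 = σ.real 1 := hf₀.real 1 (by decide)
  have ρ4 : ρ.nat 4 = σ.nat 4 := hf₀.nat 4 (by decide)
  have ρ7 : ρ.nat 7 0 = b := by rw [hf₀.nat 7 (by decide), hb]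
  have ρ11 : ρ.nat 11 0 = i := by rw [hf₀.nat 11 (by decide), hi]
  have hFi : i = 0 → F = ∅ := fun h => Finset.card_eq_zero.1 (hσ.card.trans h)
  have key : ∀ x < P.numC, 0 < i → ¬ dist (P.client x) (P.loc b) ^ P.ell < σ.real 1 x →
      σ.real 1 x = P.power (insert b F) (P.client x) ∧ σ.nat 4 x < i + 1 ∧
      P.power (insert b F) (P.client x) =
        dist (P.client x) (P.loc (ρ.nat 3 (σ.nat 4 x))) ^ P.ell := by
    intro x hx hi0 hlt
    have hne : F.Nonempty := Finset.card_pos.1 (hσ.card ▸ hi0)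
    have hl := hσ.label hi0 x hx
    rw [hσ.power x hx] at hlt
    rw [P.power_insert hne, min_eq_right (not_lt.1 hlt), ρ3,
      Function.update_of_ne (by omega)]
    exact ⟨hσ.power x hx, by omega, hl.2⟩
  have key' : ∀ x < P.numC, (i = 0 ∨ dist (P.client x) (P.loc b) ^ P.ell < σ.real 1 x) →
      P.power (insert b F) (P.client x) = dist (P.client x) (P.loc b) ^ P.ell := by
    intro x hx h
    rcases Nat.eq_zero_or_pos i with h0 | hi0
    · rw [hFi h0]
      exact P.power_singleton _ _
    · have h := h.resolve_left hi0.ne'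
      have hne : F.Nonempty := Finset.card_pos.1 (hσ.card ▸ hi0)
      rw [hσ.power x hx] at h
      rw [P.power_insert hne, min_eq_left h.le]
  -- The second half of the invariant, that clients from `j` on are untouched, ensures that the
  -- comparison in round `j` still sees the old power.
  refine (Halts.forLt (n := P.numC) (T := 60) (fun j π => ∀ x < P.numC,
    (x < j → π.real 1 x = P.power (insert b F) (P.client x) ∧ π.nat 4 x < i + 1 ∧
      P.power (insert b F) (P.client x) =
        dist (P.client x) (P.loc (ρ.nat 3 (π.nat 4 x))) ^ P.ell) ∧
    (j ≤ x → π.real 1 x = σ.real 1 x ∧ π.nat 4 x = σ.nat 4 x)) (by decide) ?_ ?_ ?_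
    (T' := P.numC * 80 + 10)
      (by simp only [NExp.cost]; omega)).mono le_rfl ?_
  · intro π hf
    simpa [NExp.eval] using (hI₀.frame hf (by decide)).numC
  · intro x hx
    simp [State.setNat, ρ1, ρ4]
  · intro j hj π hf hvj h
    refine Halts.of_straight rfl π (by decide) ?_
    have e₁ : π.nat 7 0 = b := by rw [hf.nat 7 (by decide), ρ7]
    have e₂ : π.nat 11 0 = i := by rw [hf.nat 11 (by decide), ρ11]
    have e₃ : |dist (P.client j) (P.loc b)| = dist (P.client j) (P.loc b) :=
      abs_of_nonneg dist_nonneg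
    have e₄ := ((h j hj).2 le_rfl).1
    have e₅ := ((h j hj).2 le_rfl).2
    intro x hx
    simp only [Cmd.run, BExp.holds, NExp.eval, RExp.eval, State.setReal, State.setNat, hvj, e₁, e₂,
      (hI₀.frame hf (by decide)).numC, hE.dist j b (by omega) hbL, hE.ell, e₃]
    simp only [Function.update_self, ne_eq, OfNat.one_ne_ofNat, Nat.reduceEqDiff,
      not_false_eq_true, Function.update_of_ne, e₄, Nat.lt_one_iff]
    by_cases h0 : i = 0 ∨ dist (P.client j) (P.loc b) ^ P.ell < σ.real 1 j
    · by_cases hxj : x = j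
      · subst hxj
        have hk := key' x hx h0
        rcases Nat.eq_zero_or_pos i with h1 | h1
        · simp [h1, hk, ρ3]
        · simp [h1.ne', h0.resolve_left h1.ne', hk, ρ3]
      · have hx₁ := (h x hx).1
        have hx₂ := (h x hx).2
        rcases Nat.eq_zero_or_pos i with h1 | h1
        · subst h1
          simp only [if_true, Function.update_self, Function.update_of_ne hxj]
          exact ⟨fun h => hx₁ (by omega), fun h => hx₂ (by omega)⟩
        · simp only [h1.ne', h0.resolve_left h1.ne', if_true, if_false, Function.update_self,
            Function.update_of_ne hxj]
          exact ⟨fun h => hx₁ (by omega), fun h => hx₂ (by omega)⟩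
    · push Not at h0
      simp only [h0.1, not_lt.2 h0.2, if_false]
      by_cases hxj : x = j
      · subst hxj
        have hk := key x hx (by omega) (not_lt.2 h0.2)
        simp [e₄, e₅] at hk ⊢
        exact hk
      · have hx₁ := (h x hx).1
        have hx₂ := (h x hx).2
        simp only [ne_eq, OfNat.one_ne_ofNat, not_false_eq_true, Function.update_of_ne]
        exact ⟨fun h => hx₁ (by omega), fun h => hx₂ (by omega)⟩
  · intro π hf h
    have π3 : π.nat 3 = ρ.nat 3 := hf.nat 3 (by decide)
    have π5 : π.nat 5 = ρ.nat 5 := hf.nat 5 (by decide)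
    refine ⟨?_, ?_, ?_, ?_, ?_, ?_⟩
    · intro f hf
      rcases Finset.mem_insert.1 hf with rfl | hf
      · exact hbL
      · exact hσ.subset f hf
    · rw [π3, ρ3, Finset.range_add_one, Finset.image_insert, Function.update_self, ← hσ.enum]
      congr 1
      refine Finset.image_congr fun x hx => ?_
      exact Function.update_of_ne (by simpa using (Finset.mem_range.1 hx).ne) _ _
    · rw [Finset.card_insert_of_notMem hbF, hσ.card]
    · intro f hf
      rw [π5, ρ5, Finset.mem_insert]
      by_cases hfb : f = b
      · simp [hfb]
      · rw [Function.update_of_ne hfb, hσ.used f hf]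
        simp [hfb]
    · exact fun x hx => ((h x hx).1 hx).1
    · rw [π3]
      exact fun _ x hx => ((h x hx).1 hx).2

end RealRAM

/-! ### Machine code: one round, and keeping the best result -/

namespace RealRAM

variable {X : Type*} [MetricSpace X] {P : IndexedInstance X} {k : ℕ} {E : Env}

/-- One round: sample a client and choose the nearest unused location. -/
def Cmd.round : Cmd :=
  .seq .markTop <| .seq (.argmax 0 6 1) <| .seq .drawClient <| .seq .findNearest .addLocation

theorem Cmd.round_halts {σ : State} {F : Finset ℕ} {i : ℕ} (hE : Represents E P)
    (hI : Input P k σ) (hm : P.m ≤ P.numC) (hσ : Chosen P i F σ) (hi : σ.nat 11 0 = i)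
    (hiL : i < P.numL) :
    Halts E .round σ ((P.m + 1) * (P.numC * 38 + 42) + P.numC * 218 + P.numL * 70 + 206) fun τ =>
      Chosen P (i + 1) (P.next F (σ.tape 0)) τ ∧ τ.tape = fun t => σ.tape (t + 1) := by
  have hD0 : ∀ x < P.numC, 0 ≤ P.power F (P.client x) := fun x _ => P.power_nonneg _ _
  refine Halts.seq (T₂ := P.numC * 218 + P.numL * 70 + 205)
    (Cmd.markTop_halts hI hm hσ.power hD0) ?_ (by omega)
  rintro τ₁ hf₁ ⟨M, hM, hMτ⟩
  have hI₁ := hI.frame hf₁ (by decide)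
  have hp₁ : τ₁.real 1 = σ.real 1 := hf₁.real 1 (by decide)
  refine Halts.seq (T₁ := P.numC * 38 + 22) (T₂ := P.numC * 180 + P.numL * 70 + 182)
    (Cmd.argmax_halts (U := M) (v := fun x => P.power F (P.client x))
      (by decide) (by decide) (by decide) hI₁.numC hMτ (by rw [hp₁]; exact hσ.power)) ?_ (by omega)
  rintro τ₂ hf₂ ⟨-, hT⟩
  have hI₂ := hI₁.frame hf₂ (by decide)
  have hp₂ : τ₂.real 1 = σ.real 1 := by rw [hf₂.real 1 (by decide), hp₁]
  -- The maximum over the unmarked clients is a threshold, hence by uniqueness the threshold used in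
  -- the analysis, whichever top set was marked.
  rw [← P.threshold_eq (hM.isThreshold hD0)] at hT
  have ht₂ : τ₂.tape = σ.tape := by rw [hf₂.tape (by decide), hf₁.tape (by decide)]
  refine Halts.seq (T₁ := P.numC * 100 + 100) (T₂ := P.numC * 80 + P.numL * 70 + 81)
    (Cmd.drawClient_halts hI₂ (by rw [hp₂]; exact hσ.power) hT) ?_ (by omega)
  rintro τ₃ hf₃ ⟨hd, ht₃⟩
  rw [ht₂] at hd ht₃
  have hI₃ := hI₂.frame hf₃ (by decide)
  have h5 : τ₃.nat 5 = σ.nat 5 := by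
    rw [hf₃.nat 5 (by decide), hf₂.nat 5 (by decide), hf₁.nat 5 (by decide)]
  -- Without clients `pickIndex` returns `0`, and the oracle is queried at index `0` nevertheless;
  -- hence the bound `max P.numC 1`.
  have hx : P.drawn F (σ.tape 0) < max P.numC 1 := by
    rcases Nat.eq_zero_or_pos P.numC with h0 | h0
    · simp [IndexedInstance.drawn, h0, pickIndex]
    · exact lt_max_of_lt_left (pickIndex_lt h0)
  have hfree : ∃ f < P.numL, f ∉ F := by
    by_contra! h
    have := Finset.card_le_card (s := Finset.range P.numL) (t := F)
      fun f hf => h f (Finset.mem_range.1 hf)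
    rw [hσ.card, Finset.card_range] at this
    omega
  refine Halts.seq (T₁ := P.numL * 70 + 40) (T₂ := P.numC * 80 + 40)
    (Cmd.findNearest_halts hE hI₃ hd hx (by rw [h5]; exact hσ.used)) ?_ (by omega)
  rintro τ₄ hf₄ hb
  have hnat : ∀ a ∈ [3, 4, 5, 11], τ₄.nat a = σ.nat a := by
    intro a ha
    have h₁ : ∀ a ∈ [3, 4, 5, 11], Cmd.markTop.writesNat a = false := by decide
    have h₂ : ∀ a ∈ [3, 4, 5, 11], (Cmd.argmax 0 6 1).writesNat a = false := by decide
    have h₃ : ∀ a ∈ [3, 4, 5, 11], Cmd.drawClient.writesNat a = false := by decide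
    have h₄ : ∀ a ∈ [3, 4, 5, 11], Cmd.findNearest.writesNat a = false := by decide
    rw [hf₄.nat a (h₄ a ha), hf₃.nat a (h₃ a ha), hf₂.nat a (h₂ a ha), hf₁.nat a (h₁ a ha)]
  have hp₄ : τ₄.real 1 = σ.real 1 := by
    rw [hf₄.real 1 (by decide), hf₃.real 1 (by decide), hp₂]
  have hσ₄ : Chosen P i F τ₄ :=
    ⟨hσ.subset, by rw [hnat 3 (by decide)]; exact hσ.enum, hσ.card,
      by rw [hnat 5 (by decide)]; exact hσ.used, by rw [hp₄]; exact hσ.power,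
      by rw [hnat 3 (by decide), hnat 4 (by decide)]; exact hσ.label⟩
  obtain ⟨hbL, hbF, -⟩ := P.nearest_spec (x := P.drawn F (σ.tape 0)) hfree
  refine (Cmd.addLocation_halts hE (hI₃.frame hf₄ (by decide)) hσ₄
    (by rw [hnat 11 (by decide), hi]) hb hbL hbF).mono le_rfl fun τ hf h => ⟨h, ?_⟩
  rw [hf.tape (by decide), hf₄.tape (by decide), ht₃]

/-- Copy the chosen locations and the clustering to the output arrays. -/
def Cmd.save : Cmd :=
  .seq (.seq (.setReal 8 (.const 0) (.var 12)) (.setNat 13 (.const 0) (.const 1))) <|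
  .seq (.forLt 9 (.get 0 (.const 2)) (.setNat 1 (.var 9) (.get 3 (.var 9)))) <|
  .forLt 9 (.get 0 (.const 0))
    (.branch (.natLt (.get 6 (.var 9)) (.const 1)) (.setNat 2 (.var 9) (.get 4 (.var 9)))
      (.setNat 2 (.var 9) (.get 0 (.const 2))))

/-- The output arrays describe a feasible solution of cost `v`. -/
structure Saved (P : IndexedInstance X) (k : ℕ) (v : ℝ) (τ : State) : Prop where
  lt : ∀ j < k, τ.nat 1 j < P.numL
  inj : Set.InjOn (τ.nat 1) (Finset.range k)
  cost : ∃ M ⊆ Finset.range P.numC, M.card = P.m ∧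
    (∀ x < P.numC, (τ.nat 2 x < k ↔ x ∉ M)) ∧
    ∑ x ∈ Finset.range P.numC \ M,
      dist (P.client x) (P.loc (τ.nat 1 (τ.nat 2 x))) ^ P.ell = v

theorem Cmd.save_halts {σ : State} {F M : Finset ℕ} (hk : 0 < k)
    (hI : Input P k σ) (hσ : Chosen P k F σ) (hM : IsTopSet (fun x => P.power F (P.client x))
      P.numC P.m M) (hMσ : ∀ x < P.numC, (σ.nat 6 x < 1 ↔ x ∉ M))
    (hc : σ.real 12 0 = ∑ x ∈ Finset.range P.numC \ M, P.power F (P.client x)) :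
    Halts E .save σ (P.numC * 40 + k * 40 + 60) fun τ =>
      τ.nat 13 0 = 1 ∧ τ.real 8 0 = σ.real 12 0 ∧ Saved P k (τ.real 8 0) τ := by
  refine Halts.seq (T₁ := 10) (T₂ := P.numC * 40 + k * 40 + 49)
    (Halts.of_straight rfl σ (by decide) rfl) ?_ (by omega)
  rintro _ hf₀ rfl
  have hI₀ := hI.frame hf₀ (by decide)
  have e₁ : (Cmd.run E ((Cmd.setReal 8 (.const 0) (.var 12)).seq
      (.setNat 13 (.const 0) (.const 1))) σ).nat 13 0 = 1 := by
    simp [Cmd.run, State.setNat, NExp.eval]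
  have e₂ : (Cmd.run E ((Cmd.setReal 8 (.const 0) (.var 12)).seq
      (.setNat 13 (.const 0) (.const 1))) σ).real 8 0 = σ.real 12 0 := by
    simp [Cmd.run, State.setNat, State.setReal, NExp.eval, RExp.eval]
  generalize Cmd.run E ((Cmd.setReal 8 (.const 0) (.var 12)).seq
      (.setNat 13 (.const 0) (.const 1))) σ = ρ at *
  refine Halts.seq (T₁ := k * 40 + 10) (T₂ := P.numC * 40 + 10)
    (R := fun τ => ∀ j < k, τ.nat 1 j = σ.nat 3 j) ?_ ?_ (by omega)
  · refine Halts.forLt (n := k) (T := 20) (fun i τ => ∀ j < i, τ.nat 1 j = σ.nat 3 j)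
      (by decide) ?_ ?_ ?_ (by simp only [NExp.cost]; omega)
    · intro τ hf
      simpa [NExp.eval] using (hI₀.frame hf (by decide)).k
    · simp
    · intro i hi τ hf hvi h
      refine Halts.of_straight rfl τ (by decide) ?_
      have e : τ.nat 3 = σ.nat 3 := by rw [hf.nat 3 (by decide), hf₀.nat 3 (by decide)]
      intro j hj
      simp only [Cmd.run, State.setNat, NExp.eval, hvi, e]
      by_cases hji : j = i
      · simp [hji]
      · simp [hji, h j (by omega)]
  intro τ hf h
  have hIτ := hI₀.frame hf (by decide)
  -- Outliers receive the label `k`, the smallest one that is not the name of a cluster.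
  refine (Halts.forLt (n := P.numC) (T := 25) (T' := P.numC * 40 + 10) (fun i π => ∀ x < i,
      π.nat 2 x = if x ∈ M then k else σ.nat 4 x) (by decide) ?_ ?_ ?_
      (by simp only [NExp.cost]; omega)).mono le_rfl ?_
  · intro π hf'
    simpa [NExp.eval] using (hIτ.frame hf' (by decide)).numC
  · simp
  · intro i hi π hf' hvi hπ
    refine Halts.of_straight rfl π (by decide) ?_
    have e4 : π.nat 4 = σ.nat 4 := by
      rw [hf'.nat 4 (by decide), hf.nat 4 (by decide), hf₀.nat 4 (by decide)]
    have e6 : π.nat 6 = σ.nat 6 := by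
      rw [hf'.nat 6 (by decide), hf.nat 6 (by decide), hf₀.nat 6 (by decide)]
    intro x hx
    simp only [Cmd.run, BExp.holds, NExp.eval, hvi, e4, e6, hMσ i hi, State.setNat,
      (hIτ.frame hf' (by decide)).k]
    by_cases hxi : x = i
    · subst hxi
      by_cases hxM : x ∈ M <;> simp [hxM]
    · have := hπ x (by omega)
      split_ifs <;> simp_all
  · intro π hf' h'
    have e1 : ∀ j < k, π.nat 1 j = σ.nat 3 j := by rw [hf'.nat 1 (by decide)]; exact h
    have e8 : π.real 8 0 = σ.real 12 0 := by
      rw [hf'.real 8 (by decide), hf.real 8 (by decide), e₂]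
    have hinj : Set.InjOn (σ.nat 3) (Finset.range k) := by
      rw [← Finset.card_image_iff, hσ.enum, hσ.card, Finset.card_range]
    refine ⟨by rw [hf'.nat 13 (by decide), hf.nat 13 (by decide), e₁], e8, ?_, ?_, ?_⟩
    · intro j hj
      rw [e1 j hj]
      exact hσ.subset _ (hσ.enum ▸ Finset.mem_image_of_mem _ (Finset.mem_range.2 hj))
    · intro i hi j hj hij
      simp only [Finset.coe_range, Set.mem_Iio] at hi hj
      rw [e1 i hi, e1 j hj] at hij
      exact hinj (by simpa using hi) (by simpa using hj) hij
    · refine ⟨M, hM.subset, hM.card, fun x hx => ?_, ?_⟩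
      · rw [h' x hx]
        by_cases hxM : x ∈ M
        · simp [hxM]
        · simp [hxM, (hσ.label hk x hx).1]
      · rw [e8, hc]
        refine Finset.sum_congr rfl fun x hx => ?_
        simp only [Finset.mem_sdiff, Finset.mem_range] at hx
        have hl := hσ.label hk x hx.1
        rw [h' x hx.1, if_neg hx.2, hl.2, e1 _ hl.1]

/-- Compute the cost of the chosen locations and keep them if they are better than the saved
ones. -/
def Cmd.collect : Cmd :=
  .seq .markTop <| .seq (.setReal 12 (.const 0) (.ofNat (.const 0))) <|
  .seq (.forLt 9 (.get 0 (.const 0)) (.branch (.natLt (.get 6 (.var 9)) (.const 1))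
    (.setReal 12 (.const 0) (.add (.var 12) (.get 1 (.var 9)))) .skip)) <|
  .branch (.natLt (.var 13) (.const 1)) .save (.branch (.realLt (.var 12) (.var 8)) .save .skip)

/-- The output arrays hold a feasible solution whose cost is stored in the real variable `8`. -/
def HasSolution (P : IndexedInstance X) (k : ℕ) (τ : State) : Prop :=
  τ.nat 13 0 = 1 ∧ Saved P k (τ.real 8 0) τ

/-- A lower bound for the cost of the clients after the removal of any `m` of them. -/
def IsCheapest (P : IndexedInstance X) (F : Finset ℕ) (v : ℝ) : Prop :=
  ∀ N ⊆ Finset.range P.numC, N.card = P.m →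
    v ≤ ∑ x ∈ Finset.range P.numC \ N, P.power F (P.client x)

/-- Removing a top set is the cheapest removal (`IsTopSet.sum_le`), so the computed cost is a lower
bound for every choice of outliers. A previously saved value that is not beaten is no larger, hence
a lower bound too. The natural variable `13` records whether anything has been saved. -/
theorem Cmd.collect_halts {σ : State} {F : Finset ℕ} (hk : 0 < k) (hm : P.m ≤ P.numC)
    (hI : Input P k σ) (hσ : Chosen P k F σ) (hs : σ.nat 13 0 = 0 ∨ HasSolution P k σ) :
    Halts E .collect σ ((P.m + 1) * (P.numC * 38 + 42) + P.numC * 80 + k * 40 + 100) fun τ =>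
      HasSolution P k τ ∧ IsCheapest P F (τ.real 8 0) ∧
        (σ.nat 13 0 = 0 ∨ τ.real 8 0 ≤ σ.real 8 0) := by
  have hD0 : ∀ x < P.numC, 0 ≤ P.power F (P.client x) := fun x _ => P.power_nonneg _ _
  refine Halts.seq (T₂ := P.numC * 80 + k * 40 + 99)
    (Cmd.markTop_halts hI hm hσ.power hD0) ?_ (by omega)
  rintro τ hf ⟨M, hM, hMτ⟩
  have hn : ∀ a, Cmd.markTop.writesNat a = false → τ.nat a = σ.nat a := hf.nat
  have hσ₁ : Chosen P k F τ :=
    ⟨hσ.subset, by rw [hn 3 (by decide)]; exact hσ.enum, hσ.card,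
      by rw [hn 5 (by decide)]; exact hσ.used, by rw [hf.real 1 (by decide)]; exact hσ.power,
      by rw [hn 3 (by decide), hn 4 (by decide)]; exact hσ.label⟩
  have hs₁ : τ.nat 13 0 = 0 ∨ HasSolution P k τ := by
    rw [HasSolution, hn 13 (by decide), hf.real 8 (by decide)]
    refine hs.imp id fun h => ⟨h.1, ?_⟩
    obtain ⟨h₁, h₂, h₃⟩ := h.2
    exact ⟨by rw [hn 1 (by decide)]; exact h₁, by rw [hn 1 (by decide)]; exact h₂,
      by rw [hn 1 (by decide), hn 2 (by decide)]; exact h₃⟩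
  have hI₁ := hI.frame hf (by decide)
  rw [← hn 13 (by decide), ← hf.real 8 (by decide)]
  clear hn hf hσ hs hI
  refine Halts.seq (T₁ := 4) (T₂ := P.numC * 80 + k * 40 + 94)
    (Halts.of_straight rfl τ (by decide) rfl) ?_ (by omega)
  rintro _ hf₀ rfl
  have e₀ : (Cmd.run E (.setReal 12 (.const 0) (.ofNat (.const 0))) τ).real 12 0 = 0 := by
    simp [Cmd.run, State.setReal, NExp.eval, RExp.eval]
  have hI₀ := hI₁.frame hf₀ (by decide)
  generalize Cmd.run E (.setReal 12 (.const 0) (.ofNat (.const 0))) τ = ρ at *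
  refine Halts.seq (T₁ := P.numC * 40 + 10) (T₂ := P.numC * 40 + k * 40 + 80)
    (R := fun π => π.real 12 0 = ∑ x ∈ Finset.range P.numC \ M, P.power F (P.client x))
    ?_ ?_ (by omega)
  · refine (Halts.forLt (n := P.numC) (T := 22) (fun i π => π.real 12 0 =
      ∑ x ∈ Finset.range i, if x ∉ M then P.power F (P.client x) else 0) (by decide) ?_ ?_ ?_
      (by simp only [NExp.cost]; omega)).mono le_rfl ?_
    · intro π hf
      simpa [NExp.eval] using (hI₀.frame hf (by decide)).numC
    · simpa [State.setNat] using e₀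
    · intro i hi π hf hvi h
      refine Halts.of_straight rfl π (by decide) ?_
      have e6 : π.nat 6 i < 1 ↔ i ∉ M := by
        rw [hf.nat 6 (by decide), hf₀.nat 6 (by decide), hMτ i hi]
      have e1 : π.real 1 i = P.power F (P.client i) := by
        rw [hf.real 1 (by decide), hf₀.real 1 (by decide), hσ₁.power i hi]
      simp only [Cmd.run, BExp.holds, NExp.eval, RExp.eval, hvi, e6, Finset.sum_range_succ]
      split_ifs with h' <;> simp [State.setReal, State.setNat, h, e1]
    · intro π _ h
      rw [h, Finset.sdiff_eq_filter, Finset.sum_filter]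
  intro π hfπ hc
  have hIπ := hI₀.frame hfπ (by decide)
  have hn : ∀ a ∈ [1, 2, 3, 4, 5, 6, 13], π.nat a = τ.nat a := by
    intro a ha
    rw [hfπ.nat a ?_, hf₀.nat a ?_]
    · rfl
    · revert a; decide
  have h8 : π.real 8 = τ.real 8 := by rw [hfπ.real 8 (by decide), hf₀.real 8 (by decide)]
  have hσπ : Chosen P k F π :=
    ⟨hσ₁.subset, by rw [hn 3 (by decide)]; exact hσ₁.enum, hσ₁.card,
      by rw [hn 5 (by decide)]; exact hσ₁.used,
      by rw [hfπ.real 1 (by decide), hf₀.real 1 (by decide)]; exact hσ₁.power,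
      by rw [hn 3 (by decide), hn 4 (by decide)]; exact hσ₁.label⟩
  have hcheap : IsCheapest P F (π.real 12 0) := fun N hN hcard => by
    rw [hc]; exact hM.sum_le hN hcard
  have hsave := Cmd.save_halts (E := E) hk hIπ hσπ hM (by rw [hn 6 (by decide)]; exact hMτ) hc
  refine Halts.branch (T := P.numC * 40 + k * 40 + 70) ?_ ?_
    (by simp only [BExp.cost, NExp.cost]; omega)
  · intro h
    refine hsave.mono (by omega) ?_
    rintro ξ - ⟨h₁, h₂, h₃⟩
    refine ⟨⟨h₁, h₃⟩, h₂ ▸ hcheap, Or.inl ?_⟩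
    simpa [BExp.holds, NExp.eval, hn 13 (by decide)] using h
  · intro h
    have h13 : ¬ τ.nat 13 0 = 0 := by
      simpa [BExp.holds, NExp.eval, hn 13 (by decide)] using h
    refine Halts.branch (T := P.numC * 40 + k * 40 + 60) ?_ ?_
      (by simp only [BExp.cost, RExp.cost, NExp.cost]; omega)
    · intro hlt
      refine hsave.mono (by omega) ?_
      rintro ξ - ⟨h₁, h₂, h₃⟩
      refine ⟨⟨h₁, h₃⟩, h₂ ▸ hcheap, Or.inr ?_⟩
      simp only [BExp.holds, RExp.eval, NExp.eval, h8] at hlt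
      rw [h₂]
      exact hlt.le
    · intro hlt
      refine Halts.of_straight rfl π (T := P.numC * 40 + k * 40 + 60)
        (by simp only [Cmd.bound]; omega) ?_
      simp only [BExp.holds, RExp.eval, NExp.eval, not_lt] at hlt
      simp only [Cmd.run]
      refine ⟨?_, fun N hN hcard => hlt.trans (hcheap N hN hcard), Or.inr (by rw [h8])⟩
      have := hs₁.resolve_left h13
      rw [HasSolution, hn 13 (by decide), h8]
      obtain ⟨h₁, h₂, h₃⟩ := this.2
      exact ⟨this.1, by rw [hn 1 (by decide)]; exact h₁, by rw [hn 1 (by decide)]; exact h₂,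
        by rw [hn 1 (by decide), hn 2 (by decide)]; exact h₃⟩

end RealRAM

/-! ### Machine code: trials and the whole program -/

namespace RealRAM

variable {X : Type*} [MetricSpace X] {P : IndexedInstance X} {k : ℕ} {E : Env}

/-- Choose `k` locations, and keep them if they are better than the saved ones. -/
def Cmd.trial : Cmd :=
  .seq (.forLt 9 (.get 0 (.const 1)) (.setNat 5 (.var 9) (.const 0))) <|
  .seq (.forLt 9 (.get 0 (.const 0)) (.setReal 1 (.var 9) (.ofNat (.const 1)))) <|
  .seq (.forLt 11 (.get 0 (.const 2)) .round) .collect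

/-- A bound for the number of steps of a trial. -/
def trialTime (c l k m : ℕ) : ℕ := (k + 1) * ((m + 1) * (c * 38 + 42) + c * 218 + l * 70 + 260)

/-- A trial consumes exactly `k` numbers of the tape, so successive trials read disjoint blocks;
this is what later makes them independent. -/
theorem Cmd.trial_halts {σ : State} (hE : Represents E P) (hk : 0 < k) (hm : P.m ≤ P.numC)
    (hkL : k ≤ P.numL) (hI : Input P k σ) (hs : σ.nat 13 0 = 0 ∨ HasSolution P k σ) :
    Halts E .trial σ (trialTime P.numC P.numL k P.m) fun τ =>
      HasSolution P k τ ∧ IsCheapest P (P.rounds k ∅ σ.tape) (τ.real 8 0) ∧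
        (σ.nat 13 0 = 0 ∨ τ.real 8 0 ≤ σ.real 8 0) ∧ τ.tape = fun t => σ.tape (t + k) := by
  set R := (P.m + 1) * (P.numC * 38 + 42) + P.numC * 218 + P.numL * 70 + 206 with hR
  have hT : P.numL * 17 + P.numC * 18 + k * (R + 13) + 33
      + ((P.m + 1) * (P.numC * 38 + 42) + P.numC * 80 + k * 40 + 100)
      ≤ trialTime P.numC P.numL k P.m := by
    have h₁ : trialTime P.numC P.numL k P.m = (k + 1) * (R + 54) := by
      rw [trialTime, hR]
    have h₂ : (k + 1) * (R + 54) = k * (R + 13) + k * 41 + R + 54 := by ring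
    omega
  refine Halts.seq (T₁ := P.numL * 17 + 10) (T₂ := P.numC * 18 + k * (R + 13) + 22
      + ((P.m + 1) * (P.numC * 38 + 42) + P.numC * 80 + k * 40 + 100))
    (R := fun τ => ∀ f < P.numL, τ.nat 5 f = 0) ?_ ?_ (by omega)
  · refine Halts.forLt (n := P.numL) (T := 4) (fun i τ => ∀ x < i, τ.nat 5 x = 0)
      (by decide) ?_ ?_ ?_ (by simp only [NExp.cost]; omega)
    · intro τ hf
      simpa [NExp.eval] using (hI.frame hf (by decide)).numL
    · simp
    · intro i hi τ hf hvi h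
      refine Halts.of_straight rfl τ (by decide) ?_
      intro x hx
      simp only [Cmd.run, State.setNat, NExp.eval, hvi]
      by_cases hxi : x = i
      · simp [hxi]
      · simp [hxi, h x (by omega)]
  intro τ₁ hf₁ h₁
  have hI₁ := hI.frame hf₁ (by decide)
  refine Halts.seq (T₁ := P.numC * 18 + 10) (T₂ := k * (R + 13) + 11
      + ((P.m + 1) * (P.numC * 38 + 42) + P.numC * 80 + k * 40 + 100))
    (R := fun τ => ∀ x < P.numC, τ.real 1 x = 1) ?_ ?_ (by omega)
  · refine Halts.forLt (n := P.numC) (T := 5) (fun i τ => ∀ x < i, τ.real 1 x = 1)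
      (by decide) ?_ ?_ ?_ (by simp only [NExp.cost]; omega)
    · intro τ hf
      simpa [NExp.eval] using (hI₁.frame hf (by decide)).numC
    · simp
    · intro i hi τ hf hvi h
      refine Halts.of_straight rfl τ (by decide) ?_
      intro x hx
      simp only [Cmd.run, State.setReal, State.setNat, NExp.eval, RExp.eval, hvi]
      by_cases hxi : x = i
      · simp [hxi]
      · simp [hxi, h x (by omega)]
  intro τ₂ hf₂ h₂
  have hI₂ := hI₁.frame hf₂ (by decide)
  have ht₂ : τ₂.tape = σ.tape := by rw [hf₂.tape (by decide), hf₁.tape (by decide)]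
  have h5 : ∀ f < P.numL, τ₂.nat 5 f = 0 := by rw [hf₂.nat 5 (by decide)]; exact h₁
  refine Halts.seq (T₁ := k * (R + 13) + 10)
    (T₂ := (P.m + 1) * (P.numC * 38 + 42) + P.numC * 80 + k * 40 + 100)
    (R := fun τ => Chosen P k (P.rounds k ∅ σ.tape) τ ∧ τ.tape = fun t => σ.tape (t + k))
    ?_ ?_ (by omega)
  · refine Halts.forLt (n := k) (T := R) (fun i τ => Chosen P i (P.rounds i ∅ σ.tape) τ ∧
      τ.tape = fun t => σ.tape (t + i)) (by decide) ?_ ?_ ?_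
      (by simp only [NExp.cost, add_assoc, le_refl, Nat.reduceAdd])
    · intro τ hf
      simpa [NExp.eval] using (hI₂.frame hf (by decide)).k
    · refine ⟨⟨by simp [IndexedInstance.rounds], by simp [IndexedInstance.rounds],
        by simp [IndexedInstance.rounds], ?_, ?_, by simp⟩, ht₂⟩
      · intro f hf
        simp [IndexedInstance.rounds, State.setNat, h5 f hf]
      · intro x hx
        simp [IndexedInstance.rounds, State.setNat, h₂ x hx, IndexedInstance.power_empty]
    · rintro i hi τ hf hvi ⟨hc, ht⟩
      refine (Cmd.round_halts hE (hI₂.frame hf (by decide)) hm hc hvi (by omega)).mono le_rfl ?_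
      rintro ρ - ⟨hρ, htρ⟩
      have h0 : τ.tape 0 = σ.tape i := by simp [ht]
      rw [h0, ← P.rounds_succ] at hρ
      refine ⟨⟨hρ.subset, hρ.enum, hρ.card, hρ.used, hρ.power, hρ.label⟩, ?_⟩
      rw [ht] at htρ
      refine htρ.trans (funext fun t => ?_)
      simp only [Nat.add_right_comm, Nat.add_assoc]
  · rintro τ₃ hf₃ ⟨hc, ht⟩
    have hn : ∀ a ∈ [1, 2, 13], τ₃.nat a = σ.nat a := by
      intro a ha
      rw [hf₃.nat a (by revert a; decide), hf₂.nat a (by revert a; decide),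
        hf₁.nat a (by revert a; decide)]
    have h8 : τ₃.real 8 = σ.real 8 := by
      rw [hf₃.real 8 (by decide), hf₂.real 8 (by decide), hf₁.real 8 (by decide)]
    have hs₃ : τ₃.nat 13 0 = 0 ∨ HasSolution P k τ₃ := by
      rw [HasSolution, hn 13 (by decide), h8]
      refine hs.imp id fun h => ⟨h.1, ?_⟩
      obtain ⟨h₁, h₂, h₃⟩ := h.2
      exact ⟨by rw [hn 1 (by decide)]; exact h₁, by rw [hn 1 (by decide)]; exact h₂,
        by rw [hn 1 (by decide), hn 2 (by decide)]; exact h₃⟩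
    refine (Cmd.collect_halts hk hm (hI₂.frame hf₃ (by decide)) hc hs₃).mono le_rfl ?_
    rintro ρ hf ⟨h₁, h₂, h₃⟩
    rw [hn 13 (by decide), h8] at h₃
    exact ⟨h₁, h₂, h₃, by rw [hf.tape (by decide), ht]⟩

/-- The whole algorithm: compute the number of trials, and perform them. -/
def Cmd.service : Cmd :=
  .seq (.seq (.setReal 10 (.const 0) (.powEll (.powEll (.mul (.ofNat (.const 200))
      (.div (.ofNat (.add (.get 0 (.const 2)) (.get 0 (.const 3)))) (.var 0))))))
    (.seq (.setReal 10 (.const 0) (.mul (.mul (.var 10) (.var 10)) (.mul (.var 10) (.var 10))))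
      (.setReal 9 (.const 0) (.ofNat (.const 1))))) <|
  .seq (.forLt 9 (.get 0 (.const 2)) (.setReal 9 (.const 0) (.mul (.var 9) (.var 10)))) <|
  .count 12 (.realLt (.ofNat (.var 12)) (.var 9)) .trial

/-- The number of trials of the algorithm. -/
noncomputable def numTrials (k m : ℕ) (ℓ ε : ℝ) : ℕ :=
  ⌈((((200 * ((k + m) / ε)) ^ ℓ) ^ ℓ) ^ 4) ^ k⌉₊

theorem Cmd.service_halts {σ : State} {ε : ℝ} (hE : Represents E P) (hk : 0 < k)
    (hm : P.m ≤ P.numC) (hkL : k ≤ P.numL) (hI : Input P k σ) (hs : σ.nat 13 0 = 0)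
    (hε : σ.real 0 0 = ε) (hε0 : 0 < ε) :
    Halts E .service σ
      (numTrials k P.m P.ell ε * (trialTime P.numC P.numL k P.m + 14) + k * 20 + 80) fun τ =>
      numTrials k P.m P.ell ε = 0 ∨ HasSolution P k τ ∧ ∀ t < numTrials k P.m P.ell ε,
        IsCheapest P (P.rounds k ∅ fun s => σ.tape (s + t * k)) (τ.real 8 0) := by
  set q : ℝ := (((200 * ((k + P.m) / ε)) ^ P.ell) ^ P.ell) ^ 4 with hq
  set N := numTrials k P.m P.ell ε with hN
  refine Halts.seq (T₁ := 50) (T₂ := N * (trialTime P.numC P.numL k P.m + 14) + k * 20 + 29)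
    (Halts.of_straight rfl σ (by decide) rfl) ?_ (by omega)
  rintro ρ hf₀ hρ
  have hI₀ := hI.frame hf₀ (by decide)
  have e10 : ρ.real 10 0 = q := by
    have hpos : (0 : ℝ) ≤ 200 * ((k + P.m) / ε) := by positivity
    rw [← hρ]
    simp only [Cmd.run, State.setReal, NExp.eval, RExp.eval, hI.k, hI.m, hε, hE.ell]
    simp only [ne_eq, Nat.reduceEqDiff, not_false_eq_true, Function.update_of_ne,
      Function.update_self, Nat.cast_ofNat, Nat.cast_add]
    rw [abs_of_nonneg hpos, abs_of_nonneg (Real.rpow_nonneg hpos _), hq]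
    ring
  have e9 : ρ.real 9 0 = 1 := by
    rw [← hρ]
    simp [Cmd.run, State.setReal, NExp.eval, RExp.eval]
  clear hρ
  refine Halts.seq (T₁ := k * 20 + 10) (T₂ := N * (trialTime P.numC P.numL k P.m + 14) + 11)
    (R := fun τ => τ.real 9 0 = q ^ k) ?_ ?_ (by omega)
  · refine Halts.forLt (n := k) (T := 7) (fun i τ => τ.real 9 0 = q ^ i) (by decide) ?_ ?_ ?_
      (by simp only [NExp.cost]; omega)
    · intro τ hf
      simpa [NExp.eval] using (hI₀.frame hf (by decide)).k
    · simpa [State.setNat] using e9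
    · intro i hi τ hf hvi h
      refine Halts.of_straight rfl τ (by decide) ?_
      have e : τ.real 10 0 = q := by rw [hf.real 10 (by decide), e10]
      simp [Cmd.run, State.setReal, State.setNat, NExp.eval, RExp.eval, h, e, pow_succ]
  intro τ hfτ h9
  have hIτ := hI₀.frame hfτ (by decide)
  have h13 : τ.nat 13 0 = 0 := by rw [hfτ.nat 13 (by decide), hf₀.nat 13 (by decide), hs]
  have htape : τ.tape = σ.tape := by rw [hfτ.tape (by decide), hf₀.tape (by decide)]
  rw [← htape]
  refine (Halts.count (n := N) (T := trialTime P.numC P.numL k P.m) (fun i π =>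
    (π.tape = fun s => τ.tape (s + i * k)) ∧ (i = 0 ∧ π.nat 13 0 = 0 ∨ HasSolution P k π ∧
      ∀ t < i, IsCheapest P (P.rounds k ∅ fun s => τ.tape (s + t * k)) (π.real 8 0)))
    (by decide) ?_ ?_ ?_).mono
    (le_of_eq (by simp only [BExp.cost, RExp.cost, NExp.cost])) ?_
  · intro π hf _
    have : π.real 9 0 = q ^ k := by rw [hf.real 9 (by decide), h9]
    simp only [BExp.holds, RExp.eval, NExp.eval, this]
    -- The loop compares its counter with the real number `q ^ k` itself, so the machine gets the
    -- rounded-up number of trials without any rounding operation.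
    rw [hN, numTrials, Nat.lt_ceil]
  · exact ⟨by simp [State.setNat], Or.inl ⟨rfl, h13⟩⟩
  · rintro i hi π hf hvi ⟨ht, h⟩
    refine (Cmd.trial_halts hE hk hm hkL (hIτ.frame hf (by decide))
      (h.imp And.right And.left)).mono le_rfl ?_
    rintro ξ - ⟨h₁, h₂, h₃, h₄⟩
    refine ⟨?_, Or.inr ⟨⟨h₁.1, h₁.2.lt, h₁.2.inj, h₁.2.cost⟩, ?_⟩⟩
    · refine h₄.trans (funext fun s => ?_)
      rw [ht]
      simp only [add_mul, one_mul, add_assoc, add_comm k]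
    · intro t ht'
      rcases Nat.lt_succ_iff_lt_or_eq.1 ht' with hlt | rfl
      · rcases h with h | ⟨hsol, h⟩
        · omega
        -- Later trials only lower the saved cost, so the bounds from earlier trials persist.
        · have hle := h₃.resolve_left (by rw [hsol.1]; exact one_ne_zero)
          exact fun M hM hc => hle.trans (h t hlt M hM hc)
      · rw [ht] at h₂
        exact h₂
  · rintro π - ⟨-, h⟩
    exact h.imp And.left id

end RealRAM

/-! ### Points near the mean radius of a cluster -/

section Cluster

variable {X : Type*} [MetricSpace X] {ℓ : ℝ}

/-- The `ℓ`-th power mean of the distances between the points of `A` and `c`. -/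
noncomputable def meanRadius (a : ℕ → X) (ℓ : ℝ) (A : Finset ℕ) (c : X) : ℝ :=
  ((∑ x ∈ A, dist (a x) c ^ ℓ) / A.card) ^ (1 / ℓ)

theorem meanRadius_nonneg (a : ℕ → X) (ℓ : ℝ) (A : Finset ℕ) (c : X) :
    0 ≤ meanRadius a ℓ A c := by
  unfold meanRadius
  positivity

theorem card_mul_meanRadius_rpow (hℓ : 1 ≤ ℓ) (a : ℕ → X) (A : Finset ℕ) (c : X) :
    A.card * meanRadius a ℓ A c ^ ℓ = ∑ x ∈ A, dist (a x) c ^ ℓ := by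
  rw [meanRadius, ← Real.rpow_mul (by positivity), one_div_mul_cancel (by linarith),
    Real.rpow_one]
  rcases A.eq_empty_or_nonempty with rfl | hA
  · simp
  · have : (A.card : ℝ) ≠ 0 := by exact_mod_cast hA.card_ne_zero
    field_simp

/-- Minkowski's inequality applied to the distances to `c` and the constant `s * meanRadius`. The
mean radius is defined so that this constant has exactly `s` times the `ℓ`-norm of the distances,
which gives the factor `(1 + s) ^ ℓ` with no further loss. -/
theorem sum_dist_rpow_le_of_dist_le (hℓ : 1 ≤ ℓ) {a : ℕ → X} {A : Finset ℕ} {b c : X} {s : ℝ}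
    (hs : 0 ≤ s) (h : dist b c ≤ s * meanRadius a ℓ A c) :
    ∑ x ∈ A, dist (a x) b ^ ℓ ≤ (1 + s) ^ ℓ * ∑ x ∈ A, dist (a x) c ^ ℓ := by
  have hℓ0 : 0 < ℓ := by linarith
  have hr := meanRadius_nonneg a ℓ A c
  have h1 : ∑ x ∈ A, dist (a x) b ^ ℓ
      ≤ ∑ x ∈ A, (dist (a x) c + s * meanRadius a ℓ A c) ^ ℓ := by
    refine Finset.sum_le_sum fun x _ => Real.rpow_le_rpow dist_nonneg ?_ hℓ0.le
    have := dist_triangle_right (a x) b c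
    linarith
  have h2 := Real.Lp_add_le_of_nonneg (s := A) (f := fun x => dist (a x) c)
    (g := fun _ => s * meanRadius a ℓ A c) hℓ (fun _ _ => dist_nonneg)
    (fun _ _ => mul_nonneg hs hr)
  have h3 : ∑ x ∈ A, (s * meanRadius a ℓ A c) ^ ℓ = s ^ ℓ * ∑ x ∈ A, dist (a x) c ^ ℓ := by
    rw [Finset.sum_const, nsmul_eq_mul, Real.mul_rpow hs hr, ← card_mul_meanRadius_rpow hℓ]
    ring
  have hS : 0 ≤ ∑ x ∈ A, dist (a x) c ^ ℓ := by positivity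
  rw [h3, Real.mul_rpow (by positivity) hS, ← Real.rpow_mul hs, mul_one_div_cancel hℓ0.ne',
    Real.rpow_one, ← one_add_mul] at h2
  have h4 := Real.rpow_le_rpow (by positivity) h2 hℓ0.le
  rw [← Real.rpow_mul (by positivity), one_div_mul_cancel hℓ0.ne', Real.rpow_one,
    Real.mul_rpow (by positivity) (by positivity), ← Real.rpow_mul hS,
    one_div_mul_cancel hℓ0.ne', Real.rpow_one] at h4
  exact h1.trans h4

/-- Markov's inequality: at most a fraction `1 / (1 + δ) ^ ℓ`, hence at most `1 / (1 + δ)`, of the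
points lies beyond `1 + δ` mean radii. -/
theorem card_near_ge (hℓ : 1 ≤ ℓ) {δ : ℝ} (hδ : 0 < δ) (a : ℕ → X) (A : Finset ℕ) (c : X) :
    δ / (1 + δ) * A.card
      ≤ {x ∈ A | dist (a x) c ≤ (1 + δ) * meanRadius a ℓ A c}.card := by
  have hℓ0 : 0 < ℓ := by linarith
  set r := meanRadius a ℓ A c with hr
  have hr0 : 0 ≤ r := meanRadius_nonneg a ℓ A c
  have hcard : ({x ∈ A | dist (a x) c ≤ (1 + δ) * r}.card : ℝ)
      + {x ∈ A | ¬ dist (a x) c ≤ (1 + δ) * r}.card = A.card := by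
    exact_mod_cast Finset.card_filter_add_card_filter_not (s := A)
      (fun x => dist (a x) c ≤ (1 + δ) * r)
  have hbad : (1 + δ) * {x ∈ A | ¬ dist (a x) c ≤ (1 + δ) * r}.card ≤ A.card := by
    have hsum : ({x ∈ A | ¬ dist (a x) c ≤ (1 + δ) * r}.card : ℝ) * ((1 + δ) * r) ^ ℓ
        ≤ A.card * r ^ ℓ := by
      rw [hr, card_mul_meanRadius_rpow hℓ, ← hr, ← nsmul_eq_mul, ← Finset.sum_const]
      refine (Finset.sum_le_sum fun x hx => ?_).trans
        (Finset.sum_le_sum_of_subset_of_nonneg (Finset.filter_subset _ A)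
          fun x _ _ => Real.rpow_nonneg dist_nonneg ℓ)
      have := (Finset.mem_filter.1 hx).2
      exact Real.rpow_le_rpow (by positivity) (not_le.1 this).le hℓ0.le
    -- Radius zero is separate because `r ^ ℓ` cannot be cancelled; then all points of the cluster
    -- coincide with `c`.
    rcases hr0.eq_or_lt with h0 | h0
    · have hz : ∀ x ∈ A, dist (a x) c ^ ℓ = 0 := by
        have := card_mul_meanRadius_rpow hℓ a A c
        rw [← hr, ← h0, Real.zero_rpow hℓ0.ne', mul_zero] at this
        exact (Finset.sum_eq_zero_iff_of_nonneg fun x _ => Real.rpow_nonneg dist_nonneg ℓ).1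
          this.symm
      have : {x ∈ A | ¬ dist (a x) c ≤ (1 + δ) * r} = ∅ := by
        refine Finset.filter_eq_empty_iff.2 fun x hx => not_not.2 ?_
        rw [(Real.rpow_eq_zero dist_nonneg hℓ0.ne').1 (hz x hx)]
        positivity
      rw [this]
      simp
    · rw [Real.mul_rpow (by positivity) hr0, ← mul_assoc] at hsum
      have h1 := le_of_mul_le_mul_right hsum (Real.rpow_pos_of_pos h0 ℓ)
      have h2 : 1 + δ ≤ (1 + δ) ^ ℓ := Real.self_le_rpow_of_one_le (by linarith) hℓ
      calc (1 + δ) * ({x ∈ A | ¬ dist (a x) c ≤ (1 + δ) * r}.card : ℝ)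
          ≤ (1 + δ) ^ ℓ * {x ∈ A | ¬ dist (a x) c ≤ (1 + δ) * r}.card := by gcongr
        _ ≤ A.card := by linarith
  rw [div_mul_eq_mul_div, div_le_iff₀ (by positivity)]
  nlinarith

end Cluster

/-! ### The sampling weight of a cluster without a nearby location -/

namespace IndexedInstance

variable {X : Type*} [MetricSpace X] (P : IndexedInstance X)

/-- No location of `F` is close to the center `c` of the cluster `A`. -/
def Uncovered (F A : Finset ℕ) (c : X) (δ : ℝ) : Prop :=
  ∀ f ∈ F, (1 + 2 * δ) * meanRadius P.client P.ell A c < dist (P.loc f) c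

variable {P}

/-- A location `f` at distance more than `(1 + 2 * δ) * r` from `c` is at distance at least `dist c
f - (1 + δ) * r` from `x`, and this is at least `δ / (1 + 2 * δ) * dist c f`. For `F` empty both
powers are `1`. -/
theorem power_near_ge (hℓ : 1 ≤ P.ell) {F A : Finset ℕ} {c : X} {δ : ℝ} (hδ : 0 < δ)
    (hu : P.Uncovered F A c δ) {x : ℕ}
    (hx : dist (P.client x) c ≤ (1 + δ) * meanRadius P.client P.ell A c) :
    (δ / (1 + 2 * δ)) ^ P.ell * P.power F c ≤ P.power F (P.client x) := by
  have hℓ0 : 0 < P.ell := by linarith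
  have hκ : 0 ≤ δ / (1 + 2 * δ) := by positivity
  rcases F.eq_empty_or_nonempty with rfl | hF
  · rw [power_empty, power_empty, mul_one]
    exact Real.rpow_le_one hκ ((div_le_one (by positivity)).2 (by linarith)) hℓ0.le
  · obtain ⟨f, hf, he⟩ := P.exists_power_eq hF (P.client x)
    rw [he]
    refine (mul_le_mul_of_nonneg_left (P.power_le hf c) (by positivity)).trans ?_
    rw [← Real.mul_rpow hκ dist_nonneg]
    refine Real.rpow_le_rpow (by positivity) ?_ hℓ0.le
    have h1 := hu f hf
    have h2 := dist_triangle_left c (P.loc f) (P.client x)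
    rw [dist_comm (P.loc f)] at h1
    rw [div_mul_eq_mul_div, div_le_iff₀ (by positivity)]
    have h3 : (1 + δ) * ((1 + 2 * δ) * meanRadius P.client P.ell A c)
        ≤ (1 + δ) * dist c (P.loc f) := by gcongr
    have h4 : (1 + 2 * δ) * dist c (P.loc f)
        ≤ (1 + 2 * δ) * ((1 + δ) * meanRadius P.client P.ell A c
          + dist (P.client x) (P.loc f)) := by
      gcongr
      linarith
    nlinarith

/-- Take `f` nearest to `c`. Then `dist x f` is at most twice the larger of `dist x c` and `dist c
f`, so the powers sum to at most `2 ^ ℓ` times the cluster cost plus `card` times the power of `c`.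
Being uncovered forces `r ≤ dist c f`, so the first summand is no larger than the second. -/
theorem sum_min_power_le (hℓ : 1 ≤ P.ell) {F A : Finset ℕ} {c : X} {δ T : ℝ} (hδ : 0 < δ)
    (hT : 0 ≤ T) (hu : P.Uncovered F A c δ) :
    ∑ x ∈ A, min (P.power F (P.client x)) T ≤ 2 ^ (P.ell + 1) * (A.card * min (P.power F c) T) := by
  have hℓ0 : 0 < P.ell := by linarith
  have hmin : 0 ≤ min (P.power F c) T := le_min (P.power_nonneg _ _) hT
  have h2 : (1 : ℝ) ≤ 2 ^ (P.ell + 1) := Real.one_le_rpow (by norm_num) (by linarith)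
  have hTsum : ∑ x ∈ A, min (P.power F (P.client x)) T ≤ A.card * T := by
    rw [← nsmul_eq_mul, ← Finset.sum_const]
    exact Finset.sum_le_sum fun x _ => min_le_right _ _
  rcases F.eq_empty_or_nonempty with rfl | hF
  · simp only [power_empty, Finset.sum_const, nsmul_eq_mul] at hmin ⊢
    exact le_mul_of_one_le_left (by positivity) h2
  · rw [mul_min_of_nonneg _ _ (Nat.cast_nonneg _), mul_min_of_nonneg _ _ (by positivity)]
    refine le_min ?_ (hTsum.trans (le_mul_of_one_le_left (by positivity) h2))
    obtain ⟨f, hf, he⟩ := P.exists_power_eq hF c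
    have hr := meanRadius_nonneg P.client P.ell A c
    have hrf : meanRadius P.client P.ell A c ≤ dist c (P.loc f) := by
      have := hu f hf
      rw [dist_comm] at this
      nlinarith
    have hpt : ∀ x ∈ A, min (P.power F (P.client x)) T
        ≤ 2 ^ P.ell * (dist (P.client x) c ^ P.ell + dist c (P.loc f) ^ P.ell) := by
      intro x _
      refine (min_le_left _ _).trans ((P.power_le hf _).trans ?_)
      have h3 : dist (P.client x) (P.loc f)
          ≤ 2 * max (dist (P.client x) c) (dist c (P.loc f)) := by
        have := dist_triangle (P.client x) c (P.loc f)
        have := le_max_left (dist (P.client x) c) (dist c (P.loc f))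
        have := le_max_right (dist (P.client x) c) (dist c (P.loc f))
        linarith
      refine (Real.rpow_le_rpow dist_nonneg h3 hℓ0.le).trans ?_
      rw [Real.mul_rpow (by norm_num) (le_max_of_le_left dist_nonneg)]
      gcongr
      rcases max_cases (dist (P.client x) c) (dist c (P.loc f)) with ⟨h, _⟩ | ⟨h, _⟩ <;> rw [h]
      · exact le_add_of_nonneg_right (by positivity)
      · exact le_add_of_nonneg_left (by positivity)
    refine (Finset.sum_le_sum hpt).trans ?_
    rw [← Finset.mul_sum, Finset.sum_add_distrib, ← card_mul_meanRadius_rpow hℓ, Finset.sum_const,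
      nsmul_eq_mul, he, Real.rpow_add_one (by norm_num), mul_assoc]
    have : meanRadius P.client P.ell A c ^ P.ell ≤ dist c (P.loc f) ^ P.ell :=
      Real.rpow_le_rpow hr hrf hℓ0.le
    have : A.card * meanRadius P.client P.ell A c ^ P.ell
        ≤ A.card * dist c (P.loc f) ^ P.ell := by gcongr
    gcongr
    linarith

/-- The guaranteed share of the points near the center in the weight of an uncovered cluster. -/
noncomputable def nearShare (ℓ δ : ℝ) : ℝ :=
  δ / (1 + δ) * (δ / (1 + 2 * δ)) ^ ℓ / 2 ^ (ℓ + 1)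

theorem nearShare_pos {ℓ δ : ℝ} (hδ : 0 < δ) : 0 < nearShare ℓ δ := by
  unfold nearShare
  positivity

/-- Both sides are compared with `A.card * min (power of c) T`: the whole cluster weighs at most `2
^ (ℓ + 1)` times that, while the near points are a fraction `δ / (1 + δ)` of the cluster and each of
them has nearly the weight of `c`. -/
theorem nearShare_mul_sum_le (hℓ : 1 ≤ P.ell) {F A : Finset ℕ} {c : X} {δ T : ℝ} (hδ : 0 < δ)
    (hT : 0 ≤ T) (hu : P.Uncovered F A c δ) :
    nearShare P.ell δ * ∑ x ∈ A, min (P.power F (P.client x)) T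
      ≤ ∑ x ∈ A with dist (P.client x) c ≤ (1 + δ) * meanRadius P.client P.ell A c,
          min (P.power F (P.client x)) T := by
  have hℓ0 : 0 < P.ell := by linarith
  have hmin : 0 ≤ min (P.power F c) T := le_min (P.power_nonneg _ _) hT
  have hκ1 : (δ / (1 + 2 * δ)) ^ P.ell ≤ 1 :=
    Real.rpow_le_one (by positivity) ((div_le_one (by positivity)).2 (by linarith)) hℓ0.le
  have hκ0 : 0 ≤ (δ / (1 + 2 * δ)) ^ P.ell := by positivity
  calc nearShare P.ell δ * ∑ x ∈ A, min (P.power F (P.client x)) T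
      ≤ nearShare P.ell δ * (2 ^ (P.ell + 1) * (A.card * min (P.power F c) T)) := by
        gcongr
        · exact (nearShare_pos hδ).le
        · exact sum_min_power_le hℓ hδ hT hu
    _ = (δ / (1 + δ) * A.card) * ((δ / (1 + 2 * δ)) ^ P.ell * min (P.power F c) T) := by
        rw [nearShare]
        field_simp
    _ ≤ {x ∈ A | dist (P.client x) c ≤ (1 + δ) * meanRadius P.client P.ell A c}.card
          * ((δ / (1 + 2 * δ)) ^ P.ell * min (P.power F c) T) := by
        gcongr
        exact card_near_ge hℓ hδ P.client A c
    _ ≤ _ := by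
        rw [← nsmul_eq_mul, ← Finset.sum_const]
        refine Finset.sum_le_sum fun x hx => le_min ?_ ?_
        · exact (mul_le_mul_of_nonneg_left (min_le_left _ _) hκ0).trans
            (power_near_ge hℓ hδ hu (Finset.mem_filter.1 hx).2)
        · exact (mul_le_of_le_one_left hmin hκ1).trans (min_le_right _ _)

end IndexedInstance

/-! ### Outliers, covered clusters and the progress of one round -/

/-- Truncation at the threshold bounds the total by the sum over any set that misses only `m`
indices. -/
theorem IsThreshold.sum_min_le {D : ℕ → ℝ} {n m : ℕ} {T : ℝ} (h : IsThreshold D n m T)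
    (hD : ∀ x < n, 0 ≤ D x) (hm : m < n) {B : Finset ℕ} (hB : B ⊆ Finset.range n)
    (hc : B.card + m = n) :
    0 ≤ T ∧ (∃ M ⊆ Finset.range n, M.card = m ∧
        ∑ x ∈ Finset.range n \ M, D x ≤ ∑ x ∈ B, min (D x) T) ∧
      ∑ x ∈ Finset.range n, min (D x) T ≤ (m + 1) * ∑ x ∈ B, min (D x) T := by
  have hcard : m < {x ∈ Finset.range n | T ≤ D x}.card :=
    h.2.resolve_left fun h => absurd h.2 (not_le.2 hm)
  have hN : Finset.range n \ (Finset.range n \ B) = B := Finset.sdiff_sdiff_eq_self hB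
  have hNc : (Finset.range n \ B).card = m := by
    rw [Finset.card_sdiff_of_subset hB, Finset.card_range]
    omega
  -- A negative threshold would be exceeded by all `n > m` values.
  have hT : 0 ≤ T := by
    by_contra! hneg
    have : {x ∈ Finset.range n | T < D x} = Finset.range n :=
      Finset.filter_true_of_mem fun x hx => hneg.trans_le (hD x (Finset.mem_range.1 hx))
    have h1 := h.1
    rw [this, Finset.card_range] at h1
    omega
  have hmin : ∀ x < n, 0 ≤ min (D x) T := fun x hx => le_min (hD x hx) hT
  refine ⟨hT, ?_, ?_⟩
  -- An `m`-set between the values above `T` and the values at least `T` is separated at `T`, so it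
  -- can be exchanged for the complement of `B` against truncated values.
  · obtain ⟨M, hM₁, hM₂, hMc⟩ := Finset.exists_subsuperset_card_eq
      (Finset.monotone_filter_right (Finset.range n)
        fun x _ (hx : T < D x) => (hx.le : T ≤ D x)) h.1 hcard.le
    have hMs : M ⊆ Finset.range n := hM₂.trans (Finset.filter_subset _ _)
    refine ⟨M, hMs, hMc, ?_⟩
    have := sum_sdiff_le_sum_min (D := D) (t := T) hMs (Finset.sdiff_subset (t := B))
      (hMc.trans hNc.symm) (fun x hx => (Finset.mem_filter.1 (hM₂ hx)).2) ?_
    · rwa [hN] at this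
    · intro y hy
      obtain ⟨hy₁, hy₂⟩ := Finset.mem_sdiff.1 hy
      by_contra! hlt
      exact hy₂ (hM₁ (Finset.mem_filter.2 ⟨hy₁, hlt⟩))
  -- More than `m` values are at least `T`, but only `m` indices are missing from `B`, so `B` alone
  -- already weighs `T`. Each missing index weighs at most `T`, which yields the factor `m + 1`.
  · obtain ⟨z, hz, hzB⟩ := Finset.exists_mem_notMem_of_card_lt_card (hNc.trans_lt hcard)
    simp only [Finset.mem_filter] at hz
    have hzB : z ∈ B := by
      by_contra hzB'
      exact hzB (Finset.mem_sdiff.2 ⟨hz.1, hzB'⟩)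
    have h1 : T ≤ ∑ x ∈ B, min (D x) T := by
      calc T = min (D z) T := (min_eq_right hz.2).symm
        _ ≤ _ := Finset.single_le_sum (f := fun x => min (D x) T)
          (fun x hx => hmin x (Finset.mem_range.1 (hB hx))) hzB
    have h2 : ∑ x ∈ Finset.range n \ B, min (D x) T ≤ m * T := by
      rw [← hNc, ← nsmul_eq_mul, ← Finset.sum_const]
      exact Finset.sum_le_sum fun x _ => min_le_right _ _
    have h3 := Finset.sum_sdiff (f := fun x => min (D x) T) hB
    have h4 : (m : ℝ) * T ≤ m * ∑ x ∈ B, min (D x) T := by gcongr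
    linarith

namespace IndexedInstance

variable {X : Type*} [MetricSpace X] {P : IndexedInstance X} {k : ℕ}

theorem threshold_spec (hm : P.m ≤ P.numC) (F : Finset ℕ) :
    IsThreshold (fun x => P.power F (P.client x)) P.numC P.m (P.threshold F) := by
  have hD : ∀ x < P.numC, 0 ≤ P.power F (P.client x) := fun x _ => P.power_nonneg _ _
  obtain ⟨M, hM⟩ := exists_isTopSet hD hm
  have := hM.isThreshold hD
  rwa [P.threshold_eq this]

/-- After the removal of some `m` clients, the others are served by `F` at cost at most `v`. -/
def ServesWithin (P : IndexedInstance X) (F : Finset ℕ) (v : ℝ) : Prop :=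
  ∃ N ⊆ Finset.range P.numC, N.card = P.m ∧
    ∑ x ∈ Finset.range P.numC \ N, P.power F (P.client x) ≤ v

theorem ServesWithin.mono {F G : Finset ℕ} {v : ℝ} (h : P.ServesWithin F v) (hF : F.Nonempty)
    (hFG : F ⊆ G) : P.ServesWithin G v := by
  obtain ⟨N, hN, hc, hs⟩ := h
  exact ⟨N, hN, hc, (Finset.sum_le_sum fun x _ => P.power_anti hF hFG _).trans hs⟩

/-- Disjoint clusters of all clients but `m`, and a center for each of them. -/
structure Clustering (P : IndexedInstance X) (k : ℕ) where
  cluster : Fin k → Finset ℕ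
  center : Fin k → ℕ
  subset : ∀ j, cluster j ⊆ Finset.range P.numC
  disjoint : Pairwise fun i j => Disjoint (cluster i) (cluster j)
  card : (Finset.univ.biUnion cluster).card + P.m = P.numC
  center_lt : ∀ j, center j < P.numL

namespace Clustering

variable (S : Clustering P k)

/-- The location of a center. -/
def point (j : Fin k) : X := P.loc (S.center j)

/-- The cost of a single cluster. -/
noncomputable def clusterCost (j : Fin k) : ℝ :=
  ∑ x ∈ S.cluster j, dist (P.client x) (S.point j) ^ P.ell

/-- The cost of a clustering with given centers. -/
noncomputable def cost : ℝ := ∑ j, S.clusterCost j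

theorem clusterCost_nonneg (j : Fin k) : 0 ≤ S.clusterCost j :=
  Finset.sum_nonneg fun _ _ => Real.rpow_nonneg dist_nonneg _

theorem cost_nonneg : 0 ≤ S.cost := Finset.sum_nonneg fun j _ => S.clusterCost_nonneg j

/-- The mean radius of a cluster. -/
noncomputable def radius (j : Fin k) : ℝ :=
  meanRadius P.client P.ell (S.cluster j) (S.point j)

open Classical in
/-- The clusters whose center is close to `F`, in relation to their radius. -/
noncomputable def covered (s : ℝ) (F : Finset ℕ) : Finset (Fin k) :=
  {j | ∃ f ∈ F, dist (P.loc f) (S.point j) ≤ s * S.radius j}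

theorem mem_covered {s : ℝ} {F : Finset ℕ} {j : Fin k} :
    j ∈ S.covered s F ↔ ∃ f ∈ F, dist (P.loc f) (S.point j) ≤ s * S.radius j := by
  simp [covered]

theorem covered_mono {s : ℝ} {F G : Finset ℕ} (h : F ⊆ G) : S.covered s F ⊆ S.covered s G := by
  intro j hj
  rw [mem_covered] at hj ⊢
  obtain ⟨f, hf, hd⟩ := hj
  exact ⟨f, h hf, hd⟩

theorem sum_power_covered_le (hℓ : 1 ≤ P.ell) {s : ℝ} (hs : 0 ≤ s) {F : Finset ℕ} {j : Fin k}
    (hj : j ∈ S.covered s F) :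
    ∑ x ∈ S.cluster j, P.power F (P.client x) ≤ (1 + s) ^ P.ell * S.clusterCost j := by
  obtain ⟨f, hf, hd⟩ := S.mem_covered.1 hj
  exact (Finset.sum_le_sum fun x _ => P.power_le hf _).trans
    (sum_dist_rpow_le_of_dist_le hℓ hs hd)

omit [MetricSpace X] in
theorem biUnion_subset : Finset.univ.biUnion S.cluster ⊆ Finset.range P.numC :=
  Finset.biUnion_subset.2 fun j _ => S.subset j

omit [MetricSpace X] in
theorem sum_biUnion (J : Finset (Fin k)) (f : ℕ → ℝ) :
    ∑ x ∈ J.biUnion S.cluster, f x = ∑ j ∈ J, ∑ x ∈ S.cluster j, f x :=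
  Finset.sum_biUnion fun _ _ _ _ hij => S.disjoint hij

theorem servesWithin_of_covered (hℓ : 1 ≤ P.ell) {s : ℝ} (hs : 0 ≤ s) {F : Finset ℕ}
    (h : ∀ j, j ∈ S.covered s F) : P.ServesWithin F ((1 + s) ^ P.ell * S.cost) := by
  refine ⟨Finset.range P.numC \ Finset.univ.biUnion S.cluster, Finset.sdiff_subset, ?_, ?_⟩
  · rw [Finset.card_sdiff_of_subset S.biUnion_subset, Finset.card_range]
    have := S.card
    omega
  · rw [Finset.sdiff_sdiff_eq_self S.biUnion_subset, S.sum_biUnion, cost, Finset.mul_sum]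
    exact Finset.sum_le_sum fun j _ => S.sum_power_covered_le hℓ hs (h j)

open Classical in
/-- The clients near the centers of the clusters that are not covered by `F`. -/
noncomputable def useful (s δ : ℝ) (F : Finset ℕ) : Finset ℕ :=
  (S.covered s F)ᶜ.biUnion fun j =>
    {x ∈ S.cluster j | dist (P.client x) (S.point j) ≤ (1 + δ) * S.radius j}

theorem mem_useful {s δ : ℝ} {F : Finset ℕ} {x : ℕ} :
    x ∈ S.useful s δ F ↔ ∃ j ∉ S.covered s F, x ∈ S.cluster j ∧
      dist (P.client x) (S.point j) ≤ (1 + δ) * S.radius j := by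
  simp [useful]

/-- A lower bound for the probability that a round succeeds. -/
noncomputable def roundProb (ℓ s δ ε : ℝ) (m : ℕ) : ℝ :=
  nearShare ℓ δ / ((m + 1) * (1 + 2 * (1 + s) ^ ℓ / ε))

theorem roundProb_pos {ℓ s δ ε : ℝ} {m : ℕ} (hs : 0 ≤ s) (hδ : 0 < δ) (hε : 0 < ε) :
    0 < roundProb ℓ s δ ε m := by
  have := nearShare_pos (ℓ := ℓ) hδ
  unfold roundProb
  positivity

/-- Either `F` is good already, or the useful clients have a substantial share of the weight. -/
theorem servesWithin_or_weight_useful (hℓ : 1 ≤ P.ell) (hm : P.m < P.numC) {s δ ε : ℝ}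
    (hδ : 0 < δ) (hε : 0 < ε) (hs : 1 + 2 * δ ≤ s) (F : Finset ℕ) :
    F.Nonempty ∧ P.ServesWithin F (((1 + s) ^ P.ell + ε / 2) * S.cost) ∨
      0 < ∑ x ∈ Finset.range P.numC, P.weight F x ∧
        roundProb P.ell s δ ε P.m * ∑ x ∈ Finset.range P.numC, P.weight F x
          ≤ ∑ x ∈ S.useful s δ F, P.weight F x := by
  have hs0 : 0 ≤ s := by linarith
  have hD : ∀ x < P.numC, 0 ≤ P.power F (P.client x) := fun x _ => P.power_nonneg _ _
  have hthr := threshold_spec hm.le F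
  obtain ⟨hT, ⟨M, hMs, hMc, hM⟩, hW⟩ := hthr.sum_min_le hD hm S.biUnion_subset S.card
  change ∑ x ∈ Finset.range P.numC, P.weight F x ≤ _ at hW
  change _ ≤ ∑ x ∈ Finset.univ.biUnion S.cluster, P.weight F x at hM
  change _ ≤ _ * ∑ x ∈ Finset.univ.biUnion S.cluster, P.weight F x at hW
  have hw : ∀ x, 0 ≤ P.weight F x := fun x => le_min (P.power_nonneg _ _) hT
  set Γ := (1 + s) ^ P.ell with hΓ
  have hΓ0 : 0 ≤ Γ := by positivity
  set U := ∑ j ∈ (S.covered s F)ᶜ, ∑ x ∈ S.cluster j, P.weight F x with hU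
  have hU0 : 0 ≤ U := Finset.sum_nonneg fun j _ => Finset.sum_nonneg fun x _ => hw x
  set V := ∑ j ∈ S.covered s F, ∑ x ∈ S.cluster j, P.weight F x with hV
  have hsplit : ∑ x ∈ Finset.univ.biUnion S.cluster, P.weight F x = U + V := by
    rw [S.sum_biUnion, hU, hV, Finset.sum_compl_add_sum]
  have hVle : V ≤ Γ * S.cost := by
    calc V ≤ ∑ j ∈ S.covered s F, Γ * S.clusterCost j :=
          Finset.sum_le_sum fun j hj => (Finset.sum_le_sum fun x _ => min_le_left _ _).trans
            (S.sum_power_covered_le hℓ hs0 hj)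
      _ ≤ ∑ j, Γ * S.clusterCost j :=
          Finset.sum_le_sum_of_subset_of_nonneg (Finset.subset_univ _)
            fun j _ _ => mul_nonneg hΓ0 (S.clusterCost_nonneg j)
      _ = Γ * S.cost := by rw [cost, Finset.mul_sum]
  have huse : nearShare P.ell δ * U ≤ ∑ x ∈ S.useful s δ F, P.weight F x := by
    rw [useful, Finset.sum_biUnion, hU, Finset.mul_sum]
    · refine Finset.sum_le_sum fun j hj => nearShare_mul_sum_le hℓ hδ hT fun f hf => ?_
      by_contra! hle
      refine Finset.mem_compl.1 hj (S.mem_covered.2 ⟨f, hf, hle.trans ?_⟩)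
      exact mul_le_mul_of_nonneg_right hs (meanRadius_nonneg _ _ _ _)
    · exact fun i _ j _ hij => (S.disjoint hij).mono (Finset.filter_subset _ _)
        (Finset.filter_subset _ _)
  rw [hsplit] at hM hW
  -- It suffices that the uncovered weight `U` dominates the covered weight `V` up to the factor `2
  -- * Γ / ε`: then `U` has a fixed share of the inliers and, up to `m + 1`, of everything.
  have hfinal : V ≤ 2 * Γ / ε * U →
      roundProb P.ell s δ ε P.m * ∑ x ∈ Finset.range P.numC, P.weight F x
        ≤ ∑ x ∈ S.useful s δ F, P.weight F x := by
    intro h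
    refine le_trans ?_ huse
    have h1 : ∑ x ∈ Finset.range P.numC, P.weight F x
        ≤ (P.m + 1) * (1 + 2 * Γ / ε) * U := by
      refine hW.trans ?_
      rw [mul_assoc]
      gcongr
      linarith
    calc roundProb P.ell s δ ε P.m * ∑ x ∈ Finset.range P.numC, P.weight F x
        ≤ roundProb P.ell s δ ε P.m * ((P.m + 1) * (1 + 2 * Γ / ε) * U) := by
          gcongr
          exact (roundProb_pos hs0 hδ hε).le
      _ = nearShare P.ell δ * U := by
          rw [roundProb, ← hΓ]
          field_simp
  -- In the first round all powers are `1` and the sampling is uniform. Nothing is covered, so `V =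
  -- 0`.
  rcases F.eq_empty_or_nonempty with rfl | hF
  · right
    have hT1 : 1 ≤ P.threshold ∅ := by
      by_contra! hlt
      have h1 := hthr.1
      simp only [power_empty] at h1
      rw [Finset.filter_true_of_mem fun _ _ => hlt, Finset.card_range] at h1
      omega
    refine ⟨?_, hfinal ?_⟩
    · refine Finset.sum_pos (fun x _ => ?_) ⟨0, Finset.mem_range.2 (by omega)⟩
      rw [weight, power_empty, min_eq_left hT1]
      exact one_pos
    · have : V = 0 := by
        rw [hV]
        refine Finset.sum_eq_zero fun j hj => ?_
        simp [mem_covered] at hj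
      rw [this]
      positivity
  -- If `U` is small, the true cost of `F` without its outliers is at most `U + V`, hence at most
  -- `(Γ + ε / 2) * cost`. Otherwise `U` dominates, since `V` is at most `Γ * cost`.
  · by_cases hle : U ≤ ε / 2 * S.cost
    · left
      exact ⟨hF, M, hMs, hMc, by linarith⟩
    · right
      push Not at hle
      have hc := S.cost_nonneg
      refine ⟨?_, hfinal ?_⟩
      · have h1 : U + V ≤ ∑ x ∈ Finset.range P.numC, P.weight F x := by
          rw [← hsplit]
          exact Finset.sum_le_sum_of_subset_of_nonneg S.biUnion_subset fun x _ _ => hw x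
        have h2 : 0 ≤ V := Finset.sum_nonneg fun j _ => Finset.sum_nonneg fun x _ => hw x
        have h3 : 0 ≤ ε / 2 * S.cost := by positivity
        linarith
      · calc V ≤ Γ * S.cost := hVle
          _ = 2 * Γ / ε * (ε / 2 * S.cost) := by field_simp
          _ ≤ 2 * Γ / ε * U := by gcongr

/-- The nearest unused location of a client is at most `β` times as far from an unused location as
the client, provided that the client is not at a used location. -/
def Reaches (P : IndexedInstance X) (β : ℝ) : Prop :=
  ∀ (F : Finset ℕ) (x b f : ℕ), x < P.numC →
    (∀ g < P.numL, g ∉ F → dist (P.client x) (P.loc b) ≤ dist (P.client x) (P.loc g)) →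
    f < P.numL → f ∉ F → (∀ g ∈ F, P.client x ≠ P.loc g) →
    dist (P.loc b) (P.loc f) ≤ β * dist (P.client x) (P.loc f)

/-- The location `f` is itself a candidate, so `x` is no farther from `b` than from `f`; the
triangle inequality through `x` does the rest. -/
theorem reaches_two (P : IndexedInstance X) : Reaches P 2 := by
  intro F x b f _ hb hf hfF _
  have := dist_triangle_left (P.loc b) (P.loc f) (P.client x)
  linarith [hb f hf hfF]

/-- The client is at an unused location, so the nearest unused one is at distance zero and can
replace the client. -/
theorem reaches_one (h : ∀ x < P.numC, ∃ g < P.numL, P.loc g = P.client x) : Reaches P 1 := by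
  intro F x b f hx hb hf hfF hne
  obtain ⟨g, hg, hgx⟩ := h x hx
  have := hb g hg fun hgF => hne g hgF hgx.symm
  rw [hgx, dist_self] at this
  rw [dist_le_zero.1 this, one_mul]

/-- Locations in `F` are farther than `s * r` from the center of an uncovered cluster. So this
center is still unused, and a near client is not at a used location; both are needed for `Reaches`.
The new location then lies within `β * (1 + δ) * r` of the center and covers the cluster. -/
theorem covered_next {β δ : ℝ} (hβ : 1 ≤ β) (hδ : 0 < δ) (hR : Reaches P β) {F : Finset ℕ} {x : ℕ}
    (hF : ∃ f < P.numL, f ∉ F) (hx : x ∈ S.useful (β * (1 + 2 * δ)) δ F) :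
    (S.covered (β * (1 + 2 * δ)) F).card
      < (S.covered (β * (1 + 2 * δ)) (insert (P.nearest F x) F)).card := by
  obtain ⟨j, hj, hxj, hd⟩ := S.mem_useful.1 hx
  refine Finset.card_lt_card (Finset.ssubset_iff_of_subset
    (S.covered_mono (Finset.subset_insert _ _)) |>.2 ⟨j, ?_, hj⟩)
  have hr : 0 ≤ S.radius j := meanRadius_nonneg _ _ _ _
  have hfar : ∀ f ∈ F, β * (1 + 2 * δ) * S.radius j < dist (P.loc f) (S.point j) := by
    intro f hf
    by_contra! h
    exact hj (S.mem_covered.2 ⟨f, hf, h⟩)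
  have hβδ : (1 + δ) * S.radius j ≤ β * (1 + 2 * δ) * S.radius j := by
    refine mul_le_mul_of_nonneg_right ?_ hr
    nlinarith
  refine S.mem_covered.2 ⟨_, Finset.mem_insert_self _ _, ?_⟩
  refine (hR F x _ (S.center j) (Finset.mem_range.1 (S.subset j hxj)) (P.nearest_spec hF).2.2
    (S.center_lt j) ?_ ?_).trans ?_
  · intro h
    have := hfar _ h
    rw [point, dist_self] at this
    have : 0 ≤ β * (1 + 2 * δ) * S.radius j := by positivity
    linarith
  · intro g hg he
    have := hfar g hg
    rw [← he] at this
    linarith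
  · rw [mul_assoc]
    refine mul_le_mul_of_nonneg_left (hd.trans ?_) (by linarith)
    exact mul_le_mul_of_nonneg_right (by linarith) hr

end Clustering

end IndexedInstance

/-! ### Independence of the numbers on the tape -/

open MeasureTheory

namespace RealRAM

instance : IsProbabilityMeasure tapeLaw := by
  unfold tapeLaw
  infer_instance

/-- Put a number in front of a tape. -/
def consTape (p : unitInterval × (ℕ → unitInterval)) : ℕ → unitInterval
  | 0 => p.1
  | t + 1 => p.2 t

theorem measurable_consTape : Measurable consTape := by
  refine measurable_pi_lambda _ fun t => ?_
  cases t with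
  | zero => exact measurable_fst
  | succ t => exact (measurable_pi_apply t).comp measurable_snd

/-- An infinite product measure is determined on boxes with finitely many constraints, and such a
box splits into a condition on the head and a box for the tail. The two cases distinguish whether
the head is constrained. -/
theorem map_consTape :
    ((volume : Measure unitInterval).prod tapeLaw).map consTape = tapeLaw := by
  refine Measure.eq_infinitePi _ fun s t ht => ?_
  rw [Measure.map_apply measurable_consTape
    (MeasurableSet.pi s.countable_toSet fun i _ => ht i)]
  set s' := s.preimage Nat.succ Nat.succ_injective.injOn with hs'
  have hpi : tapeLaw (Set.pi s' fun i => t (i + 1)) = ∏ i ∈ s', volume (t (i + 1)) :=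
    Measure.infinitePi_pi _ fun i _ => ht (i + 1)
  by_cases h0 : 0 ∈ s
  · have hs : s = insert 0 (s'.image Nat.succ) := by
      ext i
      cases i <;> simp [hs', h0]
    have hpre : consTape ⁻¹' (Set.pi s t) = t 0 ×ˢ Set.pi s' fun i => t (i + 1) := by
      ext p
      simp only [hs, Set.mem_preimage, Set.mem_pi, Finset.mem_coe, Finset.mem_insert,
        Finset.mem_image, Set.mem_prod, forall_eq_or_imp, forall_exists_index, and_imp,
        forall_apply_eq_imp_iff₂]
      exact Iff.rfl
    rw [hpre, Measure.prod_prod, hpi]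
    conv_rhs => rw [hs]
    rw [Finset.prod_insert (by simp), Finset.prod_image (by simp)]
  · have hs : s = s'.image Nat.succ := by
      ext i
      cases i <;> simp [hs', h0]
    have hpre : consTape ⁻¹' (Set.pi s t) = Set.univ ×ˢ Set.pi s' fun i => t (i + 1) := by
      ext p
      simp only [hs, Set.mem_preimage, Set.mem_pi, Finset.mem_coe,
        Finset.mem_image, Set.mem_prod, forall_exists_index, and_imp,
        forall_apply_eq_imp_iff₂, Set.mem_univ, true_and]
      exact Iff.rfl
    rw [hpre, Measure.prod_prod, hpi, measure_univ, one_mul]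
    conv_rhs => rw [hs]
    rw [Finset.prod_image (by simp)]

/-- The first number is independent of the rest of the tape; the event `B` need not be
measurable. -/
theorem tapeLaw_real_head_tail_le {A : Set unitInterval} (hA : MeasurableSet A)
    (B : Set (ℕ → unitInterval)) :
    tapeLaw.real {ω | ω 0 ∈ A ∧ (fun t => ω (t + 1)) ∈ B}
      ≤ (volume : Measure unitInterval).real A * tapeLaw.real B := by
  have hmeas : MeasurableSet {ω : ℕ → unitInterval | ω 0 ∈ A ∧
      (fun t => ω (t + 1)) ∈ toMeasurable tapeLaw B} := by
    refine MeasurableSet.inter (measurable_pi_apply 0 hA) ?_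
    have : Measurable fun (ω : ℕ → unitInterval) t => ω (t + 1) :=
      measurable_pi_lambda _ fun t => measurable_pi_apply (t + 1)
    exact this (measurableSet_toMeasurable _ _)
  have hpre : consTape ⁻¹' {ω : ℕ → unitInterval | ω 0 ∈ A ∧
      (fun t => ω (t + 1)) ∈ toMeasurable tapeLaw B} = A ×ˢ toMeasurable tapeLaw B := rfl
  rw [measureReal_def, measureReal_def, measureReal_def, ← ENNReal.toReal_mul]
  refine ENNReal.toReal_mono (ENNReal.mul_ne_top (measure_ne_top _ _) (measure_ne_top _ _)) ?_
  calc tapeLaw {ω | ω 0 ∈ A ∧ (fun t => ω (t + 1)) ∈ B}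
      ≤ tapeLaw {ω | ω 0 ∈ A ∧ (fun t => ω (t + 1)) ∈ toMeasurable tapeLaw B} :=
        measure_mono fun ω hω => ⟨hω.1, subset_toMeasurable _ _ hω.2⟩
    _ = volume A * tapeLaw B := by
        rw [← (MeasurePreserving.mk measurable_consTape map_consTape).measure_preimage
          hmeas.nullMeasurableSet, hpre, Measure.prod_prod, measure_toMeasurable]

theorem tapeLaw_real_tail_le (j : ℕ) (B : Set (ℕ → unitInterval)) :
    tapeLaw.real {ω | (fun t => ω (t + j)) ∈ B} ≤ tapeLaw.real B := by
  induction j with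
  | zero => exact le_rfl
  | succ j ih =>
    refine le_trans ?_ ih
    have := tapeLaw_real_head_tail_le MeasurableSet.univ {ω | (fun t => ω (t + j)) ∈ B}
    rw [probReal_univ, one_mul] at this
    refine le_trans (measureReal_mono fun ω hω => ?_) this
    exact ⟨trivial, hω⟩

end RealRAM

/-! ### The failure probability of rounds and trials -/

namespace IndexedInstance

open RealRAM

variable {X : Type*} [MetricSpace X] {P : IndexedInstance X} {k : ℕ}

theorem servesWithin_rounds {F : Finset ℕ} {v : ℝ} (h : P.ServesWithin F v) (hF : F.Nonempty)
    (j : ℕ) (ω : ℕ → unitInterval) : P.ServesWithin (P.rounds j F ω) v := by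
  induction j generalizing F ω with
  | zero => exact h
  | succ j ih =>
    exact ih (h.mono hF (Finset.subset_insert _ _)) (Finset.insert_nonempty _ _) _

open Classical in
/-- If a set of clients that has a share of at least `p` in the weight leads to failure only with
probability `q`, then a round leads to failure with probability at most `1 - p (1 - q)`. -/
theorem tapeLaw_real_round_le {F G : Finset ℕ} {p q : ℝ} (hw : ∀ x < P.numC, 0 ≤ P.weight F x)
    (hG : G ⊆ Finset.range P.numC) (hW : 0 < ∑ x ∈ Finset.range P.numC, P.weight F x)
    (hp : p * ∑ x ∈ Finset.range P.numC, P.weight F x ≤ ∑ x ∈ G, P.weight F x)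
    (hq : q ≤ 1) {B : Finset ℕ → Set (ℕ → unitInterval)} {A : Set (ℕ → unitInterval)} {a : ℝ}
    (hBA : ∀ F', B F' ⊆ A) (hA : tapeLaw.real A ≤ a)
    (hB : ∀ x ∈ G, tapeLaw.real (B (insert (P.nearest F x) F)) ≤ q * a) :
    tapeLaw.real {ω | (fun t => ω (t + 1)) ∈ B (P.next F (ω 0))} ≤ (1 - p * (1 - q)) * a := by
  set W := ∑ x ∈ Finset.range P.numC, P.weight F x with hWdef
  -- These are the draws that select client `x`: disjoint intervals of length `weight / W`.
  set I : ℕ → Set unitInterval := fun x => {u | ∑ y ∈ Finset.range x, P.weight F y ≤ u * W ∧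
    u * W < ∑ y ∈ Finset.range (x + 1), P.weight F y} with hI
  have hmono : ∀ x y, x ≤ y → y ≤ P.numC →
      ∑ z ∈ Finset.range x, P.weight F z ≤ ∑ z ∈ Finset.range y, P.weight F z := by
    intro x y hxy hy
    refine Finset.sum_le_sum_of_subset_of_nonneg (Finset.range_subset_range.2 hxy)
      fun z hz _ => hw z ?_
    have := Finset.mem_range.1 hz
    omega
  have hmeas : ∀ x, MeasurableSet (I x) := fun x =>
    (measurableSet_le measurable_const (measurable_subtype_coe.mul_const W)).inter
      (measurableSet_lt (measurable_subtype_coe.mul_const W) measurable_const)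
  have hvol : ∀ x ∈ G, (volume : Measure unitInterval).real (I x) = P.weight F x / W := by
    intro x hx
    have hxn := Finset.mem_range.1 (hG hx)
    have h0 : ∀ y, y ≤ P.numC →
        (∑ z ∈ Finset.range y, P.weight F z) / W ∈ Set.Icc (0 : ℝ) 1 := fun y hy =>
      ⟨div_nonneg (by simpa using hmono 0 y (by omega) hy) hW.le,
        (div_le_one hW).2 (hmono y _ hy le_rfl)⟩
    have : I x = Set.Ico ⟨_, h0 x (by omega)⟩ ⟨_, h0 (x + 1) hxn⟩ := by
      ext u
      simp only [hI, Set.mem_ofPred_eq, Set.mem_Ico, ← Subtype.coe_le_coe, ← Subtype.coe_lt_coe,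
        div_le_iff₀ hW, lt_div_iff₀ hW]
    have hdiff : (∑ z ∈ Finset.range (x + 1), P.weight F z) / W
        - (∑ z ∈ Finset.range x, P.weight F z) / W = P.weight F x / W := by
      rw [Finset.sum_range_succ]
      ring
    rw [this, measureReal_def, unitInterval.volume_Ico]
    simp only [hdiff]
    exact ENNReal.toReal_ofReal (div_nonneg (hw x hxn) hW.le)
  have hdisj : Set.PairwiseDisjoint (↑G) I := by
    have key : ∀ x y, y < P.numC → x < y → Disjoint (I x) (I y) := by
      intro x y hy hxy
      refine Set.disjoint_left.2 fun u hu hu' => ?_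
      exact absurd (hu.2.trans_le (hmono (x + 1) y hxy (by omega))) (not_lt.2 hu'.1)
    intro x hx y hy hxy
    rcases lt_or_gt_of_ne hxy with h | h
    · exact key x y (Finset.mem_range.1 (hG hy)) h
    · exact (key y x (Finset.mem_range.1 (hG hx)) h).symm
  have hUmeas : MeasurableSet (⋃ x ∈ G, I x) := G.measurableSet_biUnion fun x _ => hmeas x
  set S := ∑ x ∈ G, P.weight F x / W with hS
  have hU : (volume : Measure unitInterval).real (⋃ x ∈ G, I x) = S := by
    rw [measureReal_biUnion_finset hdisj fun x _ => hmeas x]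
    exact Finset.sum_congr rfl hvol
  -- Either the draw selects a client of `G`, after which failure is rarer by the factor `q`, or it
  -- does not and only membership in `A` is kept.
  have hsub : {ω : ℕ → unitInterval | (fun t => ω (t + 1)) ∈ B (P.next F (ω 0))}
      ⊆ (⋃ x ∈ G, {ω | ω 0 ∈ I x ∧ (fun t => ω (t + 1)) ∈ B (insert (P.nearest F x) F)}) ∪
        {ω | ω 0 ∈ (⋃ x ∈ G, I x)ᶜ ∧ (fun t => ω (t + 1)) ∈ A} := by
    intro ω hω
    by_cases h : ω 0 ∈ ⋃ x ∈ G, I x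
    · left
      obtain ⟨x, hx, hωx⟩ := Set.mem_iUnion₂.1 h
      refine Set.mem_iUnion₂.2 ⟨x, hx, hωx, ?_⟩
      have hdr : P.drawn F (ω 0) = x :=
        pickIndex_eq hw (Finset.mem_range.1 (hG hx)) hωx.1 hωx.2
      simpa only [Set.mem_ofPred_eq, next, hdr] using hω
    · exact Or.inr ⟨h, hBA _ hω⟩
  have ha0 : 0 ≤ a := measureReal_nonneg.trans hA
  have hS1 : S ≤ 1 := hU ▸ measureReal_le_one
  have hpS : p ≤ S := by
    rw [hS, ← Finset.sum_div, le_div_iff₀ hW]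
    exact hp
  calc tapeLaw.real {ω | (fun t => ω (t + 1)) ∈ B (P.next F (ω 0))}
      ≤ ∑ x ∈ G, tapeLaw.real
            {ω | ω 0 ∈ I x ∧ (fun t => ω (t + 1)) ∈ B (insert (P.nearest F x) F)}
          + tapeLaw.real {ω | ω 0 ∈ (⋃ x ∈ G, I x)ᶜ ∧ (fun t => ω (t + 1)) ∈ A} :=
        (measureReal_mono hsub).trans ((measureReal_union_le _ _).trans
          (add_le_add_left (measureReal_biUnion_finset_le _ _) _))
    _ ≤ ∑ x ∈ G, P.weight F x / W * (q * a) + (1 - S) * a := by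
        refine add_le_add (Finset.sum_le_sum fun x hx => ?_) ?_
        · refine (tapeLaw_real_head_tail_le (hmeas x) _).trans ?_
          rw [hvol x hx]
          have := hw x (Finset.mem_range.1 (hG hx))
          exact mul_le_mul_of_nonneg_left (hB x hx) (by positivity)
        · refine (tapeLaw_real_head_tail_le hUmeas.compl _).trans ?_
          rw [probReal_compl_eq_one_sub hUmeas, hU]
          exact mul_le_mul_of_nonneg_left hA (sub_nonneg.2 hS1)
    _ = (1 - S * (1 - q)) * a := by
        rw [← Finset.sum_mul]
        ring
    _ ≤ (1 - p * (1 - q)) * a := by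
        refine mul_le_mul_of_nonneg_right ?_ ha0
        have := mul_le_mul_of_nonneg_right hpS (sub_nonneg.2 hq)
        linarith

namespace Clustering

variable (S : Clustering P k)

theorem useful_subset {s δ : ℝ} {F : Finset ℕ} : S.useful s δ F ⊆ Finset.range P.numC := by
  intro x hx
  obtain ⟨j, -, hj, -⟩ := S.mem_useful.1 hx
  exact S.subset j hj

theorem roundProb_le_one {ℓ s δ ε : ℝ} {m : ℕ} (hℓ : 0 ≤ ℓ) (hs : 0 ≤ s) (hδ : 0 < δ)
    (hε : 0 < ε) : roundProb ℓ s δ ε m ≤ 1 := by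
  rw [roundProb, div_le_one (by positivity)]
  have h1 : nearShare ℓ δ ≤ 1 := by
    have h2 : δ / (1 + δ) ≤ 1 := (div_le_one (by positivity)).2 (by linarith)
    have h3 : (δ / (1 + 2 * δ)) ^ ℓ ≤ 1 := Real.rpow_le_one (by positivity)
      ((div_le_one (by positivity)).2 (by linarith)) hℓ
    have h4 : (1 : ℝ) ≤ 2 ^ (ℓ + 1) := Real.one_le_rpow (by norm_num) (by linarith)
    rw [nearShare, div_le_one (by positivity)]
    exact (mul_le_one₀ h2 (by positivity) h3).trans h4
  have h5 : 0 ≤ 2 * (1 + s) ^ ℓ / ε := by positivity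
  nlinarith [Nat.cast_nonneg (α := ℝ) m, mul_nonneg (Nat.cast_nonneg (α := ℝ) m) h5]

/-- Induction on the remaining rounds with the invariant that `i` locations cover at least `i`
clusters; a set that is good already stays good by `servesWithin_rounds`. The event `A` on the
unread tape is carried along so that trials can be chained without measurability of failure. -/
theorem tapeLaw_real_rounds_le (hℓ : 1 ≤ P.ell) (hm : P.m < P.numC) (hk : 0 < k)
    (hkL : k ≤ P.numL) {β δ ε : ℝ} (hβ : 1 ≤ β) (hδ : 0 < δ) (hε : 0 < ε) (hR : Reaches P β)
    (A : Set (ℕ → unitInterval)) (j i : ℕ) (hij : i + j = k) (F : Finset ℕ) (hFi : F.card = i)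
    (hF : i ≤ (S.covered (β * (1 + 2 * δ)) F).card) :
    tapeLaw.real {ω | ¬ P.ServesWithin (P.rounds j F ω)
        (((1 + β * (1 + 2 * δ)) ^ P.ell + ε / 2) * S.cost) ∧ (fun t => ω (t + j)) ∈ A}
      ≤ (1 - roundProb P.ell (β * (1 + 2 * δ)) δ ε P.m ^ j) * tapeLaw.real A := by
  set s := β * (1 + 2 * δ) with hs
  set v := ((1 + s) ^ P.ell + ε / 2) * S.cost with hv
  set p := roundProb P.ell s δ ε P.m with hp
  have hs0 : 1 + 2 * δ ≤ s := by rw [hs]; nlinarith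
  have hp0 : 0 < p := roundProb_pos (by linarith) hδ hε
  have hp1 : p ≤ 1 := roundProb_le_one (by linarith) (by linarith) hδ hε
  have hq : ∀ j, 0 ≤ 1 - p ^ j := fun j => sub_nonneg.2 (pow_le_one₀ hp0.le hp1)
  have hw : ∀ F x, 0 ≤ P.weight F x := by
    intro F x
    refine le_min (P.power_nonneg _ _) ?_
    exact ((threshold_spec hm.le F).sum_min_le (fun x _ => P.power_nonneg _ _) hm
      S.biUnion_subset S.card).1
  have hgood : ∀ (j : ℕ) (F : Finset ℕ), F.Nonempty → P.ServesWithin F v →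
      tapeLaw.real {ω | ¬ P.ServesWithin (P.rounds j F ω) v ∧ (fun t => ω (t + j)) ∈ A}
        ≤ (1 - p ^ j) * tapeLaw.real A := by
    intro j F h₁ h₂
    have : {ω | ¬ P.ServesWithin (P.rounds j F ω) v ∧ (fun t => ω (t + j)) ∈ A} = ∅ :=
      Set.eq_empty_iff_forall_notMem.2 fun ω hω => hω.1 (servesWithin_rounds h₂ h₁ j ω)
    rw [this, measureReal_empty]
    exact mul_nonneg (hq j) measureReal_nonneg
  induction j generalizing i F with
  | zero =>
    -- No rounds are left and `k` of `k` clusters are covered.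
    obtain rfl : i = k := hij
    refine hgood 0 F (Finset.card_pos.1 (hFi ▸ hk)) ?_
    have huniv : S.covered s F = Finset.univ :=
      Finset.eq_univ_of_card _ (le_antisymm (Finset.card_le_univ _) (by simpa using hF))
    obtain ⟨N, hN, hc, hle⟩ :=
      S.servesWithin_of_covered hℓ (s := s) (by linarith) (F := F) (by simp [huniv])
    refine ⟨N, hN, hc, hle.trans ?_⟩
    exact mul_le_mul_of_nonneg_right (by linarith) S.cost_nonneg
  | succ j ih =>
    rcases S.servesWithin_or_weight_useful hℓ hm hδ hε hs0 F with h | ⟨hW, hG⟩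
    · exact hgood _ _ h.1 h.2
    have hfree : ∃ f < P.numL, f ∉ F := by
      by_contra! h
      have := Finset.card_le_card (s := Finset.range P.numL) (t := F)
        fun f hf => h f (Finset.mem_range.1 hf)
      rw [hFi, Finset.card_range] at this
      omega
    have := tapeLaw_real_round_le (P := P) (F := F) (q := 1 - p ^ j)
      (B := fun F' => {ω | ¬ P.ServesWithin (P.rounds j F' ω) v ∧ (fun t => ω (t + j)) ∈ A})
      (A := {ω | (fun t => ω (t + j)) ∈ A}) (a := tapeLaw.real A)
      (fun x _ => hw F x) S.useful_subset hW hG (by linarith [pow_pos hp0 j])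
      (fun F' ω hω => hω.2) (tapeLaw_real_tail_le j A) ?_
    -- With `q = 1 - p ^ j`, the bound `1 - p * (1 - q)` is `1 - p ^ (j + 1)`.
    · rw [sub_sub_cancel, ← pow_succ'] at this
      exact this
    · intro x hx
      refine ih (i + 1) (by omega) _ ?_ ?_
      · rw [Finset.card_insert_of_notMem (P.nearest_spec hfree).2.1, hFi]
      · exact hF.trans_lt (S.covered_next hβ hδ hR hfree hx)

/-- The probability that all of `N` independent runs fail. -/
theorem tapeLaw_real_trials_le (hℓ : 1 ≤ P.ell) (hm : P.m < P.numC) (hk : 0 < k)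
    (hkL : k ≤ P.numL) {β δ ε : ℝ} (hβ : 1 ≤ β) (hδ : 0 < δ) (hε : 0 < ε) (hR : Reaches P β)
    (N : ℕ) :
    tapeLaw.real {ω | ∀ t < N, ¬ P.ServesWithin (P.rounds k ∅ fun s => ω (s + t * k))
        (((1 + β * (1 + 2 * δ)) ^ P.ell + ε / 2) * S.cost)}
      ≤ (1 - roundProb P.ell (β * (1 + 2 * δ)) δ ε P.m ^ k) ^ N := by
  have hs : 0 ≤ β * (1 + 2 * δ) := by positivity
  have hp0 : 0 < roundProb P.ell (β * (1 + 2 * δ)) δ ε P.m := roundProb_pos hs hδ hε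
  have hp1 : roundProb P.ell (β * (1 + 2 * δ)) δ ε P.m ≤ 1 :=
    roundProb_le_one (by linarith) hs hδ hε
  induction N with
  | zero => simp
  | succ N ih =>
    -- The event on the unread tape is that the `N` later trials fail.
    have h := S.tapeLaw_real_rounds_le hℓ hm hk hkL hβ hδ hε hR
      {ω | ∀ t < N, ¬ P.ServesWithin (P.rounds k ∅ fun s => ω (s + t * k))
        (((1 + β * (1 + 2 * δ)) ^ P.ell + ε / 2) * S.cost)} k 0 (by omega) ∅ rfl (Nat.zero_le _)
    refine (measureReal_mono fun ω hω => ?_).trans (h.trans ?_)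
    · refine ⟨by simpa using hω 0 (by omega), fun t ht => ?_⟩
      have := hω (t + 1) (by omega)
      simpa only [add_mul, one_mul, add_assoc, add_comm k] using this
    · rw [pow_succ']
      exact mul_le_mul_of_nonneg_left ih (sub_nonneg.2 (pow_le_one₀ hp0.le hp1))

end Clustering

end IndexedInstance

/-! ### The choice of the parameters -/

/-- The relative slack for the distance of a sampled client from the center. -/
noncomputable def slack (ℓ ε : ℝ) : ℝ := ε / (8 * 6 ^ ℓ)

theorem slack_pos {ℓ ε : ℝ} (hε : 0 < ε) : 0 < slack ℓ ε := by
  unfold slack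
  positivity

theorem slack_le {ℓ ε : ℝ} (hℓ : 1 ≤ ℓ) (hε1 : ε ≤ 1) : slack ℓ ε ≤ 1 / 48 := by
  have h6 : (6 : ℝ) ≤ 6 ^ ℓ := Real.self_le_rpow_of_one_le (by norm_num) hℓ
  rw [slack, div_le_div_iff₀ (by positivity) (by norm_num)]
  linarith

/-- The left base is at most `(1 + β) * (1 + 2 * slack)`, and `(1 + 2 * slack) ^ ℓ` is at most `1 +
2 * x` with `x = 2 * ℓ * slack`. In the denominator `8 * 6 ^ ℓ` of the slack, the part `2 ^ ℓ`
absorbs `ℓ` and `3 ^ ℓ` absorbs `(1 + β) ^ ℓ`, so the excess is at most `ε / 2`. -/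
theorem ratio_le {ℓ ε β : ℝ} (hℓ : 1 ≤ ℓ) (hε : 0 < ε) (hε1 : ε ≤ 1) (hβ : 1 ≤ β) (hβ2 : β ≤ 2) :
    (1 + β * (1 + 2 * slack ℓ ε)) ^ ℓ + ε / 2 ≤ (1 + β) ^ ℓ + ε := by
  have hδ := slack_pos (ℓ := ℓ) hε
  have h3 : (1 : ℝ) ≤ 3 ^ ℓ := Real.one_le_rpow (by norm_num) (by linarith)
  have h2 : ℓ ≤ 2 ^ ℓ := by
    have := one_add_mul_self_le_rpow_one_add (s := 1) (by norm_num) hℓ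
    norm_num at this
    linarith
  set x := slack ℓ ε * ℓ * 2 with hx
  have hxle : x * (4 * 3 ^ ℓ) ≤ ε := by
    have h6 : (6 : ℝ) ^ ℓ = 2 ^ ℓ * 3 ^ ℓ := by
      rw [← Real.mul_rpow (by norm_num) (by norm_num)]
      norm_num
    calc x * (4 * 3 ^ ℓ) = ε * (ℓ / 2 ^ ℓ) := by
          rw [hx, slack, h6]
          field_simp
          norm_num
      _ ≤ ε * 1 := by
          gcongr
          exact (div_le_one (by positivity)).2 h2
      _ = ε := mul_one ε
  have hx0 : 0 ≤ x := by positivity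
  have hx4 : x ≤ 1 / 4 := by nlinarith
  have hexp : (1 + 2 * slack ℓ ε) ^ ℓ ≤ 1 + 2 * x := by
    calc (1 + 2 * slack ℓ ε) ^ ℓ ≤ Real.exp (2 * slack ℓ ε) ^ ℓ := by
          refine Real.rpow_le_rpow (by positivity) ?_ (by linarith)
          rw [add_comm]
          exact Real.add_one_le_exp _
      _ = Real.exp x := by rw [← Real.exp_mul, hx]; ring_nf
      _ ≤ 1 / (1 - x) := Real.exp_bound_div_one_sub_of_interval hx0 (by linarith)
      _ ≤ 1 + 2 * x := by
          rw [div_le_iff₀ (by linarith)]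
          nlinarith
  have hbase : 1 + β * (1 + 2 * slack ℓ ε) ≤ (1 + β) * (1 + 2 * slack ℓ ε) := by nlinarith
  have h4 : (1 + β) ^ ℓ ≤ 3 ^ ℓ := Real.rpow_le_rpow (by linarith) (by linarith) (by linarith)
  have h5 : (1 + β * (1 + 2 * slack ℓ ε)) ^ ℓ ≤ (1 + β) ^ ℓ * (1 + 2 * x) := by
    refine (Real.rpow_le_rpow (by positivity) hbase (by linarith)).trans ?_
    rw [Real.mul_rpow (by positivity) (by positivity)]
    gcongr
  have h6 : (1 + β) ^ ℓ * (2 * x) ≤ 3 ^ ℓ * (2 * x) := by gcongr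
  nlinarith

/-- The base of `numTrials` is at least the reciprocal of the success probability of a round. -/
theorem one_le_roundProb_mul {ℓ ε β : ℝ} {k m : ℕ} (hℓ : 1 ≤ ℓ) (hε : 0 < ε) (hε1 : ε ≤ 1)
    (hβ : 1 ≤ β) (hβ2 : β ≤ 2) (hk : 0 < k) :
    1 ≤ IndexedInstance.Clustering.roundProb ℓ (β * (1 + 2 * slack ℓ ε)) (slack ℓ ε) ε m
      * (((200 * ((k + m) / ε)) ^ ℓ) ^ ℓ) ^ 4 := by
  have hδ := slack_pos (ℓ := ℓ) hε
  have hδ1 := slack_le hℓ hε1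
  have hℓ0 : 0 ≤ ℓ := by linarith
  have hk1 : (1 : ℝ) ≤ k := by exact_mod_cast hk
  have hm0 : (0 : ℝ) ≤ m := Nat.cast_nonneg m
  set b : ℝ := (k + m) / ε with hb
  have hbε : 1 / ε ≤ b := div_le_div_of_nonneg_right (by linarith) hε.le
  have hbk : (k : ℝ) + m ≤ b := by
    rw [hb, le_div_iff₀ hε]
    nlinarith
  have hb1 : 1 ≤ b := by linarith
  set y := (200 * b) ^ ℓ with hy
  set z := y ^ ℓ with hz
  have hpow : ∀ {a : ℝ}, 1 ≤ a → a ≤ a ^ ℓ := fun ha => Real.self_le_rpow_of_one_le ha hℓ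
  have hy1 : 1 ≤ y := Real.one_le_rpow (by linarith) hℓ0
  have hyz : y ≤ z := hpow hy1
  have hby : b ≤ y := by linarith [hpow (a := 200 * b) (by linarith)]
  have hz0 : 0 < z := by linarith
  have hslack : 1 / y ≤ slack ℓ ε / 4 := by
    have h1 : 32 * 6 ^ ℓ * b ≤ y := by
      calc 32 * 6 ^ ℓ * b = 6 ^ ℓ * (32 * b) := by ring
        _ ≤ 6 ^ ℓ * (32 * b) ^ ℓ := by
            gcongr
            exact hpow (by linarith)
        _ = (6 * (32 * b)) ^ ℓ := (Real.mul_rpow (by norm_num) (by positivity)).symm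
        _ ≤ y := Real.rpow_le_rpow (by positivity) (by linarith) hℓ0
    rw [slack, div_div, div_le_div_iff₀ (by linarith) (by positivity)]
    have h2 : 1 ≤ ε * b := by
      rw [div_le_iff₀ hε] at hbε
      linarith
    have h3 : (0 : ℝ) < 6 ^ ℓ := by positivity
    nlinarith
  -- For `δ ≤ 1 / 2` the share is at least `(δ / 4) ^ (ℓ + 1)`. As `1 / δ` is itself exponential in
  -- `ℓ`, this costs an exponent of order `ℓ ^ 2`, which is why `numTrials` applies the power `ℓ`
  -- twice.
  have hnear : 1 / z ^ 2 ≤ IndexedInstance.nearShare ℓ (slack ℓ ε) := by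
    set δ := slack ℓ ε
    calc 1 / z ^ 2 = (1 / y) ^ (2 * ℓ) := by
          rw [one_div, one_div, Real.inv_rpow (by linarith), mul_comm, Real.rpow_mul (by linarith),
            ← hz]
          norm_cast
      _ ≤ (δ / 4) ^ (2 * ℓ) := Real.rpow_le_rpow (by positivity) hslack (by linarith)
      _ ≤ (δ / 4) ^ (ℓ + 1) :=
          Real.rpow_le_rpow_of_exponent_ge (by positivity) (by linarith) (by linarith)
      _ = δ / 2 * (δ / 2) ^ ℓ / 2 ^ (ℓ + 1) := by
          rw [show δ / 4 = δ / 2 / 2 by ring, Real.div_rpow (by positivity) (by norm_num),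
            Real.rpow_add_one (by positivity), mul_comm (δ / 2)]
      _ ≤ δ / (1 + δ) * (δ / (1 + 2 * δ)) ^ ℓ / 2 ^ (ℓ + 1) := by
          gcongr <;> linarith
      _ = _ := rfl
  -- Each of the two factors is at most `z`. With the `z ^ 2` lost in `hnear` this explains the
  -- fourth power.
  have hden : ((m : ℝ) + 1) * (1 + 2 * (1 + β * (1 + 2 * slack ℓ ε)) ^ ℓ / ε) ≤ z ^ 2 := by
    have h1 : (1 + β * (1 + 2 * slack ℓ ε)) ^ ℓ ≤ 4 ^ ℓ :=
      Real.rpow_le_rpow (by positivity) (by nlinarith) hℓ0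
    have h4 : (1 : ℝ) ≤ 4 ^ ℓ := Real.one_le_rpow (by norm_num) hℓ0
    have h2 : 1 + 2 * (1 + β * (1 + 2 * slack ℓ ε)) ^ ℓ / ε ≤ z := by
      calc 1 + 2 * (1 + β * (1 + 2 * slack ℓ ε)) ^ ℓ / ε
          = 1 + 2 * (1 + β * (1 + 2 * slack ℓ ε)) ^ ℓ * (1 / ε) := by ring
        _ ≤ 1 + 2 * 4 ^ ℓ * b := by gcongr
        _ ≤ 4 ^ ℓ * (3 * b) := by nlinarith
        _ ≤ 4 ^ ℓ * (3 * b) ^ ℓ := by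
            gcongr
            exact hpow (by linarith)
        _ = (4 * (3 * b)) ^ ℓ := (Real.mul_rpow (by norm_num) (by positivity)).symm
        _ ≤ y := Real.rpow_le_rpow (by positivity) (by linarith) hℓ0
        _ ≤ z := hyz
    calc ((m : ℝ) + 1) * (1 + 2 * (1 + β * (1 + 2 * slack ℓ ε)) ^ ℓ / ε) ≤ z * z := by
          gcongr
          linarith
      _ = z ^ 2 := (sq z).symm
  have hden0 : 0 < ((m : ℝ) + 1) * (1 + 2 * (1 + β * (1 + 2 * slack ℓ ε)) ^ ℓ / ε) := by
    positivity
  rw [IndexedInstance.Clustering.roundProb, div_mul_eq_mul_div, one_le_div hden0]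
  calc ((m : ℝ) + 1) * (1 + 2 * (1 + β * (1 + 2 * slack ℓ ε)) ^ ℓ / ε) ≤ z ^ 2 := hden
    _ = 1 / z ^ 2 * z ^ 4 := by field_simp
    _ ≤ _ := by gcongr

theorem one_sub_pow_le_half {x : ℝ} {N : ℕ} (hx1 : x ≤ 1) (h : 1 ≤ x * N) :
    (1 - x) ^ N ≤ 1 / 2 := by
  calc (1 - x) ^ N ≤ Real.exp (-x) ^ N :=
        pow_le_pow_left₀ (by linarith) (Real.one_sub_le_exp_neg x) N
    _ = Real.exp (-(x * N)) := by rw [← Real.exp_nat_mul]; ring_nf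
    _ ≤ Real.exp (-1) := Real.exp_le_exp.2 (by linarith)
    _ ≤ 1 / 2 := by
        rw [Real.exp_neg, one_div]
        exact inv_anti₀ (by norm_num) (by linarith [Real.add_one_le_exp (1 : ℝ)])

namespace IndexedInstance

open RealRAM

variable {X : Type*} [MetricSpace X] {P : IndexedInstance X} {k : ℕ}

theorem Clustering.tapeLaw_real_numTrials_le (S : Clustering P k) (hℓ : 1 ≤ P.ell)
    (hm : P.m < P.numC) (hk : 0 < k) (hkL : k ≤ P.numL) {β ε : ℝ} (hβ : 1 ≤ β) (hβ2 : β ≤ 2)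
    (hε : 0 < ε) (hε1 : ε ≤ 1) (hR : Reaches P β) :
    tapeLaw.real {ω | ∀ t < numTrials k P.m P.ell ε, ¬ P.ServesWithin
        (P.rounds k ∅ fun s => ω (s + t * k)) (((1 + β) ^ P.ell + ε) * S.cost)} ≤ 1 / 2 := by
  have hδ := slack_pos (ℓ := P.ell) hε
  set p := Clustering.roundProb P.ell (β * (1 + 2 * slack P.ell ε)) (slack P.ell ε) ε P.m with hp
  have hp0 : 0 < p := Clustering.roundProb_pos (by positivity) hδ hε
  have hp1 : p ≤ 1 := Clustering.roundProb_le_one (by linarith) (by positivity) hδ hε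
  have hfail := S.tapeLaw_real_trials_le hℓ hm hk hkL hβ hδ hε hR (numTrials k P.m P.ell ε)
  refine (measureReal_mono ?_).trans (hfail.trans
    (one_sub_pow_le_half (pow_le_one₀ hp0.le hp1) ?_))
  · intro ω hω t ht h
    obtain ⟨N, hN, hc, hle⟩ := h
    exact hω t ht ⟨N, hN, hc, hle.trans
      (mul_le_mul_of_nonneg_right (ratio_le hℓ hε hε1 hβ hβ2) S.cost_nonneg)⟩
  · have h1 := one_le_roundProb_mul (k := k) (m := P.m) hℓ hε hε1 hβ hβ2 hk
    calc (1 : ℝ) ≤ (p * (((200 * ((k + P.m) / ε)) ^ P.ell) ^ P.ell) ^ 4) ^ k := one_le_pow₀ h1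
      _ = p ^ k * ((((200 * ((k + P.m) / ε)) ^ P.ell) ^ P.ell) ^ 4) ^ k := mul_pow _ _ _
      _ ≤ p ^ k * numTrials k P.m P.ell ε := by
          gcongr
          exact Nat.le_ceil _

end IndexedInstance

/-- The running time of the algorithm. -/
theorem service_time_le {c l k m : ℕ} {ℓ ε : ℝ} (hℓ : 1 ≤ ℓ) (hε : 0 < ε) (hε1 : ε ≤ 1)
    (hk : 0 < k) (hl : 0 < l) :
    ((RealRAM.numTrials k m ℓ ε * (RealRAM.trialTime c l k m + 14) + k * 20 + 80 : ℕ) : ℝ)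
      ≤ 1318 * (c + l : ℕ) * (max 2 (((k : ℝ) + m) / ε)) ^ (1318 * k * ℓ ^ 2) := by
  set B := max 2 (((k : ℝ) + m) / ε) with hB
  have hB2 : 2 ≤ B := le_max_left _ _
  have hk1 : (1 : ℝ) ≤ k := by exact_mod_cast hk
  have hl1 : (1 : ℝ) ≤ l := by exact_mod_cast hl
  have hm0 : (0 : ℝ) ≤ m := Nat.cast_nonneg m
  have hc0 : (0 : ℝ) ≤ c := Nat.cast_nonneg c
  have hkm : (k : ℝ) + m ≤ B := by
    refine le_trans ?_ (le_max_right _ _)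
    rw [le_div_iff₀ hε]
    nlinarith
  set n : ℝ := (c : ℝ) + l with hn
  have hn1 : 1 ≤ n := by linarith
  have htrial : (RealRAM.trialTime c l k m : ℝ) + 14 ≤ 644 * n * B ^ 2 := by
    have h1 : ((m : ℝ) + 1) * (c * 38 + 42) ≤ B * (80 * n) := by gcongr <;> linarith
    have h2 : (c : ℝ) * 218 + l * 70 + 260 ≤ B * (240 * n) := by nlinarith
    have h3 : ((k : ℝ) + 1) * (((m : ℝ) + 1) * (c * 38 + 42) + c * 218 + l * 70 + 260)
        ≤ (2 * B) * (B * (320 * n)) := by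
      gcongr
      · linarith
      · linarith
    have h4 : (14 : ℝ) ≤ 4 * n * B ^ 2 := by nlinarith
    rw [RealRAM.trialTime]
    push_cast
    nlinarith
  set q : ℝ := (((200 * ((k + m) / ε)) ^ ℓ) ^ ℓ) ^ 4 with hq
  have hb1 : (1 : ℝ) ≤ (k + m) / ε := by
    rw [one_le_div hε]
    linarith
  have hq1 : 1 ≤ q :=
    one_le_pow₀ (Real.one_le_rpow (Real.one_le_rpow (by linarith) (by linarith)) (by linarith))
  have hN : (RealRAM.numTrials k m ℓ ε : ℝ) ≤ 2 * q ^ k := by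
    have := (Nat.ceil_lt_add_one (a := q ^ k) (by positivity)).le
    have h1 : 1 ≤ q ^ k := one_le_pow₀ hq1
    rw [RealRAM.numTrials]
    linarith
  -- As `200 ≤ 2 ^ 8 ≤ B ^ 8`, the base is at most `B ^ 9`; the powers `ℓ`, `ℓ`, `4` and `k` give
  -- the exponent `36 * k * ℓ ^ 2`.
  have hqB : q ^ k ≤ B ^ (36 * k * ℓ ^ 2) := by
    have h1 : 200 * (((k : ℝ) + m) / ε) ≤ B ^ (9 : ℝ) := by
      have h2 : (2 : ℝ) ^ 8 ≤ B ^ 8 := pow_le_pow_left₀ (by norm_num) hB2 8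
      have h3 : ((k : ℝ) + m) / ε ≤ B := le_max_right _ _
      have h4 : B ^ (9 : ℝ) = B ^ 8 * B := by
        rw [← pow_succ]
        exact_mod_cast Real.rpow_natCast B 9
      rw [h4]
      gcongr
      norm_num at h2
      linarith
    have h5 : ((200 * (((k : ℝ) + m) / ε)) ^ ℓ) ^ ℓ ≤ B ^ (9 * ℓ ^ 2) := by
      have : B ^ (9 * ℓ ^ 2) = ((B ^ (9 : ℝ)) ^ ℓ) ^ ℓ := by
        rw [← Real.rpow_mul (by linarith), ← Real.rpow_mul (by linarith)]
        ring_nf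
      rw [this]
      have hℓ0 : 0 ≤ ℓ := by linarith
      gcongr
    calc q ^ k = (((200 * (((k : ℝ) + m) / ε)) ^ ℓ) ^ ℓ) ^ (4 * k) := by rw [hq, ← pow_mul]
      _ ≤ (B ^ (9 * ℓ ^ 2)) ^ (4 * k) := by gcongr
      _ = B ^ (36 * k * ℓ ^ 2) := by
          rw [← Real.rpow_natCast, ← Real.rpow_mul (by linarith)]
          push_cast
          ring_nf
  have hqk : 1 ≤ q ^ k := one_le_pow₀ hq1
  have hkℓ : 1 ≤ (k : ℝ) * ℓ ^ 2 := by
    have : 1 ≤ ℓ ^ 2 := one_le_pow₀ hℓ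
    nlinarith
  have hfinal : B ^ 2 * q ^ k ≤ B ^ (1318 * k * ℓ ^ 2) := by
    calc B ^ 2 * q ^ k ≤ B ^ (2 : ℝ) * B ^ (36 * k * ℓ ^ 2) := by
          rw [Real.rpow_two]
          gcongr
      _ = B ^ (2 + 36 * k * ℓ ^ 2) := (Real.rpow_add (by linarith) _ _).symm
      _ ≤ _ := Real.rpow_le_rpow_of_exponent_le (by linarith) (by nlinarith)
  have hrest : (k : ℝ) * 20 + 80 ≤ 30 * n * B ^ 2 := by nlinarith
  push_cast
  calc (RealRAM.numTrials k m ℓ ε : ℝ) * (RealRAM.trialTime c l k m + 14) + k * 20 + 80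
      ≤ 2 * q ^ k * (644 * n * B ^ 2) + 30 * n * B ^ 2 := by
        rw [add_assoc]
        gcongr
    _ ≤ 2 * q ^ k * (644 * n * B ^ 2) + 30 * n * B ^ 2 * q ^ k := by
        exact add_le_add le_rfl (le_mul_of_one_le_right (by positivity) hqk)
    -- Here `1318 = 2 * 644 + 30`. The same number serves as the constant in the exponent, where it
    -- is far from tight.
    _ = 1318 * n * (B ^ 2 * q ^ k) := by ring
    _ ≤ 1318 * n * B ^ (1318 * k * ℓ ^ 2) := by gcongr

/-! ### Attainment of the minima that define the optimum -/

namespace OutlierInstance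

variable {X : Type*} (I : OutlierInstance X)

theorem IsOutlierClustering.subset {I : OutlierInstance X} {Z : Finset X}
    {𝒞 : Fin I.k → Finset X} (h : I.IsOutlierClustering Z 𝒞) (j : Fin I.k) : 𝒞 j ⊆ I.C :=
  fun x hx => ((h.2.2.2 x).1 ⟨j, hx⟩).1

theorem exists_isCenterSet : ∃ f, I.IsCenterSet f := by
  obtain ⟨S, hS, hc⟩ := Finset.exists_subset_card_eq I.k_le
  refine ⟨fun j => (S.equivFin.symm (Fin.cast hc.symm j) : X), ?_, fun j => hS (Subtype.coe_prop _)⟩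
  exact Subtype.val_injective.comp (S.equivFin.symm.injective.comp (Fin.cast_injective hc.symm))

theorem exists_isOutlierClustering : ∃ Z 𝒞, I.IsOutlierClustering Z 𝒞 := by
  classical
  obtain ⟨Z, hZ, hc⟩ := Finset.exists_subset_card_eq I.m_le
  refine ⟨Z, fun j => if j = ⟨0, I.k_pos⟩ then I.C \ Z else ∅, hZ, hc, ?_, fun x => ?_⟩
  · intro i j hij
    dsimp only
    by_cases hi : i = ⟨0, I.k_pos⟩
    · rw [if_neg (c := j = _) (fun hj => hij (hi.trans hj.symm))]
      exact Finset.disjoint_empty_right _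
    · rw [if_neg hi]
      exact Finset.disjoint_empty_left _
  · constructor
    · rintro ⟨j, hj⟩
      dsimp only at hj
      split_ifs at hj
      · simpa using hj
      · simp at hj
    · rintro ⟨h₁, h₂⟩
      exact ⟨⟨0, I.k_pos⟩, by simp [h₁, h₂]⟩

variable [MetricSpace X] (ℓ : ℝ)

theorem exists_psi_eq (f : Fin I.k → X) (𝒞 : Fin I.k → Finset X) :
    ∃ π : Equiv.Perm (Fin I.k), I.Psi ℓ f 𝒞 = ∑ j, ∑ x ∈ 𝒞 j, dist x (f (π j)) ^ ℓ := by
  obtain ⟨π, hπ⟩ := exists_eq_ciInf_of_finite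
    (f := fun π : Equiv.Perm (Fin I.k) => ∑ j, ∑ x ∈ 𝒞 j, dist x (f (π j)) ^ ℓ)
  exact ⟨π, hπ.symm⟩

theorem psi_le (f : Fin I.k → X) (𝒞 : Fin I.k → Finset X) :
    I.Psi ℓ f 𝒞 ≤ ∑ j, ∑ x ∈ 𝒞 j, dist x (f j) ^ ℓ :=
  ciInf_le (f := fun π : Equiv.Perm (Fin I.k) => ∑ j, ∑ x ∈ 𝒞 j, dist x (f (π j)) ^ ℓ)
    (Set.finite_range _).bddBelow 1

theorem exists_psiStar_eq (𝒞 : Fin I.k → Finset X) :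
    ∃ f, I.IsCenterSet f ∧ I.PsiStar ℓ 𝒞 = I.Psi ℓ f 𝒞 := by
  classical
  have hfin : {r | ∃ f, I.IsCenterSet f ∧ r = I.Psi ℓ f 𝒞}.Finite := by
    refine (((Fintype.piFinset fun _ : Fin I.k => I.L).image fun f => I.Psi ℓ f 𝒞).finite_toSet
      ).subset ?_
    rintro _ ⟨f, hf, rfl⟩
    exact Finset.mem_coe.2 (Finset.mem_image_of_mem _ (Fintype.mem_piFinset.2 hf.2))
  obtain ⟨f, hf⟩ := I.exists_isCenterSet
  have hne : {r | ∃ f, I.IsCenterSet f ∧ r = I.Psi ℓ f 𝒞}.Nonempty := ⟨_, f, hf, rfl⟩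
  exact hne.csInf_mem hfin

theorem exists_opt_eq : ∃ Z 𝒞, I.IsOutlierClustering Z 𝒞 ∧ I.opt ℓ = I.PsiStar ℓ 𝒞 := by
  classical
  have hfin : {r | ∃ Z 𝒞, I.IsOutlierClustering Z 𝒞 ∧ r = I.PsiStar ℓ 𝒞}.Finite := by
    refine (((Fintype.piFinset fun _ : Fin I.k => I.C.powerset).image
      fun 𝒞 => I.PsiStar ℓ 𝒞).finite_toSet).subset ?_
    rintro _ ⟨Z, 𝒞, h, rfl⟩
    exact Finset.mem_coe.2 (Finset.mem_image_of_mem _ (Fintype.mem_piFinset.2 fun j =>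
      Finset.mem_powerset.2 (h.subset j)))
  obtain ⟨Z, 𝒞, h⟩ := I.exists_isOutlierClustering
  have hne : {r | ∃ Z 𝒞, I.IsOutlierClustering Z 𝒞 ∧ r = I.PsiStar ℓ 𝒞}.Nonempty :=
    ⟨_, Z, 𝒞, h, rfl⟩
  exact hne.csInf_mem hfin

/-- An optimal solution. -/
theorem exists_optimal : ∃ (Z : Finset X) (𝒞 : Fin I.k → Finset X) (f : Fin I.k → X),
    I.IsOutlierClustering Z 𝒞 ∧ (∀ j, f j ∈ I.L) ∧
    I.opt ℓ = ∑ j, ∑ x ∈ 𝒞 j, dist x (f j) ^ ℓ := by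
  obtain ⟨Z, 𝒞, h, h₁⟩ := I.exists_opt_eq ℓ
  obtain ⟨f, hf, h₂⟩ := I.exists_psiStar_eq ℓ 𝒞
  obtain ⟨π, h₃⟩ := I.exists_psi_eq ℓ f 𝒞
  exact ⟨Z, 𝒞, fun j => f (π j), h, fun j => hf.2 _, by rw [h₁, h₂, h₃]⟩

end OutlierInstance

/-! ### Translation between listed instances and indices -/

namespace ListedInstance

open RealRAM

variable {X : Type*} (I : ListedInstance X)

theorem n_pos : 0 < I.n := by
  have := I.k_pos
  have := I.k_le
  unfold n
  omega

/-- The listed points, extended to all natural numbers. -/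
def pointNat (i : ℕ) : X := if h : i < I.n then I.point ⟨i, h⟩ else I.point ⟨0, I.n_pos⟩

theorem mem_labelled {σ : State} {p : ℕ → Prop} [DecidablePred p] {x : X} :
    x ∈ I.labelled σ p ↔ ∃ i, p (σ.nat 2 i) ∧ ∃ h : i < I.C.card, (I.client ⟨i, h⟩ : X) = x := by
  simp only [labelled, Finset.mem_map, Finset.mem_filter, Finset.mem_univ, true_and]
  constructor
  · rintro ⟨i, hi, rfl⟩
    exact ⟨i, hi, i.2, rfl⟩
  · rintro ⟨i, hi, h, rfl⟩
    exact ⟨⟨i, h⟩, hi, rfl⟩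

variable (ℓ : ℝ)

/-- The instance with clients and locations given by their indices. -/
def indexed : IndexedInstance X where
  client := I.pointNat
  loc f := I.pointNat (I.C.card + f)
  ell := ℓ
  numC := I.C.card
  numL := I.L.card
  m := I.m

theorem indexed_client {x : ℕ} (hx : x < I.C.card) :
    (I.indexed ℓ).client x = I.client ⟨x, hx⟩ := by
  have hn : x < I.n := hx.trans_le (Nat.le_add_right _ _)
  simp only [indexed, pointNat, dif_pos hn, point]
  exact Fin.addCases_left (motive := fun _ => X) (⟨x, hx⟩ : Fin I.C.card)

theorem indexed_loc {f : ℕ} (hf : f < I.L.card) :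
    (I.indexed ℓ).loc f = I.location ⟨f, hf⟩ := by
  have hn : I.C.card + f < I.n := Nat.add_lt_add_left hf _
  simp only [indexed, pointNat, dif_pos hn, point]
  exact Fin.addCases_right (motive := fun _ => X) (⟨f, hf⟩ : Fin I.L.card)

theorem input_init (ε : ℝ) (ω : ℕ → unitInterval) :
    Input (I.indexed ℓ) I.k (I.init ℓ ε ω) := by
  constructor <;> simp [init, indexed]

theorem exists_client_index {x : X} (hx : x ∈ I.C) :
    ∃ i < I.C.card, (I.indexed ℓ).client i = x := by
  obtain ⟨i, hi⟩ := I.client.surjective ⟨x, hx⟩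
  exact ⟨i, i.2, by rw [I.indexed_client ℓ i.2, Fin.eta, hi]⟩

theorem exists_loc_index {x : X} (hx : x ∈ I.L) :
    ∃ i < I.L.card, (I.indexed ℓ).loc i = x := by
  obtain ⟨i, hi⟩ := I.location.surjective ⟨x, hx⟩
  exact ⟨i, i.2, by rw [I.indexed_loc ℓ i.2, Fin.eta, hi]⟩

theorem indexed_client_injOn :
    Set.InjOn (I.indexed ℓ).client (Finset.range I.C.card) := by
  intro x hx y hy hxy
  simp only [Finset.coe_range, Set.mem_Iio] at hx hy
  rw [I.indexed_client ℓ hx, I.indexed_client ℓ hy] at hxy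
  simpa using I.client.injective (Subtype.val_injective hxy)

theorem indexed_client_mem {x : ℕ} (hx : x < I.C.card) : (I.indexed ℓ).client x ∈ I.C := by
  rw [I.indexed_client ℓ hx]
  exact Subtype.coe_prop _

open Classical in
theorem image_filter_client {S : Finset X} (hS : S ⊆ I.C) :
    {x ∈ Finset.range I.C.card | (I.indexed ℓ).client x ∈ S}.image (I.indexed ℓ).client = S := by
  ext x
  simp only [Finset.mem_image, Finset.mem_filter, Finset.mem_range]
  constructor
  · rintro ⟨i, ⟨-, hi⟩, rfl⟩
    exact hi
  · intro hx
    obtain ⟨i, hi, rfl⟩ := I.exists_client_index ℓ (hS hx)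
    exact ⟨i, ⟨hi, hx⟩, rfl⟩

theorem sum_labelled {σ : State} {p : ℕ → Prop} [DecidablePred p] (G : X → ℝ) :
    ∑ x ∈ I.labelled σ p, G x
      = ∑ i ∈ Finset.range I.C.card with p (σ.nat 2 i), G ((I.indexed ℓ).client i) := by
  rw [labelled, Finset.sum_map, Finset.sum_filter, Finset.sum_filter, Finset.sum_range]
  refine Finset.sum_congr rfl fun i _ => ?_
  rw [I.indexed_client ℓ i.2]
  rfl

variable [MetricSpace X]

theorem represents_indexed : Represents (I.env ℓ) (I.indexed ℓ) where
  dist x f hx hf := by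
    have hf' : I.C.card + f < I.n := Nat.add_lt_add_left hf _
    -- If there are no clients, index `0` denotes the first location, so the query is still
    -- legitimate.
    have hx' : x < I.n := by
      change x < max I.C.card 1 at hx
      have := I.n_pos
      rcases lt_max_iff.1 hx with h | h
      · exact h.trans_le (Nat.le_add_right _ _)
      · omega
    change (I.env ℓ).dist x (I.C.card + f) = dist (I.pointNat x) (I.pointNat (I.C.card + f))
    simp only [env, pointNat, dif_pos hx', dif_pos hf', dif_pos (And.intro hx' hf')]
  ell := rfl

theorem exists_clustering_cost_eq :
    ∃ S : IndexedInstance.Clustering (I.indexed ℓ) I.k, S.cost = I.opt ℓ := by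
  classical
  obtain ⟨Z, 𝒞, f, h, hf, hopt⟩ := I.exists_optimal ℓ
  choose g hg hgf using fun j => I.exists_loc_index ℓ (hf j)
  have hinj : ∀ S : Finset X, Set.InjOn (I.indexed ℓ).client
      (({x ∈ Finset.range I.C.card | (I.indexed ℓ).client x ∈ S} : Finset ℕ) : Set ℕ) := fun S =>
    (I.indexed_client_injOn ℓ).mono (Finset.coe_subset.2 (Finset.filter_subset _ _))
  refine ⟨⟨fun j => {x ∈ Finset.range I.C.card | (I.indexed ℓ).client x ∈ 𝒞 j}, g,
    fun j => Finset.filter_subset _ _, ?_, ?_, hg⟩, ?_⟩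
  · intro i j hij
    refine Finset.disjoint_left.2 fun x hx hx' => ?_
    exact Finset.disjoint_left.1 (h.2.2.1 hij) (Finset.mem_filter.1 hx).2
      (Finset.mem_filter.1 hx').2
  · have : (Finset.univ.biUnion fun j =>
        {x ∈ Finset.range I.C.card | (I.indexed ℓ).client x ∈ 𝒞 j})
        = {x ∈ Finset.range I.C.card | (I.indexed ℓ).client x ∈ I.C \ Z} := by
      ext x
      simp only [Finset.mem_biUnion, Finset.mem_univ, true_and, Finset.mem_filter,
        Finset.mem_sdiff, ← h.2.2.2, exists_and_left]
    rw [this, ← Finset.card_image_of_injOn (hinj _),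
      I.image_filter_client ℓ Finset.sdiff_subset, Finset.card_sdiff_of_subset h.1, h.2.1]
    exact Nat.sub_add_cancel I.m_le
  · rw [hopt]
    refine Finset.sum_congr rfl fun j _ => ?_
    have e := Finset.sum_image (f := fun x => dist x (f j) ^ ℓ) (hinj (𝒞 j))
    rw [I.image_filter_client ℓ (h.subset j)] at e
    rw [e]
    refine Finset.sum_congr rfl fun x _ => ?_
    change dist _ ((I.indexed ℓ).loc (g j)) ^ ℓ = _
    rw [hgf]

/-- The saved cost is that of the identity matching of clusters and centers, which bounds the
minimum over all permutations. Regrouping the clients outside `M` by label turns one sum into the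
other. -/
theorem isApproxOutput_of_saved {σ : State} {v ρ : ℝ} (h : Saved (I.indexed ℓ) I.k v σ)
    (hv : v ≤ ρ * I.opt ℓ) : I.IsApproxOutput ℓ ρ σ := by
  classical
  obtain ⟨hlt, hinj, M, hM, hMc, hlab, hcost⟩ := h
  change M ⊆ Finset.range I.C.card at hM
  change M.card = I.m at hMc
  change ∀ x < I.C.card, _ at hlab
  have hloc : ∀ j : Fin I.k, (I.indexed ℓ).loc (σ.nat 1 j) = I.location ⟨σ.nat 1 j, hlt j j.2⟩ :=
    fun j => I.indexed_loc ℓ (hlt j j.2)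
  refine ⟨fun j => I.location ⟨σ.nat 1 j, hlt j j.2⟩, fun j => ⟨hlt j j.2, rfl⟩,
    ⟨fun i j hij => ?_, fun j => Subtype.coe_prop _⟩, ⟨?_, ?_, ?_, ?_⟩, ?_⟩
  · have : σ.nat 1 i = σ.nat 1 j :=
      congrArg Fin.val (I.location.injective (Subtype.val_injective hij))
    exact Fin.ext (hinj (by simp) (by simp) this)
  · intro x hx
    obtain ⟨i, -, h, rfl⟩ := I.mem_labelled.1 hx
    exact Subtype.coe_prop _
  · rw [labelled, Finset.card_map, ← hMc, ← Finset.card_map Fin.valEmbedding]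
    congr 1
    ext i
    simp only [Finset.mem_map, Finset.mem_filter, Finset.mem_univ, true_and, Fin.valEmbedding_apply]
    constructor
    · rintro ⟨i, hi, rfl⟩
      by_contra hiM
      exact absurd ((hlab i i.2).2 hiM) (not_lt.2 hi)
    · intro hi
      have hlt := Finset.mem_range.1 (hM hi)
      refine ⟨⟨i, hlt⟩, ?_, rfl⟩
      by_contra hc
      exact (hlab i hlt).1 (not_le.1 hc) hi
  · intro i j hij
    refine Finset.disjoint_left.2 fun x hx hx' => hij ?_
    obtain ⟨a, ha, ha', rfl⟩ := I.mem_labelled.1 hx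
    obtain ⟨b, hb, hb', hab⟩ := I.mem_labelled.1 hx'
    have := I.client.injective (Subtype.val_injective hab)
    simp only [Fin.mk.injEq] at this
    subst this
    exact Fin.ext (ha.symm.trans hb)
  · intro x
    constructor
    · rintro ⟨j, hj⟩
      obtain ⟨a, ha, ha', rfl⟩ := I.mem_labelled.1 hj
      refine ⟨Subtype.coe_prop _, fun hx => ?_⟩
      obtain ⟨b, hb, hb', hab⟩ := I.mem_labelled.1 hx
      have := I.client.injective (Subtype.val_injective hab)
      simp only [Fin.mk.injEq] at this
      subst this
      have := j.2
      omega
    · rintro ⟨hx, hxZ⟩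
      obtain ⟨i, hi⟩ := I.client.surjective ⟨x, hx⟩
      have hk : σ.nat 2 i < I.k := by
        by_contra hk
        exact hxZ (I.mem_labelled.2 ⟨i, not_lt.1 hk, i.2, by rw [Fin.eta, hi]⟩)
      exact ⟨⟨_, hk⟩, I.mem_labelled.2 ⟨i, rfl, i.2, by rw [Fin.eta, hi]⟩⟩
  · refine (I.psi_le ℓ _ _).trans (le_trans (le_of_eq ?_) hv)
    rw [← hcost, Finset.sdiff_eq_filter, Finset.sum_filter]
    simp only [I.sum_labelled ℓ, Finset.sum_filter]
    rw [Finset.sum_comm]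
    refine Finset.sum_congr rfl fun x hx => ?_
    have hxC := Finset.mem_range.1 hx
    by_cases hxM : x ∈ M
    · rw [if_neg (not_not.2 hxM)]
      refine Finset.sum_eq_zero fun j _ => if_neg fun hj => ?_
      exact (hlab x hxC).1 (hj ▸ j.2) hxM
    · rw [if_pos hxM]
      have hk : σ.nat 2 x < I.k := (hlab x hxC).2 hxM
      rw [Finset.sum_eq_single (⟨_, hk⟩ : Fin I.k)]
      · rw [if_pos rfl, ← hloc ⟨_, hk⟩]
        rfl
      · intro j _ hj
        exact if_neg fun h => hj (Fin.ext h.symm)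
      · simp

end ListedInstance

/-! ### Assembly -/

theorem mainTheorem7 :
    ∃ (P : RealRAM.Cmd) (c : ℝ), 0 < c ∧
      ∀ (X : Type*) [MetricSpace X] (I : ListedInstance X) (ℓ ε : ℝ),
        1 ≤ ℓ → 0 < ε → ε ≤ 1 →
        ∃ out : (ℕ → unitInterval) → RealRAM.State,
          (∀ ω, ∃ t : ℕ, RealRAM.Exec (I.env ℓ) P (I.init ℓ ε ω) t (out ω) ∧
            (t : ℝ) ≤ c * I.n * (max 2 (((I.k : ℝ) + I.m) / ε)) ^ (c * I.k * ℓ ^ 2)) ∧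
          RealRAM.tapeLaw {ω | ¬ I.IsApproxOutput ℓ ((3 : ℝ) ^ ℓ + ε) (out ω)} ≤ 1 / 2 ∧
          (I.C ⊆ I.L →
            RealRAM.tapeLaw {ω | ¬ I.IsApproxOutput ℓ ((2 : ℝ) ^ ℓ + ε) (out ω)} ≤ 1 / 2) := by
  refine ⟨RealRAM.Cmd.service, 1318, by norm_num, fun X _ I ℓ ε hℓ hε hε1 => ?_⟩
  have hL : 0 < I.L.card := I.k_pos.trans_le I.k_le
  have hrun : ∀ ω, RealRAM.Halts (I.env ℓ) .service (I.init ℓ ε ω) _ _ := fun ω =>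
    RealRAM.Cmd.service_halts (ε := ε) (I.represents_indexed ℓ) I.k_pos I.m_le I.k_le
      (I.input_init ℓ ε ω) (by simp [ListedInstance.init]) (by simp [ListedInstance.init]) hε
  choose t out hexec ht hout using hrun
  obtain ⟨S, hS⟩ := I.exists_clustering_cost_eq ℓ
  have hopt : 0 ≤ I.opt ℓ := hS ▸ S.cost_nonneg
  -- At least one trial is performed, so the output arrays do hold a solution.
  have hN : 0 < RealRAM.numTrials I.k I.m ℓ ε := by
    have : (0 : ℝ) < I.k := by exact_mod_cast I.k_pos
    exact Nat.ceil_pos.2 (by positivity)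
  have hgood : ∀ ω (ρ : ℝ), (∃ t < RealRAM.numTrials I.k I.m ℓ ε, (I.indexed ℓ).ServesWithin
      ((I.indexed ℓ).rounds I.k ∅ fun s => ω (s + t * I.k)) (ρ * I.opt ℓ)) →
      I.IsApproxOutput ℓ ρ (out ω) := by
    rintro ω ρ ⟨s, hs, N, hN', hc, hle⟩
    obtain ⟨hsol, hbest⟩ := (hout ω).resolve_left hN.ne'
    exact I.isApproxOutput_of_saved ℓ hsol.2 ((hbest s hs N hN' hc).trans hle)
  have hprob : ∀ β : ℝ, 1 ≤ β → β ≤ 2 →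
      IndexedInstance.Clustering.Reaches (I.indexed ℓ) β →
      RealRAM.tapeLaw {ω | ¬ I.IsApproxOutput ℓ ((1 + β) ^ ℓ + ε) (out ω)} ≤ 1 / 2 := by
    intro β hβ hβ2 hR
    rcases I.m_le.lt_or_eq with hm | hm
    · have h := S.tapeLaw_real_numTrials_le hℓ hm I.k_pos I.k_le hβ hβ2 hε hε1 hR
      have h' : RealRAM.tapeLaw.real {ω | ¬ I.IsApproxOutput ℓ ((1 + β) ^ ℓ + ε) (out ω)}
          ≤ 1 / 2 := by
        refine (measureReal_mono ?_).trans h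
        intro ω hω s hs h
        rw [hS] at h
        exact hω (hgood ω _ ⟨s, hs, h⟩)
      rw [measureReal_def] at h'
      rw [← ENNReal.ofReal_toReal (measure_ne_top RealRAM.tapeLaw _)]
      refine (ENNReal.ofReal_le_ofReal h').trans_eq ?_
      rw [one_div, one_div, ENNReal.ofReal_inv_of_pos (by norm_num), ENNReal.ofReal_ofNat]
    -- If all clients are outliers, the sampling analysis does not apply, but every trial has cost
    -- zero.
    · have : {ω | ¬ I.IsApproxOutput ℓ ((1 + β) ^ ℓ + ε) (out ω)} = ∅ := by
        refine Set.eq_empty_iff_forall_notMem.2 fun ω hω => hω (hgood ω _ ⟨0, hN, ?_⟩)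
        refine ⟨Finset.range I.C.card, Finset.Subset.rfl, by rw [Finset.card_range, ← hm]; rfl, ?_⟩
        change ∑ x ∈ Finset.range I.C.card \ Finset.range I.C.card, _ ≤ _
        rw [Finset.sdiff_self, Finset.sum_empty]
        positivity
      rw [this, measure_empty]
      exact zero_le
  refine ⟨out, fun ω => ⟨t ω, hexec ω, ?_⟩, ?_, fun hCL => ?_⟩
  · refine le_trans (Nat.cast_le.2 (ht ω)) ?_
    exact service_time_le hℓ hε hε1 I.k_pos hL
  · have := hprob 2 (by norm_num) le_rfl (IndexedInstance.Clustering.reaches_two _)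
    norm_num at this ⊢
    exact this
  · have := hprob 1 le_rfl (by norm_num) (IndexedInstance.Clustering.reaches_one fun x hx =>
      I.exists_loc_index ℓ (hCL (I.indexed_client_mem ℓ hx)))
    norm_num at this ⊢
    exact this
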